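/- Let $\Gamma$ be a countable discrete group acting by homeomorphisms on a compact Hausdorff space $X$, let $p\in[1,\infty)$, and let $l:\Gamma\to\mathbb{N}$ be a proper length function: $l(g)=0$ iff $g=e$, $l(g^{-1})=l(g)$, $l(gh)\le l(g)+l(h)$, and $\{g:l(g)\le n\}$ is finite for every $n$. Put $d(g,h)=l(gh^{-1})$. Let $s\ge 0$. Let $P_s(\Gamma)$ be the Rips complex at scale $s$, i.e. the set of formal convex combinations $z=\sum_g t_g(z)\,g$ with finite support $\mathrm{supp}(z)=\{g:t_g(z)\ne0\}$ satisfying $d(g,h)\le s$ for all $g,h\in\mathrm{supp}(z)$, with the $\ell^1$ metric, and let $Z_s\subseteq P_s(\Gamma)$ be the set of points with rational coordinates. Let $E_s=\ell^p(Z_s)\otimes\ell^p(X)\otimes\ell^p\otimes\ell^p(\Gamma)=\ell^p(Z_s\times X\times\mathbb{N}\times\Gamma)$ with the $\Gamma$-action $u_g(\delta_z\otimes\delta_x\otimes\eta\otimes\delta_h)=\delta_{zg^{-1}}\otimes\delta_{gx}\otimes\eta\otimes\delta_{gh}$. Write $T\in B(E_s)$ as a matrix $(T_{y,z})_{y,z\in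 Z_s}$ with $T_{y,z}\in B(\ell^p(X)\otimes\ell^p\otimes\ell^p(\Gamma))$. Let $\mathcal K_\Gamma$ be the algebra of compact operators on $\ell^p\otimes\ell^p(\Gamma)$. Let $\mathbb{C}[\Gamma\curvearrowright X;s]$ be the algebra of all $T\in B(E_s)$ such that * $u_gTu_g^{-1}=T$ for all $g\in\Gamma$; * $T_{y,z}\in C(X)\otimes\mathcal K_\Gamma=C(X,\mathcal K_\Gamma)$ for all $y,z$, and for every compact $F\subseteq P_s(\Gamma)$ only finitely many $(y,z)\in F\times F$ have $T_{y,z}\neq0$; * the $\Gamma$-propagation $\sup\{d(g,h): T_{y,z}\ne0 \text{ for some } y,z\in Z_s \text{ with } g\in\mathrm{supp}(y),\ h\in\mathrm{supp}(z)\}$ is finite. The Rips-propagation of $T$ is $\sup\{d_{P_s(\Gamma)}(y,z):T_{y,z}\neq0\}$. Let $\Gamma\ltimes X=\{(gx,g,x):g\in\Gamma,\ x\in X\}$ be the transformation groupoid, with the topology of $\Gamma\times X$. The support of $T$ is the set of all $(gx,gh^{-1},hx)$ such that $T_{y,z}(x)\neq0$ for some $y,z\in Z_s$ with $g\in\mathrm{supp}(y)$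 and $h\in\mathrm{supp}(z)$. For an open subgroupoid $G$ of $\Gamma\ltimes X$, let $\mathbb{C}_{L,0}[G;s]$ be the algebra of all bounded, uniformly continuous functions $a:[0,\infty)\to\mathbb{C}[\Gamma\curvearrowright X;s]$ with $a(0)=0$ such that the $\Gamma$-propagation of $a(t)$ is bounded uniformly in $t$, the Rips-propagation of $a(t)$ tends to $0$ as $t\to\infty$, and $\bigcup_{t\ge0}\mathrm{supp}(a(t))$ is contained in a compact subset of $G$. Let $A^s(G)=B^p_{L,0}(G;s)$ be its closure in the norm $\|a\|=\sup_{t\ge0}\|a(t)\|$. **Proposition.** Let $G$ be an open subgroupoid of $\Gamma\ltimes X$ with $G\subseteq\{(gx,g,x)\in\Gamma\ltimes X: l(g)\le s\}$. Then the Banach algebra $K$-theory groups of $A^s(G)=B^p_{L,0}(G;s)$ vanish: $K_0(A^s(G))=0$ and $K_1(A^s(G))=0$. -/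

import Mathlib

open scoped Topology ENNReal NNReal BoundedContinuousFunction
open Filter

noncomputable section

namespace KTheory

/-! ### `K₀` of a unital ring: idempotent matrices up to algebraic equivalence -/

section KZero

/-- Algebraic (Murray–von Neumann) equivalence of square matrices: `e = x y` and `f = y x`. -/
def MvN {R ι κ : Type*} [Ring R] [Fintype ι] [Fintype κ]
    (e : Matrix ι ι R) (f : Matrix κ κ R) : Prop :=
  ∃ (x : Matrix ι κ R) (y : Matrix κ ι R), e = x * y ∧ f = y * x

theorem MvN.symm {R ι κ : Type*} [Ring R] [Fintype ι] [Fintype κ]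
    {e : Matrix ι ι R} {f : Matrix κ κ R} (h : MvN e f) : MvN f e := by
  obtain ⟨x, y, h1, h2⟩ := h
  exact ⟨y, x, h2, h1⟩

theorem MvN.refl {R ι : Type*} [Ring R] [Fintype ι]
    {e : Matrix ι ι R} (he : e * e = e) : MvN e e :=
  ⟨e, e, he.symm, he.symm⟩

theorem MvN.trans {R ι κ σ : Type*} [Ring R] [Fintype ι] [Fintype κ] [Fintype σ]
    {e : Matrix ι ι R} {f : Matrix κ κ R} {g : Matrix σ σ R}
    (he : e * e = e) (hg : g * g = g) (h : MvN e f) (h' : MvN f g) : MvN e g := by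
  obtain ⟨x, y, h1, h2⟩ := h
  obtain ⟨u, v, h3, h4⟩ := h'
  refine ⟨x * u, v * y, ?_, ?_⟩
  · have : x * u * (v * y) = x * (u * v) * y := by simp only [Matrix.mul_assoc]
    rw [this, ← h3, h2]
    have : x * (y * x) * y = (x * y) * (x * y) := by simp only [Matrix.mul_assoc]
    rw [this, ← h1, he]
  · have : v * y * (x * u) = v * (y * x) * u := by simp only [Matrix.mul_assoc]
    rw [this, ← h2, h3]
    have : v * (u * v) * u = (v * u) * (v * u) := by simp only [Matrix.mul_assoc]
    rw [this, ← h4, hg]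

theorem MvN.submatrix {R ι κ : Type*} [Ring R] [Fintype ι] [Fintype κ]
    {e : Matrix ι ι R} (he : e * e = e) (σ : κ ≃ ι) : MvN (e.submatrix σ σ) e := by
  refine ⟨e.submatrix σ id, e.submatrix id σ, ?_, ?_⟩
  · rw [← Matrix.submatrix_mul _ _ _ _ _ Function.bijective_id, he]
  · rw [← Matrix.submatrix_mul _ _ _ _ _ σ.bijective, he, Matrix.submatrix_id_id]

theorem MvN.fromBlocks {R ι κ ι' κ' : Type*} [Ring R] [Fintype ι] [Fintype κ] [Fintype ι']
    [Fintype κ'] {e : Matrix ι ι R} {f : Matrix κ κ R} {e' : Matrix ι' ι' R}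
    {f' : Matrix κ' κ' R} (h : MvN e f) (h' : MvN e' f') :
    MvN (Matrix.fromBlocks e 0 0 e') (Matrix.fromBlocks f 0 0 f') := by
  obtain ⟨x, y, h1, h2⟩ := h
  obtain ⟨u, v, h3, h4⟩ := h'
  refine ⟨Matrix.fromBlocks x 0 0 u, Matrix.fromBlocks y 0 0 v, ?_, ?_⟩ <;>
    simp [Matrix.fromBlocks_multiply, *]

/-- Idempotent matrices of all sizes over `R`. -/
structure Idem (R : Type*) [Ring R] where
  size : ℕ
  mat : Matrix (Fin size) (Fin size) R
  idem : mat * mat = mat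

variable {R S : Type*} [Ring R] [Ring S]

/-- The block-diagonal sum of idempotent matrices. -/
def Idem.sum (e f : Idem R) : Idem R where
  size := e.size + f.size
  mat := (Matrix.fromBlocks e.mat 0 0 f.mat).submatrix finSumFinEquiv.symm finSumFinEquiv.symm
  idem := by
    rw [← Matrix.submatrix_mul _ _ _ _ _ finSumFinEquiv.symm.bijective]
    simp [Matrix.fromBlocks_multiply, e.idem, f.idem]

/-- The image of an idempotent matrix under a ring homomorphism. -/
def Idem.map (φ : R →+* S) (e : Idem R) : Idem S where
  size := e.size
  mat := e.mat.map φ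
  idem := by rw [← Matrix.map_mul, e.idem]

theorem Idem.sum_mvN (e f : Idem R) :
    MvN (e.sum f).mat (Matrix.fromBlocks e.mat 0 0 f.mat) :=
  MvN.submatrix (by simp [Matrix.fromBlocks_multiply, e.idem, f.idem]) _

variable (R) in
/-- Equivalence of idempotent matrices. -/
def idemSetoid : Setoid (Idem R) where
  r e f := MvN e.mat f.mat
  iseqv := ⟨fun e => MvN.refl e.idem, MvN.symm, fun {e _ g} h h' => MvN.trans e.idem g.idem h h'⟩

variable (R) in
/-- The monoid `V(R)` of equivalence classes of idempotent matrices over `R`. -/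
def V : Type _ := Quotient (idemSetoid R)

theorem fromBlocks_idem {ι κ : Type*} [Fintype ι] [Fintype κ] {e : Matrix ι ι R}
    {f : Matrix κ κ R} (he : e * e = e) (hf : f * f = f) :
    Matrix.fromBlocks e 0 0 f * Matrix.fromBlocks e 0 0 f = Matrix.fromBlocks e 0 0 f := by
  simp [Matrix.fromBlocks_multiply, he, hf]

theorem Idem.sum_congr {e f e' f' : Idem R} (h : MvN e.mat f.mat) (h' : MvN e'.mat f'.mat) :
    MvN (e.sum e').mat (f.sum f').mat :=
  MvN.trans (e.sum e').idem (f.sum f').idem (e.sum_mvN e')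
    (MvN.trans (fromBlocks_idem e.idem e'.idem) (f.sum f').idem (MvN.fromBlocks h h')
      (f.sum_mvN f').symm)

instance : Add (V R) :=
  ⟨Quotient.map₂ Idem.sum fun _ _ h _ _ h' => Idem.sum_congr h h'⟩

instance : Zero (V R) :=
  ⟨Quotient.mk (idemSetoid R) ⟨0, 0, by simp⟩⟩

instance : AddCommMonoid (V R) where
  add_assoc := by
    rintro ⟨e⟩ ⟨f⟩ ⟨g⟩
    refine Quotient.sound (s := idemSetoid R) ?_
    change MvN ((e.sum f).sum g).mat (e.sum (f.sum g)).mat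
    have hA := fromBlocks_idem (fromBlocks_idem e.idem f.idem) g.idem
    have hB := fromBlocks_idem e.idem (fromBlocks_idem f.idem g.idem)
    have h1 : MvN ((e.sum f).sum g).mat
        (Matrix.fromBlocks (Matrix.fromBlocks e.mat 0 0 f.mat) 0 0 g.mat) :=
      MvN.trans ((e.sum f).sum g).idem hA ((e.sum f).sum_mvN g)
        (MvN.fromBlocks (e.sum_mvN f) (MvN.refl g.idem))
    have h2 : MvN (e.sum (f.sum g)).mat
        (Matrix.fromBlocks e.mat 0 0 (Matrix.fromBlocks f.mat 0 0 g.mat)) :=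
      MvN.trans (e.sum (f.sum g)).idem hB (e.sum_mvN (f.sum g))
        (MvN.fromBlocks (MvN.refl e.idem) (f.sum_mvN g))
    have h3 := MvN.submatrix hB (Equiv.sumAssoc (Fin e.size) (Fin f.size) (Fin g.size))
    have h4 : (Matrix.fromBlocks e.mat 0 0 (Matrix.fromBlocks f.mat 0 0 g.mat)).submatrix
        (Equiv.sumAssoc (Fin e.size) (Fin f.size) (Fin g.size))
        (Equiv.sumAssoc (Fin e.size) (Fin f.size) (Fin g.size)) =
        Matrix.fromBlocks (Matrix.fromBlocks e.mat 0 0 f.mat) 0 0 g.mat := by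
      ext ((i | i) | i) ((j | j) | j) <;> rfl
    rw [h4] at h3
    exact MvN.trans ((e.sum f).sum g).idem (e.sum (f.sum g)).idem h1
      (MvN.trans hA (e.sum (f.sum g)).idem h3 h2.symm)
  zero_add := by
    rintro ⟨e⟩
    refine Quotient.sound (s := idemSetoid R) ?_
    change MvN (Idem.sum ⟨0, 0, by simp⟩ e).mat e.mat
    refine MvN.trans (Idem.idem _) e.idem (Idem.sum_mvN _ _) ?_
    have h := MvN.submatrix e.idem (Equiv.emptySum (Fin 0) (Fin e.size))
    convert h using 1
    ext (i | i) (j | j)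
    · exact i.elim0
    · exact i.elim0
    · exact j.elim0
    · rfl
  add_zero := by
    rintro ⟨e⟩
    refine Quotient.sound (s := idemSetoid R) ?_
    change MvN (Idem.sum e ⟨0, 0, by simp⟩).mat e.mat
    refine MvN.trans (Idem.idem _) e.idem (Idem.sum_mvN _ _) ?_
    have h := MvN.submatrix e.idem (Equiv.sumEmpty (Fin e.size) (Fin 0))
    convert h using 1
    ext (i | i) (j | j)
    · rfl
    · exact j.elim0
    · exact i.elim0
    · exact i.elim0
  add_comm := by
    rintro ⟨e⟩ ⟨f⟩
    refine Quotient.sound (s := idemSetoid R) ?_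
    change MvN (e.sum f).mat (f.sum e).mat
    have hB := fromBlocks_idem f.idem e.idem
    have h3 := MvN.submatrix hB (Equiv.sumComm (Fin e.size) (Fin f.size))
    have h4 : (Matrix.fromBlocks f.mat 0 0 e.mat).submatrix
        (Equiv.sumComm (Fin e.size) (Fin f.size)) (Equiv.sumComm (Fin e.size) (Fin f.size)) =
        Matrix.fromBlocks e.mat 0 0 f.mat := by
      ext (i | i) (j | j) <;> rfl
    rw [h4] at h3
    exact MvN.trans (e.sum f).idem (f.sum e).idem (e.sum_mvN f)
      (MvN.trans (fromBlocks_idem e.idem f.idem) (f.sum e).idem h3 (f.sum_mvN e).symm)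
  nsmul := nsmulRec

/-- The additive map `V(R) → V(S)` induced by a ring homomorphism. -/
def V.map (φ : R →+* S) : V R →+ V S where
  toFun := Quotient.map (Idem.map φ) fun e f ⟨x, y, h1, h2⟩ =>
    ⟨x.map φ, y.map φ, by simp only [Idem.map, h1, Matrix.map_mul]; rfl,
      by simp only [Idem.map, h2, Matrix.map_mul]; rfl⟩
  map_zero' := by
    refine congrArg (Quotient.mk (idemSetoid S)) ?_
    simp only [Idem.map, Idem.mk.injEq, heq_eq_eq, true_and]
    exact Subsingleton.elim _ _
  map_add' := by
    rintro ⟨e⟩ ⟨f⟩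
    refine congrArg (Quotient.mk (idemSetoid S)) ?_
    simp only [Idem.map, Idem.sum, Idem.mk.injEq, heq_eq_eq, true_and]
    rw [← Matrix.submatrix_map, Matrix.fromBlocks_map]
    simp only [Matrix.map_zero _ (map_zero φ)]
    rfl

variable (R) in
/-- `K₀` of a unital ring: the Grothendieck group of `V(R)`. -/
abbrev K0Unital : Type _ := Algebra.GrothendieckAddGroup (V R)

/-- The map on `K₀` induced by a unital ring homomorphism. -/
def K0Unital.map (φ : R →+* S) : K0Unital R →+ K0Unital S :=
  Algebra.GrothendieckAddGroup.lift (Algebra.GrothendieckAddGroup.of.comp (V.map φ))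

end KZero

/-! ### `K₁` of a unital topological ring: `π₀` of the stable general linear group -/

section KOne

/-- The corner embedding `a ↦ a ⊕ 1` of `n × n` matrices into `m × m` matrices, `n ≤ m`. -/
def padMatrix {R : Type*} [Ring R] (n m : ℕ) (a : Matrix (Fin n) (Fin n) R) :
    Matrix (Fin m) (Fin m) R :=
  Matrix.of fun i j =>
    if h : (i : ℕ) < n ∧ (j : ℕ) < n then a ⟨i, h.1⟩ ⟨j, h.2⟩ else if i = j then 1 else 0

variable {R : Type*} [Ring R]

theorem padMatrix_one {n m : ℕ} : padMatrix n m (1 : Matrix (Fin n) (Fin n) R) = 1 := by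
  ext i j
  simp only [padMatrix, Matrix.of_apply, Matrix.one_apply]
  split_ifs <;> simp_all [Fin.ext_iff]

theorem padMatrix_mul {n m : ℕ} (hnm : n ≤ m) (a b : Matrix (Fin n) (Fin n) R) :
    padMatrix n m (a * b) = padMatrix n m a * padMatrix n m b := by
  ext i j
  obtain ⟨k, rfl⟩ := Nat.exists_eq_add_of_le hnm
  simp only [padMatrix, Matrix.of_apply, Matrix.mul_apply, Fin.sum_univ_add]
  by_cases hi : (i : ℕ) < n
  · by_cases hj : (j : ℕ) < n
    · have hz : ∀ x : Fin k, ¬ ((i : ℕ) = n + x) := fun x => by omega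
      simp [hi, hj, Fin.ext_iff, hz]
    · have hz : ∀ x : Fin n, ¬ ((x : ℕ) = j) := fun x => by omega
      have hz' : ∀ x : Fin k, ¬ ((i : ℕ) = n + x) := fun x => by omega
      have hz2 : ¬ ((i : ℕ) = j) := by omega
      simp [hi, hj, Fin.ext_iff, hz, hz', hz2]
  · have hz : ∀ x : Fin n, ¬ ((i : ℕ) = x) := fun x => by omega
    obtain ⟨x, hx⟩ : ∃ x : Fin k, i = Fin.natAdd n x :=
      ⟨⟨i - n, by omega⟩, by ext; simp; omega⟩
    simp [hi, Fin.ext_iff, hz]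
    subst hx
    rw [Finset.sum_eq_single x]
    · simp
    · intro y _ hy
      simp [Fin.val_inj, hy.symm]
    · simp

theorem padMatrix_self {n : ℕ} (a : Matrix (Fin n) (Fin n) R) : padMatrix n n a = a := by
  ext i j
  simp [padMatrix]

theorem padMatrix_padMatrix {n m k : ℕ} (hnm : n ≤ m)
    (a : Matrix (Fin n) (Fin n) R) : padMatrix m k (padMatrix n m a) = padMatrix n k a := by
  ext i j
  simp only [padMatrix, Matrix.of_apply, Fin.ext_iff]
  split_ifs <;> first | rfl | omega

theorem continuous_padMatrix [TopologicalSpace R] (n m : ℕ) :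
    Continuous (padMatrix n m : Matrix (Fin n) (Fin n) R → _) := by
  refine continuous_matrix fun i j => ?_
  simp only [padMatrix, Matrix.of_apply]
  split_ifs
  · exact continuous_id.matrix_elem _ _
  · exact continuous_const
  · exact continuous_const

variable (R) in
/-- The general linear group `GL_n(R)`. -/
abbrev GLn (n : ℕ) : Type _ := (Matrix (Fin n) (Fin n) R)ˣ

/-- The embedding `u ↦ u ⊕ 1` of `GL_n(R)` into `GL_m(R)`. -/
def padGL (n m : ℕ) (h : n ≤ m) : GLn R n →* GLn R m :=
  Units.map ⟨⟨padMatrix n m, padMatrix_one⟩, padMatrix_mul h⟩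

variable [TopologicalSpace R]

theorem continuous_padGL (n m : ℕ) (h : n ≤ m) :
    Continuous (padGL n m h : GLn R n → GLn R m) :=
  Continuous.units_map _ (continuous_padMatrix n m)

variable [IsTopologicalRing R]

variable (R) in
/-- The group of path components of `GL_n(R)`. -/
abbrev PiZeroGL (n : ℕ) : Type _ := GLn R n ⧸ Subgroup.pathComponentOne (GLn R n)

/-- The map induced by `u ↦ u ⊕ 1` on path components. -/
def padPiZero (n m : ℕ) (h : n ≤ m) : PiZeroGL R n →* PiZeroGL R m :=
  QuotientGroup.map _ _ (padGL n m h) fun u hu => by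
    have hu' : Joined (1 : GLn R n) u := hu
    have : Joined (padGL n m h 1) (padGL n m h u) := hu'.map (continuous_padGL n m h)
    rw [map_one] at this
    exact this

instance : DirectedSystem (PiZeroGL R) (padPiZero (R := R) · · ·) where
  map_self n x := by
    obtain ⟨u, rfl⟩ := QuotientGroup.mk_surjective x
    exact congrArg QuotientGroup.mk (Units.ext (padMatrix_self _))
  map_map {k j i} hij hjk x := by
    obtain ⟨u, rfl⟩ := QuotientGroup.mk_surjective x
    exact congrArg QuotientGroup.mk (Units.ext (padMatrix_padMatrix hij _))

variable (R) in
/-- `K₁` of a unital topological ring: the direct limit over `n` of the groups of path components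
of `GL_n(R)`, along `u ↦ u ⊕ 1`. -/
abbrev K1Unital : Type _ := DirectLimit (PiZeroGL R) (padPiZero (R := R))

end KOne

/-! ### `K`-theory of a Banach algebra that need not have a unit -/

section Banach

variable (A : Type*) [NonUnitalNormedRing A] [NormedSpace ℂ A] [IsScalarTower ℂ A A]
  [SMulCommClass ℂ A A]

/-- The unitization `A⁺ = ℂ ⊕ A`, with the norm `‖(c, a)‖ = |c| + ‖a‖`. -/
abbrev Unitized : Type _ := WithLp 1 (Unitization ℂ A)

/-- The augmentation `A⁺ → ℂ`. -/
def augmentation : Unitized A →+* ℂ :=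
  ((Unitization.fstHom ℂ A).comp
    (WithLp.unitizationAlgEquiv (𝕜 := ℂ) (A := A) ℂ).toAlgHom).toRingHom

/-- `K₀(A)`: the kernel of `K₀(A⁺) → K₀(ℂ)`. -/
abbrev K0 : Type _ := (K0Unital.map (augmentation A)).ker

/-- `K₁(A) = GL_∞(A⁺) / GL_∞(A⁺)₀`. -/
abbrev K1 : Type _ := K1Unital (Unitized A)

end Banach

end KTheory

namespace LpRoe

/-- A proper length function `l : Γ → ℕ` on a group; the associated right invariant metric is
`d(g, h) = l(g h⁻¹)`. -/
structure ProperLength (Γ : Type*) [Group Γ] where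
  toFun : Γ → ℕ
  eq_zero_iff : ∀ g, toFun g = 0 ↔ g = 1
  inv_eq : ∀ g, toFun g⁻¹ = toFun g
  mul_le : ∀ g h, toFun (g * h) ≤ toFun g + toFun h
  finite_ball : ∀ n, {g | toFun g ≤ n}.Finite

instance {Γ : Type*} [Group Γ] : CoeFun (ProperLength Γ) fun _ => Γ → ℕ := ⟨ProperLength.toFun⟩

theorem ProperLength.finite_ball_real {Γ : Type*} [Group Γ] (l : ProperLength Γ) (r : ℝ) :
    {g | (l g : ℝ) ≤ r}.Finite := by
  refine (l.finite_ball ⌈r⌉₊).subset fun g hg => ?_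
  have : (l g : ℝ) ≤ ⌈r⌉₊ := le_trans hg (Nat.le_ceil r)
  exact_mod_cast this

/-! ### The Rips complex -/

section Rips

/-- The `ℓ¹` distance. -/
def l1dist {Γ : Type*} (y z : Γ →₀ ℝ) : ℝ := (y - z).sum fun _ a => |a|

theorem l1dist_eq {Γ : Type*} {y z : Γ →₀ ℝ} {B : Finset Γ} (hy : y.support ⊆ B) (hz : z.support ⊆ B) :
    l1dist y z = ∑ g ∈ B, |y g - z g| := by
  classical
  refine Finsupp.sum_of_support_subset _ ?_ _ (by simp)
  exact (Finsupp.support_sub).trans (Finset.union_subset hy hz)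

/-- The points `∑ t_g g` of the Rips complex `P_s(Γ)`, given by their barycentric coordinates
`g ↦ t_g`. -/
@[ext]
structure Rips {Γ : Type*} [Group Γ] (l : ProperLength Γ) (s : ℝ) where
  coord : Γ →₀ ℝ
  nonneg : ∀ g, 0 ≤ coord g
  sum_eq_one : (coord.sum fun _ a => a) = 1
  length_le : ∀ g ∈ coord.support, ∀ h ∈ coord.support, (l (g * h⁻¹) : ℝ) ≤ s

variable {Γ : Type*} [Group Γ] {l : ProperLength Γ} {s : ℝ}

/-- The set of `g` with nonzero barycentric coordinate. -/
def Rips.supp (z : Rips l s) : Finset Γ := z.coord.support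

theorem Rips.supp_nonempty (z : Rips l s) : z.supp.Nonempty := by
  rw [Finset.nonempty_iff_ne_empty]
  intro h
  have h0 : z.coord = 0 := Finsupp.support_eq_empty.1 h
  have h1 := z.sum_eq_one
  rw [h0, Finsupp.sum_zero_index] at h1
  exact zero_ne_one h1

/-- `P_s(Γ)` carries the `ℓ¹` metric. -/
instance : MetricSpace (Rips l s) where
  dist y z := l1dist y.coord z.coord
  dist_self y := by simp [l1dist]
  dist_comm y z := by
    classical
    have h1 := Finset.subset_union_left (s₁ := y.coord.support) (s₂ := z.coord.support)
    have h2 := Finset.subset_union_right (s₁ := y.coord.support) (s₂ := z.coord.support)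
    change l1dist y.coord z.coord = l1dist z.coord y.coord
    rw [l1dist_eq h1 h2, l1dist_eq h2 h1]
    exact Finset.sum_congr rfl fun g _ => abs_sub_comm _ _
  dist_triangle x y z := by
    classical
    set B := x.coord.support ∪ y.coord.support ∪ z.coord.support
    have h1 : x.coord.support ⊆ B := fun g hg => by simp [B, -Finsupp.mem_support_iff, hg]
    have h2 : y.coord.support ⊆ B := fun g hg => by simp [B, -Finsupp.mem_support_iff, hg]
    have h3 : z.coord.support ⊆ B := fun g hg => by simp [B, -Finsupp.mem_support_iff, hg]
    change l1dist x.coord z.coord ≤ l1dist x.coord y.coord + l1dist y.coord z.coord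
    rw [l1dist_eq h1 h2, l1dist_eq h2 h3, l1dist_eq h1 h3, ← Finset.sum_add_distrib]
    exact Finset.sum_le_sum fun g _ => abs_sub_le _ _ _
  eq_of_dist_eq_zero {y z} h := by
    classical
    have h1 := Finset.subset_union_left (s₁ := y.coord.support) (s₂ := z.coord.support)
    have h2 := Finset.subset_union_right (s₁ := y.coord.support) (s₂ := z.coord.support)
    change l1dist y.coord z.coord = 0 at h
    rw [l1dist_eq h1 h2, Finset.sum_eq_zero_iff_of_nonneg fun g _ => abs_nonneg _] at h
    refine Rips.ext (Finsupp.ext fun g => ?_)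
    by_cases hg : g ∈ y.coord.support ∪ z.coord.support
    · exact sub_eq_zero.1 (abs_eq_zero.1 (h g hg))
    · simp only [Finset.mem_union, Finsupp.mem_support_iff, not_or, not_not] at hg
      rw [hg.1, hg.2]

theorem Rips.dist_def (y z : Rips l s) : dist y z = l1dist y.coord z.coord := rfl

theorem Rips.continuous_coord (g : Γ) : Continuous fun z : Rips l s => z.coord g := by
  classical
  refine (LipschitzWith.of_dist_le_mul (K := 1) fun y z => ?_).continuous
  rw [NNReal.coe_one, one_mul, Real.dist_eq, Rips.dist_def]
  have h1 : y.coord.support ⊆ insert g (y.coord.support ∪ z.coord.support) :=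
    Finset.subset_union_left.trans (Finset.subset_insert _ _)
  have h2 : z.coord.support ⊆ insert g (y.coord.support ∪ z.coord.support) :=
    Finset.subset_union_right.trans (Finset.subset_insert _ _)
  rw [l1dist_eq h1 h2]
  exact Finset.single_le_sum (f := fun g => |y.coord g - z.coord g|) (fun _ _ => abs_nonneg _)
    (Finset.mem_insert_self _ _)

/-- A compact subset of the Rips complex involves only finitely many vertices. -/
theorem Rips.exists_finset_of_isCompact {F : Set (Rips l s)} (hF : IsCompact F) :
    ∃ B : Finset Γ, ∀ z ∈ F, z.supp ⊆ B := by
  classical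
  obtain ⟨t, ht⟩ := hF.elim_finite_subcover (fun g : Γ => {z : Rips l s | z.coord g ≠ 0})
    (fun g => isOpen_ne.preimage (Rips.continuous_coord g)) fun z _ => by
      obtain ⟨g, hg⟩ := z.supp_nonempty
      exact Set.mem_iUnion.2 ⟨g, Finsupp.mem_support_iff.1 hg⟩
  have hfin : (⋃ g ∈ t, {h | (l (h * g⁻¹) : ℝ) ≤ s}).Finite :=
    t.finite_toSet.biUnion fun g _ =>
      (l.finite_ball_real s).preimage ((mul_left_injective g⁻¹).injOn)
  refine ⟨hfin.toFinset, fun z hz h hh => ?_⟩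
  obtain ⟨g, hg, hzg⟩ := Set.mem_iUnion₂.1 (ht hz)
  rw [Set.Finite.mem_toFinset]
  exact Set.mem_iUnion₂.2 ⟨g, hg, z.length_le h hh g (Finsupp.mem_support_iff.2 hzg)⟩

/-- A finite subcomplex of the Rips complex is compact. -/
theorem Rips.isCompact_of_finset (B : Finset Γ) : IsCompact {z : Rips l s | z.supp ⊆ B} := by
  classical
  let K : Set (B → ℝ) := {t | (∀ b, 0 ≤ t b) ∧ ∑ b, t b = 1 ∧
    ∀ b c : B, t b = 0 ∨ t c = 0 ∨ (l (b * (c : Γ)⁻¹) : ℝ) ≤ s}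
  have hK : IsCompact K := by
    refine (isCompact_stdSimplex ℝ B).of_isClosed_subset ?_ fun t ht => ⟨ht.1, ht.2.1⟩
    simp only [K, Set.ofPred_and, Set.ofPred_forall, Set.ofPred_or]
    refine (isClosed_iInter fun b => isClosed_le continuous_const (continuous_apply b)).inter
      ((isClosed_eq (by fun_prop) continuous_const).inter
      (isClosed_iInter fun b => isClosed_iInter fun c => ?_))
    exact (isClosed_eq (continuous_apply b) continuous_const).union
      ((isClosed_eq (continuous_apply c) continuous_const).union isClosed_const)
  let f : (B → ℝ) → Γ →₀ ℝ := fun t =>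
    Finsupp.onFinset B (fun g => if h : g ∈ B then t ⟨g, h⟩ else 0) fun g hg => by
      by_contra h
      simp [h] at hg
  have hfB : ∀ t, (f t).support ⊆ B := fun t => Finsupp.support_onFinset_subset
  have hf : ∀ t (b : B), f t b = t b := fun t b => by simp [f]
  let φ : K → Rips l s := fun t => by
    refine ⟨f t.1, fun g => ?_, ?_, fun g hg h hh => ?_⟩
    · by_cases h : g ∈ B
      · rw [hf t.1 ⟨g, h⟩]; exact t.2.1 _
      · simp [f, h]
    · rw [Finsupp.sum_of_support_subset _ (hfB t.1) _ (by simp), ← Finset.sum_coe_sort,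
        ← t.2.2.1]
      exact Finset.sum_congr rfl fun b _ => hf _ _
    · have h1 := Finsupp.mem_support_iff.1 hg
      have h2 := Finsupp.mem_support_iff.1 hh
      rw [hf t.1 ⟨g, hfB _ hg⟩] at h1
      rw [hf t.1 ⟨h, hfB _ hh⟩] at h2
      rcases t.2.2.2 ⟨g, hfB _ hg⟩ ⟨h, hfB _ hh⟩ with h3 | h3 | h3
      · exact absurd h3 h1
      · exact absurd h3 h2
      · exact h3
  have hφ : Continuous φ := by
    refine (LipschitzWith.of_dist_le_mul (K := B.card) fun t t' => ?_).continuous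
    rw [Rips.dist_def, l1dist_eq (hfB t.1) (hfB t'.1), ← Finset.sum_coe_sort]
    calc ∑ b : B, |f t.1 b - f t'.1 b| ≤ ∑ _b : B, dist t t' := by
          refine Finset.sum_le_sum fun b _ => ?_
          rw [hf, hf, ← Real.dist_eq]
          exact dist_le_pi_dist t.1 t'.1 b
      _ = _ := by simp
  have := isCompact_iff_compactSpace.1 hK
  convert isCompact_range hφ using 1
  ext z
  constructor
  · intro hz
    refine ⟨⟨fun b => z.coord b, fun b => z.nonneg b, ?_, fun b c => ?_⟩, ?_⟩
    · rw [Finset.sum_coe_sort B fun g => z.coord g]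
      exact (Finsupp.sum_of_support_subset _ hz _ (by simp)).symm.trans z.sum_eq_one
    · by_cases hb : z.coord b = 0
      · exact Or.inl hb
      · by_cases hc : z.1 c = 0
        · exact Or.inr (Or.inl hc)
        · exact Or.inr (Or.inr (z.length_le b (Finsupp.mem_support_iff.2 hb) c
            (Finsupp.mem_support_iff.2 hc)))
    · refine Rips.ext (Finsupp.ext fun g => ?_)
      by_cases h : g ∈ B
      · exact hf _ ⟨g, h⟩
      · have : z.coord g = 0 := by
          by_contra h'
          exact h (hz (Finsupp.mem_support_iff.2 h'))
        rw [this]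
        simp [φ, f, h]
  · rintro ⟨t, rfl⟩
    exact hfB t.1

/-- The right translation action of `Γ` on `P_s(Γ)`: `(∑ t_h h) g = ∑ t_h (h g)`. -/
def Rips.translate (z : Rips l s) (g : Γ) : Rips l s where
  coord := Finsupp.equivMapDomain (Equiv.mulRight g) z.coord
  nonneg h := z.nonneg _
  sum_eq_one := by
    rw [Finsupp.sum_equivMapDomain]
    exact z.sum_eq_one
  length_le h hh k hk := by
    rw [Finsupp.mem_support_iff, Finsupp.equivMapDomain_apply] at hh hk
    have := z.length_le _ (Finsupp.mem_support_iff.2 hh) _ (Finsupp.mem_support_iff.2 hk)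
    simpa using this

theorem Rips.translate_apply (z : Rips l s) (g h : Γ) :
    (z.translate g).coord h = z.coord (h * g⁻¹) := rfl

/-- The set `Z_s` of points of `P_s(Γ)` with rational barycentric coordinates. -/
@[ext]
structure RatRips {Γ : Type*} [Group Γ] (l : ProperLength Γ) (s : ℝ) where
  point : Rips l s
  rational : ∀ g, ∃ q : ℚ, point.coord g = q

/-- Right translation `z ↦ z g` as a permutation of `Z_s`. -/
def RatRips.translate (g : Γ) : RatRips l s ≃ RatRips l s where
  toFun z := ⟨z.point.translate g, fun _ => z.rational _⟩
  invFun z := ⟨z.point.translate g⁻¹, fun _ => z.rational _⟩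
  left_inv z := by
    refine RatRips.ext (Rips.ext (Finsupp.ext fun h => ?_))
    simp [Rips.translate_apply]
  right_inv z := by
    refine RatRips.ext (Rips.ext (Finsupp.ext fun h => ?_))
    simp [Rips.translate_apply]

end Rips

/-! ### The `ℓᵖ` spaces and the action of `Γ` -/

section Spaces

/-- Reindexing of an `ℓᵖ` space along a bijection. -/
def lpReindex {I J B : Type*} [NormedAddCommGroup B] [NormedSpace ℂ B] (p : ℝ≥0∞)
    [Fact (1 ≤ p)] (e : J ≃ I) : lp (fun _ : I => B) p →L[ℂ] lp (fun _ : J => B) p :=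
  have hmem : ∀ f : lp (fun _ : I => B) p, Memℓp (fun j => f (e j)) p := fun f => by
    have hp : 1 ≤ p := Fact.out
    rcases p.trichotomy with rfl | rfl | h
    · simp at hp
    · have h1 := memℓp_infty_iff.1 (lp.memℓp f)
      exact memℓp_infty (h1.mono (Set.range_comp_subset_range e fun i => ‖f i‖))
    · exact memℓp_gen ((e.summable_iff (f := fun i => ‖f i‖ ^ p.toReal)).2
        ((lp.memℓp f).summable h))
  LinearMap.mkContinuous
    { toFun := fun f => ⟨fun j => f (e j), hmem f⟩
      map_add' := fun _ _ => rfl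
      map_smul' := fun _ _ => rfl } 1 fun f => by
    have hp : 1 ≤ p := Fact.out
    rw [one_mul]
    rcases p.trichotomy with rfl | rfl | h
    · simp at hp
    · exact lp.norm_le_of_forall_le (norm_nonneg _) fun j =>
        lp.norm_apply_le_norm (by simp) f (e j)
    · refine lp.norm_le_of_tsum_le h (norm_nonneg _) (le_of_eq ?_)
      rw [lp.norm_rpow_eq_tsum h]
      exact e.tsum_eq fun i => ‖f i‖ ^ p.toReal

/-- The operator `A` applied in every coordinate of an `ℓᵖ` space. -/
def lpMap {I B : Type*} [NormedAddCommGroup B] [NormedSpace ℂ B] (p : ℝ≥0∞)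
    [Fact (1 ≤ p)] (A : B →L[ℂ] B) : lp (fun _ : I => B) p →L[ℂ] lp (fun _ : I => B) p :=
  lp.mapCLM p (fun _ => A) (norm_nonneg A) fun _ => le_rfl

/-- The coefficient space `ℓᵖ ⊗ ℓᵖ(Γ) = ℓᵖ(ℕ × Γ)`. -/
abbrev CoeffSpace (Γ : Type*) (p : ℝ≥0∞) : Type _ := lp (fun _ : ℕ × Γ => ℂ) p

/-- The space `ℓᵖ(X) ⊗ ℓᵖ ⊗ ℓᵖ(Γ) = ℓᵖ(X, ℓᵖ(ℕ × Γ))`. -/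
abbrev FibreSpace (Γ X : Type*) (p : ℝ≥0∞) [Fact (1 ≤ p)] : Type _ :=
  lp (fun _ : X => CoeffSpace Γ p) p

variable {Γ : Type*} [Group Γ] (l : ProperLength Γ) (s : ℝ) (X : Type*) (p : ℝ≥0∞) [Fact (1 ≤ p)]

/-- The space `E_s = ℓᵖ(Z_s) ⊗ ℓᵖ(X) ⊗ ℓᵖ ⊗ ℓᵖ(Γ)`. -/
abbrev RipsSpace : Type _ := lp (fun _ : RatRips l s => FibreSpace Γ X p) p

variable {X} in
/-- The action of `g` on `ℓᵖ(X) ⊗ ℓᵖ ⊗ ℓᵖ(Γ)`: `δ_x ⊗ η ⊗ δ_h ↦ δ_{gx} ⊗ η ⊗ δ_{gh}`. -/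
def fibreAction [MulAction Γ X] (g : Γ) : FibreSpace Γ X p →L[ℂ] FibreSpace Γ X p :=
  (lpReindex p (MulAction.toPerm (g⁻¹ : Γ) : X ≃ X)).comp
    (lpMap p (lpReindex p (Equiv.prodCongr (Equiv.refl ℕ) (Equiv.mulLeft g⁻¹))))

/-- The action of `g` on `E_s`:
`u_g (δ_z ⊗ δ_x ⊗ η ⊗ δ_h) = δ_{z g⁻¹} ⊗ δ_{gx} ⊗ η ⊗ δ_{gh}`. -/
def ripsAction [MulAction Γ X] (g : Γ) : RipsSpace l s X p →L[ℂ] RipsSpace l s X p :=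
  (lpReindex p (RatRips.translate g)).comp (lpMap p (fibreAction p g))

end Spaces

/-! ### Operators on `E_s` -/

section Operators

variable {Γ : Type*} [Group Γ] {l : ProperLength Γ} {s : ℝ} {X : Type*} {p : ℝ≥0∞} [Fact (1 ≤ p)]

open scoped Classical in
/-- The matrix entry `T_{y,z} ∈ B(ℓᵖ(X) ⊗ ℓᵖ ⊗ ℓᵖ(Γ))` of an operator on `E_s`. -/
def entry (T : RipsSpace l s X p →L[ℂ] RipsSpace l s X p) (y z : RatRips l s) :
    FibreSpace Γ X p →L[ℂ] FibreSpace Γ X p :=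
  (lp.evalCLM ℂ (fun _ : RatRips l s => FibreSpace Γ X p) p y).comp
    (T.comp (lp.singleContinuousLinearMap ℂ (fun _ : RatRips l s => FibreSpace Γ X p) p z))

open scoped Classical in
/-- The diagonal entry `S(x) ∈ B(ℓᵖ ⊗ ℓᵖ(Γ))` at `x ∈ X` of an operator on
`ℓᵖ(X) ⊗ ℓᵖ ⊗ ℓᵖ(Γ)`. -/
def atPoint (S : FibreSpace Γ X p →L[ℂ] FibreSpace Γ X p) (x : X) :
    CoeffSpace Γ p →L[ℂ] CoeffSpace Γ p :=
  (lp.evalCLM ℂ (fun _ : X => CoeffSpace Γ p) p x).comp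
    (S.comp (lp.singleContinuousLinearMap ℂ (fun _ : X => CoeffSpace Γ p) p x))

theorem entry_add (T S : RipsSpace l s X p →L[ℂ] RipsSpace l s X p) (y z : RatRips l s) :
    entry (T + S) y z = entry T y z + entry S y z := by
  simp [entry, ContinuousLinearMap.add_comp, ContinuousLinearMap.comp_add]

theorem entry_smul (c : ℂ) (T : RipsSpace l s X p →L[ℂ] RipsSpace l s X p) (y z : RatRips l s) :
    entry (c • T) y z = c • entry T y z := by
  simp [entry, ContinuousLinearMap.smul_comp]

theorem entry_zero (y z : RatRips l s) :
    entry (0 : RipsSpace l s X p →L[ℂ] RipsSpace l s X p) y z = 0 := by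
  simp [entry]

theorem entry_mul (T S : RipsSpace l s X p →L[ℂ] RipsSpace l s X p) (y z : RatRips l s)
    (F : Finset (RatRips l s)) (hF : ∀ w, entry S w z ≠ 0 → w ∈ F) :
    entry (T * S) y z = ∑ w ∈ F, entry T y w * entry S w z := by
  classical
  refine ContinuousLinearMap.ext fun ξ => ?_
  have key : S (lp.single p z ξ) = ∑ w ∈ F, lp.single p w (entry S w z ξ) := by
    refine lp.ext (funext fun v => ?_)
    rw [lp.coeFn_sum, Finset.sum_apply]
    have h1 : S (lp.single p z ξ) v = entry S v z ξ := by
      simp only [entry]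
      congr!
    rw [h1]
    by_cases hv : v ∈ F
    · rw [Finset.sum_eq_single v]
      · rw [lp.single_apply_self]
      · intro w _ hw
        rw [lp.single_apply_ne _ _ _ hw.symm]
      · exact fun h => absurd hv h
    · have : entry S v z = 0 := by
        by_contra h
        exact hv (hF v h)
      rw [this, Finset.sum_eq_zero]
      · rfl
      · intro w hw
        rw [lp.single_apply_ne]
        rintro rfl
        exact hv hw
  have h2 : entry (T * S) y z ξ = T (S (lp.single p z ξ)) y := by
    simp only [entry]
    congr!
  rw [h2, key, map_sum, lp.coeFn_sum, Finset.sum_apply, sum_apply]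
  refine Finset.sum_congr rfl fun w _ => ?_
  simp only [entry, mul_apply_eq_comp]
  congr!

/-- The Rips-propagation `sup {d(y, z) : T_{y,z} ≠ 0}`. -/
def ripsPropagation (T : RipsSpace l s X p →L[ℂ] RipsSpace l s X p) : ℝ≥0∞ :=
  ⨆ (y : RatRips l s) (z : RatRips l s) (_ : entry T y z ≠ 0), edist y.point z.point

/-- The `Γ`-propagation
`sup {d(g, h) : T_{y,z} ≠ 0 for some y, z with t_g(y) ≠ 0 and t_h(z) ≠ 0}`. -/
def groupPropagation (T : RipsSpace l s X p →L[ℂ] RipsSpace l s X p) : ℕ∞ :=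
  ⨆ (y : RatRips l s) (z : RatRips l s) (_ : entry T y z ≠ 0)
    (g ∈ y.point.supp) (h ∈ z.point.supp), (l (g * h⁻¹) : ℕ∞)

theorem ripsPropagation_le_iff {T : RipsSpace l s X p →L[ℂ] RipsSpace l s X p} {r : ℝ≥0∞} :
    ripsPropagation T ≤ r ↔ ∀ y z, entry T y z ≠ 0 → edist y.point z.point ≤ r := by
  simp only [ripsPropagation, iSup_le_iff]

theorem groupPropagation_le_iff {T : RipsSpace l s X p →L[ℂ] RipsSpace l s X p} {r : ℕ∞} :
    groupPropagation T ≤ r ↔ ∀ y z, entry T y z ≠ 0 → ∀ g ∈ y.point.supp, ∀ h ∈ z.point.supp,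
      (l (g * h⁻¹) : ℕ∞) ≤ r := by
  simp only [groupPropagation, iSup_le_iff]

theorem entry_add_ne {T S : RipsSpace l s X p →L[ℂ] RipsSpace l s X p} {y z : RatRips l s}
    (h : entry (T + S) y z ≠ 0) : entry T y z ≠ 0 ∨ entry S y z ≠ 0 := by
  by_contra! h'
  exact h (by rw [entry_add, h'.1, h'.2, add_zero])

theorem entry_smul_ne {c : ℂ} {T : RipsSpace l s X p →L[ℂ] RipsSpace l s X p} {y z : RatRips l s}
    (h : entry (c • T) y z ≠ 0) : entry T y z ≠ 0 := fun h' =>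
  h (by rw [entry_smul, h', smul_zero])

theorem ripsPropagation_add (T S : RipsSpace l s X p →L[ℂ] RipsSpace l s X p) :
    ripsPropagation (T + S) ≤ ripsPropagation T ⊔ ripsPropagation S := by
  refine ripsPropagation_le_iff.2 fun y z h => ?_
  rcases entry_add_ne h with h | h
  · exact le_sup_of_le_left (ripsPropagation_le_iff.1 le_rfl y z h)
  · exact le_sup_of_le_right (ripsPropagation_le_iff.1 le_rfl y z h)

theorem ripsPropagation_smul (c : ℂ) (T : RipsSpace l s X p →L[ℂ] RipsSpace l s X p) :
    ripsPropagation (c • T) ≤ ripsPropagation T :=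
  ripsPropagation_le_iff.2 fun y z h => ripsPropagation_le_iff.1 le_rfl y z (entry_smul_ne h)

theorem ripsPropagation_zero :
    ripsPropagation (0 : RipsSpace l s X p →L[ℂ] RipsSpace l s X p) = 0 :=
  le_antisymm (ripsPropagation_le_iff.2 fun y z h => absurd (entry_zero y z) h) zero_le

theorem groupPropagation_add (T S : RipsSpace l s X p →L[ℂ] RipsSpace l s X p) :
    groupPropagation (T + S) ≤ groupPropagation T ⊔ groupPropagation S := by
  refine groupPropagation_le_iff.2 fun y z h => ?_
  rcases entry_add_ne h with h | h
  · exact fun g hg k hk => le_sup_of_le_left (groupPropagation_le_iff.1 le_rfl y z h g hg k hk)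
  · exact fun g hg k hk => le_sup_of_le_right (groupPropagation_le_iff.1 le_rfl y z h g hg k hk)

theorem groupPropagation_smul (c : ℂ) (T : RipsSpace l s X p →L[ℂ] RipsSpace l s X p) :
    groupPropagation (c • T) ≤ groupPropagation T :=
  groupPropagation_le_iff.2 fun y z h => groupPropagation_le_iff.1 le_rfl y z (entry_smul_ne h)

theorem groupPropagation_zero :
    groupPropagation (0 : RipsSpace l s X p →L[ℂ] RipsSpace l s X p) = 0 :=
  le_antisymm (groupPropagation_le_iff.2 fun y z h => absurd (entry_zero y z) h) zero_le

/-- An operator of finite `Γ`-propagation with finitely many nonzero entries over each compact set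
has finitely many nonzero entries in each column. -/
theorem finite_column {T : RipsSpace l s X p →L[ℂ] RipsSpace l s X p}
    (hT : groupPropagation T < ⊤)
    (hfin : ∀ F : Set (Rips l s), IsCompact F →
      {q : RatRips l s × RatRips l s | q.1.point ∈ F ∧ q.2.point ∈ F ∧
        entry T q.1 q.2 ≠ 0}.Finite) (z : RatRips l s) : {w | entry T w z ≠ 0}.Finite := by
  classical
  obtain ⟨r, hr⟩ := ENat.ne_top_iff_exists.1 hT.ne
  obtain ⟨h, hh⟩ := z.point.supp_nonempty
  have hB : {g | l (g * h⁻¹) ≤ r}.Finite :=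
    (l.finite_ball r).preimage (mul_left_injective h⁻¹).injOn
  have hF := hfin _ (Rips.isCompact_of_finset (l := l) (s := s) (hB.toFinset ∪ z.point.supp))
  refine (hF.image Prod.fst).subset fun w hw => ⟨(w, z), ⟨fun g hg => ?_, ?_, hw⟩, rfl⟩
  · have := groupPropagation_le_iff.1 hr.ge w z hw g hg h hh
    refine Finset.mem_union_left _ ?_
    rw [Set.Finite.mem_toFinset]
    exact_mod_cast this
  · exact Finset.subset_union_right

theorem exists_entry_ne {T S : RipsSpace l s X p →L[ℂ] RipsSpace l s X p} {y z : RatRips l s}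
    (hS : {w | entry S w z ≠ 0}.Finite) (h : entry (T * S) y z ≠ 0) :
    ∃ w, entry T y w ≠ 0 ∧ entry S w z ≠ 0 := by
  rw [entry_mul T S y z hS.toFinset fun w hw => (Set.Finite.mem_toFinset hS).2 hw] at h
  obtain ⟨w, _, hw⟩ := Finset.exists_ne_zero_of_sum_ne_zero h
  exact ⟨w, fun h0 => hw (by rw [h0, zero_mul]), fun h0 => hw (by rw [h0, mul_zero])⟩

theorem ripsPropagation_mul {T S : RipsSpace l s X p →L[ℂ] RipsSpace l s X p}
    (hS : ∀ z, {w | entry S w z ≠ 0}.Finite) :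
    ripsPropagation (T * S) ≤ ripsPropagation T + ripsPropagation S := by
  refine ripsPropagation_le_iff.2 fun y z h => ?_
  obtain ⟨w, h1, h2⟩ := exists_entry_ne (hS z) h
  exact (edist_triangle _ w.point _).trans
    (add_le_add (ripsPropagation_le_iff.1 le_rfl _ _ h1) (ripsPropagation_le_iff.1 le_rfl _ _ h2))

theorem groupPropagation_mul {T S : RipsSpace l s X p →L[ℂ] RipsSpace l s X p}
    (hS : ∀ z, {w | entry S w z ≠ 0}.Finite) :
    groupPropagation (T * S) ≤ groupPropagation T + groupPropagation S := by
  refine groupPropagation_le_iff.2 fun y z h g hg k hk => ?_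
  obtain ⟨w, h1, h2⟩ := exists_entry_ne (hS z) h
  obtain ⟨m, hm⟩ := w.point.supp_nonempty
  have h3 : l (g * k⁻¹) ≤ l (g * m⁻¹) + l (m * k⁻¹) := by
    have := l.mul_le (g * m⁻¹) (m * k⁻¹)
    rwa [mul_assoc, inv_mul_cancel_left] at this
  exact le_trans (by exact_mod_cast h3)
    (add_le_add (groupPropagation_le_iff.1 le_rfl _ _ h1 g hg m hm)
      (groupPropagation_le_iff.1 le_rfl _ _ h2 m hm k hk))

end Operators

/-! ### Coefficients in `C(X) ⊗ 𝒦` -/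

section Coefficients

variable (Γ X : Type*) [TopologicalSpace X] (p : ℝ≥0∞) [Fact (1 ≤ p)]

/-- The algebra `C(X) ⊗ 𝒦_Γ = C(X, 𝒦_Γ)`, with `𝒦_Γ` the compact operators on `ℓᵖ ⊗ ℓᵖ(Γ)`, acting
on `ℓᵖ(X) ⊗ ℓᵖ ⊗ ℓᵖ(Γ)` by `(k ξ)(x) = k(x) ξ(x)`. -/
def coeffAlgebra : NonUnitalSubalgebra ℂ (FibreSpace Γ X p →L[ℂ] FibreSpace Γ X p) where
  carrier := {S | ∃ k : C(X, CoeffSpace Γ p →L[ℂ] CoeffSpace Γ p),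
    (∀ x, IsCompactOperator (k x)) ∧ ∀ (ξ : FibreSpace Γ X p) (x : X), S ξ x = k x (ξ x)}
  add_mem' := by
    rintro S S' ⟨k, hk, hS⟩ ⟨k', hk', hS'⟩
    refine ⟨k + k', fun x => (hk x).add (hk' x), fun ξ x => ?_⟩
    change S ξ x + S' ξ x = _
    rw [hS, hS']
    rfl
  zero_mem' := ⟨0, fun _ => isCompactOperator_zero, fun _ _ => rfl⟩
  mul_mem' := by
    rintro S S' ⟨k, hk, hS⟩ ⟨k', hk', hS'⟩
    refine ⟨k * k', fun x => (hk x).comp_clm (k' x), fun ξ x => ?_⟩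
    change S (S' ξ) x = _
    rw [hS, hS']
    rfl
  smul_mem' := by
    rintro c S ⟨k, hk, hS⟩
    refine ⟨c • k, fun x => (hk x).smul c, fun ξ x => ?_⟩
    change c • S ξ x = _
    rw [hS]
    rfl

variable {Γ X p}

theorem atPoint_mul (S : FibreSpace Γ X p →L[ℂ] FibreSpace Γ X p)
    {S' : FibreSpace Γ X p →L[ℂ] FibreSpace Γ X p} (h : S' ∈ coeffAlgebra Γ X p) (x : X) :
    atPoint (S * S') x = atPoint S x * atPoint S' x := by
  classical
  obtain ⟨k, -, hk⟩ := h
  refine ContinuousLinearMap.ext fun v => ?_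
  have key : S' (lp.single p x v) = lp.single p x (atPoint S' x v) := by
    refine lp.ext (funext fun x' => ?_)
    by_cases hx : x' = x
    · subst hx
      rw [lp.single_apply_self]
      simp only [atPoint]
      congr!
    · rw [lp.single_apply_ne _ _ _ hx, hk, lp.single_apply_ne _ _ _ hx, map_zero]
  have h1 : atPoint (S * S') x v = S (S' (lp.single p x v)) x := by
    simp only [atPoint]
    congr!
  rw [h1, key]
  simp only [atPoint, mul_apply_eq_comp]
  congr!

end Coefficients

/-! ### The transformation groupoid and supports -/

section Groupoid

/-- The transformation groupoid `Γ ⋉ X = {(gx, g, x)}`, in the coordinates `(g, x) ∈ Γ × X`. -/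
abbrev TransGroupoid (Γ X : Type*) : Type _ := Γ × X

/-- An open subgroupoid of `Γ ⋉ X`; the pair `(g, x)` stands for `(gx, g, x)`. -/
structure OpenSubgroupoid (Γ X : Type*) [Group Γ] [TopologicalSpace Γ] [TopologicalSpace X]
    [MulAction Γ X] where
  carrier : Set (TransGroupoid Γ X)
  isOpen : IsOpen carrier
  mul_mem : ∀ (h g : Γ) (x : X), (h, g • x) ∈ carrier → (g, x) ∈ carrier → (h * g, x) ∈ carrier
  inv_mem : ∀ (g : Γ) (x : X), (g, x) ∈ carrier → (g⁻¹, g • x) ∈ carrier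
  source_mem : ∀ (g : Γ) (x : X), (g, x) ∈ carrier → (1, x) ∈ carrier
  range_mem : ∀ (g : Γ) (x : X), (g, x) ∈ carrier → (1, g • x) ∈ carrier

/-- The set of products of composable elements of `A` and `B`. -/
def groupoidMul {Γ X : Type*} [Group Γ] [MulAction Γ X] (A B : Set (TransGroupoid Γ X)) :
    Set (TransGroupoid Γ X) :=
  {q | ∃ (h g : Γ) (x : X), (h, g • x) ∈ A ∧ (g, x) ∈ B ∧ q = (h * g, x)}

theorem isCompact_groupoidMul {Γ X : Type*} [Group Γ] [TopologicalSpace Γ] [DiscreteTopology Γ]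
    [TopologicalSpace X] [T2Space X] [MulAction Γ X] [ContinuousConstSMul Γ X]
    {A B : Set (TransGroupoid Γ X)} (hA : IsCompact A) (hB : IsCompact B) :
    IsCompact (groupoidMul A B) := by
  have hc : Continuous fun q : Γ × X => q.1 • q.2 :=
    continuous_prod_of_discrete_left.2 fun g => continuous_const_smul g
  have h1 : IsCompact ((A ×ˢ B) ∩ {q : (Γ × X) × (Γ × X) | q.1.2 = q.2.1 • q.2.2}) :=
    (hA.prod hB).inter_right
      (isClosed_eq (continuous_snd.comp continuous_fst) (hc.comp continuous_snd))
  have h2 : Continuous fun q : (Γ × X) × (Γ × X) => ((q.1.1 * q.2.1, q.2.2) : Γ × X) :=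
    ((continuous_of_discreteTopology (f := fun a : Γ × Γ => a.1 * a.2)).comp
      ((continuous_fst.comp continuous_fst).prodMk (continuous_fst.comp continuous_snd))).prodMk
      (continuous_snd.comp continuous_snd)
  convert h1.image h2 using 1
  ext ⟨k, x⟩
  constructor
  · rintro ⟨h, g, x, ha, hb, hq⟩
    exact ⟨((h, g • x), (g, x)), ⟨⟨ha, hb⟩, rfl⟩, hq.symm⟩
  · rintro ⟨⟨⟨h, y⟩, ⟨g, x⟩⟩, ⟨⟨ha, hb⟩, hy⟩, hq⟩
    refine ⟨h, g, x, ?_, hb, hq.symm⟩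
    have hy' : y = g • x := hy
    exact hy' ▸ ha

variable {Γ : Type*} [Group Γ] {l : ProperLength Γ} {s : ℝ} {X : Type*} [MulAction Γ X]
  {p : ℝ≥0∞} [Fact (1 ≤ p)]

/-- The support of an operator on `E_s`: all `(gx, g h⁻¹, hx)` for which there are `y, z ∈ Z_s` with
`T_{y,z}(x) ≠ 0`, `g ∈ supp y` and `h ∈ supp z`. -/
def support (T : RipsSpace l s X p →L[ℂ] RipsSpace l s X p) : Set (TransGroupoid Γ X) :=
  {q | ∃ (y z : RatRips l s) (x : X) (g h : Γ), atPoint (entry T y z) x ≠ 0 ∧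
    g ∈ y.point.supp ∧ h ∈ z.point.supp ∧ q = (g * h⁻¹, h • x)}

theorem support_zero : support (0 : RipsSpace l s X p →L[ℂ] RipsSpace l s X p) = ∅ := by
  refine Set.eq_empty_of_forall_notMem ?_
  rintro q ⟨y, z, x, g, h, h0, -⟩
  refine h0 ?_
  rw [entry_zero]
  simp [atPoint]

theorem support_add (T S : RipsSpace l s X p →L[ℂ] RipsSpace l s X p) :
    support (T + S) ⊆ support T ∪ support S := by
  rintro q ⟨y, z, x, g, h, h0, hg, hh, rfl⟩
  by_cases h1 : atPoint (entry T y z) x = 0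
  · refine Or.inr ⟨y, z, x, g, h, fun h2 => h0 ?_, hg, hh, rfl⟩
    have : atPoint (entry (T + S) y z) x = atPoint (entry T y z) x + atPoint (entry S y z) x := by
      rw [entry_add]
      simp [atPoint, ContinuousLinearMap.add_comp, ContinuousLinearMap.comp_add]
    rw [this, h1, h2, add_zero]
  · exact Or.inl ⟨y, z, x, g, h, h1, hg, hh, rfl⟩

theorem support_smul (c : ℂ) (T : RipsSpace l s X p →L[ℂ] RipsSpace l s X p) :
    support (c • T) ⊆ support T := by
  rintro q ⟨y, z, x, g, h, h0, hg, hh, rfl⟩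
  refine ⟨y, z, x, g, h, fun h2 => h0 ?_, hg, hh, rfl⟩
  have : atPoint (entry (c • T) y z) x = c • atPoint (entry T y z) x := by
    rw [entry_smul]
    simp [atPoint, ContinuousLinearMap.smul_comp]
  rw [this, h2, smul_zero]

theorem support_mul [TopologicalSpace X] {T S : RipsSpace l s X p →L[ℂ] RipsSpace l s X p}
    (hS : ∀ z, {w | entry S w z ≠ 0}.Finite) (hSX : ∀ y z, entry S y z ∈ coeffAlgebra Γ X p) :
    support (T * S) ⊆ groupoidMul (support T) (support S) := by
  classical
  rintro q ⟨y, z, x, g, h, h0, hg, hh, rfl⟩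
  have h1 : atPoint (entry (T * S) y z) x =
      ∑ w ∈ (hS z).toFinset, atPoint (entry T y w) x * atPoint (entry S w z) x := by
    rw [entry_mul T S y z (hS z).toFinset fun w hw => (Set.Finite.mem_toFinset (hS z)).2 hw]
    rw [← Finset.sum_congr rfl fun w _ => atPoint_mul (entry T y w) (hSX w z) x]
    refine ContinuousLinearMap.ext fun v => ?_
    simp only [atPoint, ContinuousLinearMap.comp_apply, sum_apply, map_sum]
  rw [h1] at h0
  obtain ⟨w, _, hw⟩ := Finset.exists_ne_zero_of_sum_ne_zero h0
  obtain ⟨k, hk⟩ := w.point.supp_nonempty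
  refine ⟨g * k⁻¹, k * h⁻¹, h • x, ?_, ?_, ?_⟩
  · refine ⟨y, w, x, g, k, fun h2 => hw (by rw [h2, zero_mul]), hg, hk, ?_⟩
    rw [smul_smul, inv_mul_cancel_right]
  · exact ⟨w, z, x, k, h, fun h2 => hw (by rw [h2, mul_zero]), hk, hh, rfl⟩
  · rw [mul_assoc, inv_mul_cancel_left]

end Groupoid

/-! ### The algebras -/

section Algebras

theorem ripsAction_inv_mul {Γ : Type*} [Group Γ] (l : ProperLength Γ) (s : ℝ) (X : Type*)
    [MulAction Γ X] (p : ℝ≥0∞) [Fact (1 ≤ p)] (g : Γ) :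
    ripsAction l s X p g⁻¹ * ripsAction l s X p g = 1 := by
  refine ContinuousLinearMap.ext fun ξ => lp.ext (funext fun z => lp.ext (funext fun x =>
    lp.ext (funext fun i => ?_)))
  change ξ (RatRips.translate g (RatRips.translate g⁻¹ z)) (g⁻¹ • g⁻¹⁻¹ • x)
    (i.1, g⁻¹ * (g⁻¹⁻¹ * i.2)) = ξ z x i
  have h1 : RatRips.translate g (RatRips.translate g⁻¹ z) = z := by
    refine RatRips.ext (Rips.ext (Finsupp.ext fun h => ?_))
    simp [RatRips.translate, Rips.translate_apply]
  rw [h1]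
  simp

variable {Γ : Type*} [Group Γ] [TopologicalSpace Γ] [DiscreteTopology Γ] (l : ProperLength Γ)
  (s : ℝ) {X : Type*} [TopologicalSpace X] [T2Space X] [MulAction Γ X] [ContinuousConstSMul Γ X]
  (p : ℝ≥0∞) [Fact (1 ≤ p)]

/-- `T` is `Γ`-invariant: `u_g T u_g⁻¹ = T` for all `g`. -/
def IsInvariant {Γ : Type*} [Group Γ] {l : ProperLength Γ} {s : ℝ} {X : Type*} [MulAction Γ X]
    {p : ℝ≥0∞} [Fact (1 ≤ p)] (T : RipsSpace l s X p →L[ℂ] RipsSpace l s X p) : Prop :=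
  ∀ g : Γ, ripsAction l s X p g * T * ripsAction l s X p g⁻¹ = T

/-- `T` is `X`-locally compact: its entries lie in `C(X) ⊗ 𝒦_Γ`, and only finitely many of them are
nonzero over each compact subset of `P_s(Γ)`. -/
structure IsXLocallyCompact {Γ : Type*} [Group Γ] {l : ProperLength Γ} {s : ℝ} {X : Type*}
    [TopologicalSpace X] {p : ℝ≥0∞} [Fact (1 ≤ p)]
    (T : RipsSpace l s X p →L[ℂ] RipsSpace l s X p) : Prop where
  entry_mem : ∀ y z, entry T y z ∈ coeffAlgebra Γ X p
  finite : ∀ F : Set (Rips l s), IsCompact F →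
    {q : RatRips l s × RatRips l s | q.1.point ∈ F ∧ q.2.point ∈ F ∧ entry T q.1 q.2 ≠ 0}.Finite

theorem IsXLocallyCompact.mul {Γ : Type*} [Group Γ] {l : ProperLength Γ} {s : ℝ} {X : Type*}
    [TopologicalSpace X] {p : ℝ≥0∞} [Fact (1 ≤ p)]
    {T S : RipsSpace l s X p →L[ℂ] RipsSpace l s X p} (hT : IsXLocallyCompact T)
    (hS : IsXLocallyCompact S) (hS' : groupPropagation S < ⊤) : IsXLocallyCompact (T * S) := by
  classical
  have hcol := finite_column hS' hS.finite
  refine ⟨fun y z => ?_, fun F hF => ?_⟩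
  · rw [entry_mul T S y z (hcol z).toFinset fun w hw => (Set.Finite.mem_toFinset (hcol z)).2 hw]
    exact sum_mem fun w _ => mul_mem (hT.entry_mem y w) (hS.entry_mem w z)
  · obtain ⟨B, hB⟩ := Rips.exists_finset_of_isCompact hF
    obtain ⟨r, hr⟩ := ENat.ne_top_iff_exists.1 hS'.ne
    have hfin : (⋃ h ∈ B, {g | l (g * h⁻¹) ≤ r}).Finite := B.finite_toSet.biUnion fun h _ =>
      (l.finite_ball r).preimage (mul_left_injective h⁻¹).injOn
    have hF' := Rips.isCompact_of_finset (l := l) (s := s) (hfin.toFinset ∪ B)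
    refine (((hT.finite _ hF').image Prod.fst).prod ((hS.finite _ hF').image Prod.snd)).subset ?_
    rintro ⟨y, z⟩ ⟨hy, hz, h⟩
    obtain ⟨w, h1, h2⟩ := exists_entry_ne (hcol z) h
    have hw : w.point.supp ⊆ hfin.toFinset ∪ B := fun g hg => by
      obtain ⟨k, hk⟩ := z.point.supp_nonempty
      refine Finset.mem_union_left _ ((Set.Finite.mem_toFinset hfin).2
        (Set.mem_iUnion₂.2 ⟨k, hB _ hz hk, ?_⟩))
      have := groupPropagation_le_iff.1 hr.ge w z h2 g hg k hk
      exact_mod_cast this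
    exact ⟨⟨(y, w), ⟨(hB _ hy).trans Finset.subset_union_right, hw, h1⟩, rfl⟩,
      ⟨(w, z), ⟨hw, (hB _ hz).trans Finset.subset_union_right, h2⟩, rfl⟩⟩

/-- The algebra `ℂ[Γ ↷ X; s]` of all `Γ`-invariant, `X`-locally compact operators on `E_s` with
finite `Γ`-propagation. -/
def algebraicRoe {Γ : Type*} [Group Γ] (l : ProperLength Γ) (s : ℝ) (X : Type*)
    [TopologicalSpace X] [MulAction Γ X] (p : ℝ≥0∞) [Fact (1 ≤ p)] :
    NonUnitalSubalgebra ℂ (RipsSpace l s X p →L[ℂ] RipsSpace l s X p) where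
  carrier := {T | IsInvariant T ∧ IsXLocallyCompact T ∧ groupPropagation T < ⊤}
  zero_mem' := by
    refine ⟨fun g => by simp, ⟨fun y z => ?_, fun F _ => ?_⟩, ?_⟩
    · rw [entry_zero]
      exact zero_mem _
    · convert Set.finite_empty
      refine Set.eq_empty_of_forall_notMem ?_
      rintro q ⟨-, -, h⟩
      exact h (entry_zero _ _)
    · rw [groupPropagation_zero]
      exact ENat.top_pos
  add_mem' := by
    rintro T S ⟨h1, h2, h3⟩ ⟨h1', h2', h3'⟩
    refine ⟨fun g => ?_, ⟨fun y z => ?_, fun F hF => ?_⟩,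
      (groupPropagation_add T S).trans_lt (max_lt h3 h3')⟩
    · rw [mul_add, add_mul, h1 g, h1' g]
    · rw [entry_add]
      exact add_mem (h2.entry_mem y z) (h2'.entry_mem y z)
    · refine ((h2.finite F hF).union (h2'.finite F hF)).subset ?_
      rintro q ⟨ha, hb, h⟩
      exact (entry_add_ne h).imp (fun h => ⟨ha, hb, h⟩) fun h => ⟨ha, hb, h⟩
  mul_mem' := by
    rintro T S ⟨h1, h2, h3⟩ ⟨h1', h2', h3'⟩
    refine ⟨fun g => ?_, h2.mul h2' h3',
      (groupPropagation_mul (finite_column h3' h2'.finite)).trans_lt (by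
        exact WithTop.add_lt_top.2 ⟨h3, h3'⟩)⟩
    calc ripsAction l s X p g * (T * S) * ripsAction l s X p g⁻¹
        = ripsAction l s X p g * T * (ripsAction l s X p g⁻¹ * ripsAction l s X p g) * S *
          ripsAction l s X p g⁻¹ := by rw [ripsAction_inv_mul]; simp only [mul_one, mul_assoc]
      _ = (ripsAction l s X p g * T * ripsAction l s X p g⁻¹) *
          (ripsAction l s X p g * S * ripsAction l s X p g⁻¹) := by simp only [mul_assoc]
      _ = T * S := by rw [h1 g, h1' g]
  smul_mem' := by
    rintro c T ⟨h1, h2, h3⟩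
    refine ⟨fun g => ?_, ⟨fun y z => ?_, fun F hF => ?_⟩,
      (groupPropagation_smul c T).trans_lt h3⟩
    · rw [mul_smul_comm, smul_mul_assoc, h1 g]
    · rw [entry_smul]
      exact SMulMemClass.smul_mem c (h2.entry_mem y z)
    · refine (h2.finite F hF).subset ?_
      rintro q ⟨ha, hb, h⟩
      exact ⟨ha, hb, entry_smul_ne h⟩

theorem algebraicRoe_column {Γ : Type*} [Group Γ] {l : ProperLength Γ} {s : ℝ} {X : Type*}
    [TopologicalSpace X] [MulAction Γ X] {p : ℝ≥0∞} [Fact (1 ≤ p)]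
    {T : RipsSpace l s X p →L[ℂ] RipsSpace l s X p} (h : T ∈ algebraicRoe l s X p) :
    ∀ z, {w | entry T w z ≠ 0}.Finite :=
  finite_column h.2.2 h.2.1.finite

/-- Bounded continuous functions `[0, ∞) → B` with values in a Banach algebra, with the norm
`‖a‖ = sup_t ‖a(t)‖`. -/
abbrev BddFun (B : Type*) [NormedRing B] : Type _ := ℝ≥0 →ᵇ B

instance {B : Type*} [NormedRing B] [NormedAlgebra ℂ B] (S : NonUnitalSubalgebra ℂ (BddFun B)) :
    NormedSpace ℂ S where
  norm_smul_le c a := norm_smul_le c (a : BddFun B)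

/-- The algebra of bounded, uniformly continuous functions `[0, ∞) → B`. -/
def uniformlyContinuousFun (B : Type*) [NormedRing B] [NormedAlgebra ℂ B] :
    NonUnitalSubalgebra ℂ (BddFun B) where
  carrier := {a | UniformContinuous a}
  zero_mem' := uniformContinuous_const
  add_mem' := fun h h' => UniformContinuous.add h h'
  smul_mem' := fun c _ h => UniformContinuous.const_smul h c
  mul_mem' := by
    intro a b h1 h1'
    change UniformContinuous a at h1
    change UniformContinuous b at h1'
    change UniformContinuous ⇑(a * b)
    rw [Metric.uniformContinuous_iff] at h1 h1' ⊢
    intro ε hε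
    have hM : 0 < ‖a‖ + ‖b‖ + 1 := by positivity
    obtain ⟨δ, hδ, h⟩ := h1 (ε / (‖a‖ + ‖b‖ + 1)) (by positivity)
    obtain ⟨δ', hδ', h'⟩ := h1' (ε / (‖a‖ + ‖b‖ + 1)) (by positivity)
    refine ⟨min δ δ', lt_min hδ hδ', fun {t u} htu => ?_⟩
    have e1 := h (htu.trans_le (min_le_left _ _))
    have e2 := h' (htu.trans_le (min_le_right _ _))
    rw [dist_eq_norm] at e1 e2 ⊢
    have e3 : (a * b) t - (a * b) u = a t * (b t - b u) + (a t - a u) * b u := by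
      simp only [BoundedContinuousFunction.coe_mul, Pi.mul_apply]
      noncomm_ring
    rw [e3]
    calc ‖a t * (b t - b u) + (a t - a u) * b u‖
        ≤ ‖a‖ * ‖b t - b u‖ + ‖a t - a u‖ * ‖b‖ := by
          refine (norm_add_le _ _).trans (add_le_add ?_ ?_)
          · exact (norm_mul_le _ _).trans
              (mul_le_mul_of_nonneg_right (a.norm_coe_le_norm t) (norm_nonneg _))
          · exact (norm_mul_le _ _).trans
              (mul_le_mul_of_nonneg_left (b.norm_coe_le_norm u) (norm_nonneg _))
      _ ≤ ‖a‖ * (ε / (‖a‖ + ‖b‖ + 1)) + (ε / (‖a‖ + ‖b‖ + 1)) * ‖b‖ := by gcongr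
      _ = ε * ((‖a‖ + ‖b‖) / (‖a‖ + ‖b‖ + 1)) := by ring
      _ < ε * 1 := by
          refine mul_lt_mul_of_pos_left ?_ hε
          rw [div_lt_one hM]
          linarith
      _ = ε := mul_one ε
/-- The algebra `ℂ_L[Γ ↷ X; s]` of all bounded, uniformly continuous functions
`a : [0, ∞) → ℂ[Γ ↷ X; s]` such that the `Γ`-propagation of `a(t)` is uniformly finite and the
Rips-propagation of `a(t)` tends to `0` as `t → ∞`. -/
def algebraicLocalization {Γ : Type*} [Group Γ] (l : ProperLength Γ) (s : ℝ) (X : Type*)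
    [TopologicalSpace X] [MulAction Γ X] (p : ℝ≥0∞) [Fact (1 ≤ p)] :
    NonUnitalSubalgebra ℂ (BddFun (RipsSpace l s X p →L[ℂ] RipsSpace l s X p)) where
  carrier := {a | a ∈ uniformlyContinuousFun (RipsSpace l s X p →L[ℂ] RipsSpace l s X p) ∧
    (∀ t, a t ∈ algebraicRoe l s X p) ∧
    (⨆ t, groupPropagation (a t)) < ⊤ ∧ Tendsto (fun t => ripsPropagation (a t)) atTop (𝓝 0)}
  zero_mem' := by
    refine ⟨zero_mem _, fun t => zero_mem _, ?_, ?_⟩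
    · exact lt_of_le_of_lt (iSup_le fun t => groupPropagation_zero.le) ENat.top_pos
    · refine Tendsto.congr (fun t => ?_) tendsto_const_nhds
      exact ripsPropagation_zero.symm
  add_mem' := by
    rintro a b ⟨h1, h2, h3, h4⟩ ⟨h1', h2', h3', h4'⟩
    refine ⟨add_mem h1 h1', fun t => add_mem (h2 t) (h2' t), ?_, ?_⟩
    · refine lt_of_le_of_lt (iSup_le fun t => ?_) (max_lt h3 h3')
      exact (groupPropagation_add _ _).trans
        (sup_le_sup (le_iSup (fun t => groupPropagation (a t)) t)
          (le_iSup (fun t => groupPropagation (b t)) t))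
    · have := h4.sup_nhds h4'
      rw [sup_idem] at this
      exact tendsto_of_tendsto_of_tendsto_of_le_of_le tendsto_const_nhds this
        (fun t => zero_le) fun t => ripsPropagation_add _ _
  mul_mem' := by
    rintro a b ⟨h1, h2, h3, h4⟩ ⟨h1', h2', h3', h4'⟩
    refine ⟨mul_mem h1 h1', fun t => mul_mem (h2 t) (h2' t), ?_, ?_⟩
    · refine lt_of_le_of_lt (iSup_le fun t => ?_) (WithTop.add_lt_top.2 ⟨h3, h3'⟩)
      exact (groupPropagation_mul (algebraicRoe_column (h2' t))).trans
        (add_le_add (le_iSup (fun t => groupPropagation (a t)) t)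
          (le_iSup (fun t => groupPropagation (b t)) t))
    · have := h4.add h4'
      rw [add_zero] at this
      exact tendsto_of_tendsto_of_tendsto_of_le_of_le tendsto_const_nhds this
        (fun t => zero_le) fun t => ripsPropagation_mul (algebraicRoe_column (h2' t))
  smul_mem' := by
    rintro c a ⟨h1, h2, h3, h4⟩
    refine ⟨SMulMemClass.smul_mem c h1, fun t => SMulMemClass.smul_mem c (h2 t), ?_, ?_⟩
    · exact lt_of_le_of_lt (iSup_mono fun t => groupPropagation_smul c (a t)) h3
    · exact tendsto_of_tendsto_of_tendsto_of_le_of_le tendsto_const_nhds h4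
        (fun t => zero_le) fun t => ripsPropagation_smul c (a t)

/-- The algebra `ℂ_{L,0}[G; s]` of all `a ∈ ℂ_L[Γ ↷ X; s]` with `a(0) = 0` such that the union of
the supports of the `a(t)` is contained in a compact subset of `G`. -/
def algebraicObstruction (G : OpenSubgroupoid Γ X) :
    NonUnitalSubalgebra ℂ (BddFun (RipsSpace l s X p →L[ℂ] RipsSpace l s X p)) where
  carrier := {a | a ∈ algebraicLocalization l s X p ∧ a 0 = 0 ∧
    ∃ K : Set (TransGroupoid Γ X), IsCompact K ∧ K ⊆ G.carrier ∧ ⋃ t, support (a t) ⊆ K}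
  zero_mem' := by
    refine ⟨zero_mem _, rfl, ∅, isCompact_empty, Set.empty_subset _, Set.iUnion_subset fun t => ?_⟩
    exact support_zero.subset
  add_mem' := by
    rintro a b ⟨h1, h2, K, hK, hKG, h3⟩ ⟨h1', h2', K', hK', hKG', h3'⟩
    refine ⟨add_mem h1 h1', ?_, K ∪ K', hK.union hK', Set.union_subset hKG hKG',
      Set.iUnion_subset fun t => (support_add _ _).trans (Set.union_subset_union
        ((Set.subset_iUnion _ t).trans h3) ((Set.subset_iUnion _ t).trans h3'))⟩
    change a 0 + b 0 = 0
    rw [h2, h2', add_zero]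
  mul_mem' := by
    rintro a b ⟨h1, h2, K, hK, hKG, h3⟩ ⟨h1', h2', K', hK', hKG', h3'⟩
    refine ⟨mul_mem h1 h1', ?_, groupoidMul K K', isCompact_groupoidMul hK hK', ?_,
      Set.iUnion_subset fun t => ?_⟩
    · change a 0 * b 0 = 0
      rw [h2, zero_mul]
    · rintro q ⟨h, g, x, ha, hb, rfl⟩
      exact G.mul_mem h g x (hKG ha) (hKG' hb)
    · refine (support_mul (algebraicRoe_column (h1'.2.1 t)) (h1'.2.1 t).2.1.entry_mem).trans ?_
      rintro q ⟨h, g, x, ha, hb, rfl⟩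
      exact ⟨h, g, x, h3 (Set.mem_iUnion.2 ⟨t, ha⟩), h3' (Set.mem_iUnion.2 ⟨t, hb⟩), rfl⟩
  smul_mem' := by
    rintro c a ⟨h1, h2, K, hK, hKG, h3⟩
    refine ⟨SMulMemClass.smul_mem c h1, ?_, K, hK, hKG, Set.iUnion_subset fun t =>
      (support_smul c (a t)).trans ((Set.subset_iUnion (fun t => support (a t)) t).trans h3)⟩
    change c • a 0 = 0
    rw [h2, smul_zero]

/-- The obstruction algebra `A^s(G) = B^p_{L,0}(G; s)`: the closure of `ℂ_{L,0}[G; s]` in the norm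
`‖a‖ = sup_t ‖a(t)‖`. -/
def obstructionAlgebra (G : OpenSubgroupoid Γ X) :
    NonUnitalSubalgebra ℂ (BddFun (RipsSpace l s X p →L[ℂ] RipsSpace l s X p)) :=
  (algebraicObstruction l s p G).topologicalClosure

end Algebras

end LpRoe

end

/-!
The `K`-theory of the obstruction algebra `A = B^p_{L,0}(G; s)` vanishes by an Eilenberg swindle in
the time parameter: `diag(b(t), b(t - 1), b(t - 2), …)` and its delay by one differ by the single
entry `b(t)`, and they are homotopic, because the `b` are uniformly continuous. As `b(0) = 0`, only
finitely many entries are nonzero at each time. The swindle has to be realised inside `A`: there must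
be isometries `V(t) : ℓᵖ(ℕ, E_s) → E_s` with left inverses `V'(t)` such that
`V(t) diag(b(t), b(t - 1), …) V'(t)` still lies in `A`. The issue is the Rips-propagation, which is
small for `b(t - k)` only while `t - k` is large, so that `V(t)` has to pull the points of the
`k`-th copy of `Z_s` together as `k` grows.

This is where `l ≤ s` on `G` enters. Suppose that `b` is supported in a compact symmetric subset `K`
of `G`. Points `z` and `w` connected by `b` over `x ∈ X` have their vertices in one orbit of `G`, and
all the vertices of such an orbit span a simplex of `P_s(Γ)`. There is a continuous function `f`,
compactly supported in `G`, that is one on `K` and invariant under left multiplication by elements of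
`K` (`exists_isInvariantBump`): one maximises, over the factorizations of a groupoid element, the
minimum of a bump function over the factors. Averaging `f` over the vertices of `z` gives a vector,
the hull of `z` over `x`, which is the same for all points connected to `z`. The vectors
`frameVector f t k z x = (t - k)₊ z + min(k, t) · hull` contract `z` linearly towards its hull. They have
length at least `t`, and for connected `z` and `w` they differ by at most `(t - k)₊ d(z, w)`, so that
their directions approach each other uniformly in `k` as `t → ∞`.

These directions need not be rational, and a point of `Z_s` has to be spread over nearby points of
`Z_s` continuously in `x` and `t`. Since the vectors are long, it suffices to round their coordinates
to integers, with weights given by products of tent functions (`latticeWeight`), and to take the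
directions of the lattice points obtained; the number of coordinates is at most the size of the ball of
radius `2s`. The square roots of these weights are the matrix entries of `V(t)` and `V'(t)`. On
`ℓᵖ ⊗ ℓᵖ(Γ)` the isometry also encodes the label `(k, z h, n)` into `ℕ`, which is invariant under the
action of `Γ` and makes the images of distinct basis vectors disjoint. Boundedness and uniform
continuity in `ℓᵖ` follow from a Schur estimate for matrices with boundedly many nonzero entries in
each row and column (`IsSchur.norm_kernelOp_le`), as `p < ∞`.

The frame depends on `K`, and hence there is no swindle on all of `A` at once. Only finitely many
elements of the dense subalgebra `ℂ_{L,0}[G; s]` are needed to represent a class in `K₀(A)` or `K₁(A)`,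
however, and they have a common compact support `K`. They generate elements of the closed subalgebra
`swindleAlgebra`, on which all the maps of the swindle take values in `A`, and whose inclusion into `A`
is therefore trivial in `K`-theory (`HasSwindle.of_mk_eq`, `HasSwindle.joined`). Newton's iteration for
idempotents and the openness of the invertible elements move a class of `A` into this subalgebra
(`subsingleton_K0`, `subsingleton_K1`).
-/

noncomputable section

/-! ### Idempotents and units in matrix rings over a Banach algebra -/

namespace KTheory

section Newton

variable {R : Type*} [NormedRing R]

/-- Newton's iteration `r ↦ 3 r² - 2 r³` for idempotents, written as a correction of `r`. -/
def newtonStep (r : R) : R := r + (2 * r - 1) * (r - r * r)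

theorem newtonStep_defect (r : R) :
    newtonStep r - newtonStep r * newtonStep r =
      (r - r * r) * (r - r * r) * (3 + 4 * (r - r * r)) := by
  simp only [newtonStep]
  noncomm_ring

theorem one_sub_two_mul_newtonStep (r : R) :
    1 - 2 * newtonStep r = (1 - 2 * r) * (1 + 2 * (r - r * r)) := by
  simp only [newtonStep]
  noncomm_ring

theorem norm_newtonStep_defect_le {r : R} {q : ℝ} (h : ‖r - r * r‖ ≤ q) (hq : q ≤ 1 / 8) :
    ‖newtonStep r - newtonStep r * newtonStep r‖ ≤ q / 2 := by
  set x := r - r * r with hx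
  have h0 := norm_nonneg x
  have e : x * x * (3 + 4 * x) = x * x + x * x + x * x +
      (x * x * x + x * x * x + x * x * x + x * x * x) := by noncomm_ring
  have hq0 : 0 ≤ q := h0.trans h
  have h2 : ‖x * x‖ ≤ q * q := (norm_mul_le _ _).trans (by gcongr)
  have h3 : ‖x * x * x‖ ≤ q * q * q := (norm_mul_le _ _).trans (by gcongr)
  rw [newtonStep_defect, ← hx, e]
  calc _ ≤ (q * q + q * q + q * q) + (q * q * q + q * q * q + q * q * q + q * q * q) := by
        refine (norm_add_le _ _).trans (add_le_add ?_ ?_)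
        · exact norm_add_le_of_le (norm_add_le_of_le h2 h2) h2
        · exact norm_add_le_of_le (norm_add_le_of_le (norm_add_le_of_le h3 h3) h3) h3
    _ ≤ q / 2 := by nlinarith [h0.trans h, mul_nonneg (h0.trans h) (h0.trans h)]

/-- An element of a Banach algebra that is nearly idempotent is close to an idempotent: Newton's
iteration converges quadratically. -/
theorem exists_idempotent_near [CompleteSpace R] (r : R) (h : ‖r - r * r‖ ≤ 1 / 8) :
    ∃ e : R, e * e = e ∧ ‖e - r‖ ≤ 4 * ‖1 - 2 * r‖ * ‖r - r * r‖ := by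
  set K := ‖1 - 2 * r‖
  set q := ‖r - r * r‖
  have hK : 0 ≤ K := norm_nonneg _
  have hq : 0 ≤ q := norm_nonneg _
  let f : ℕ → R := fun n => newtonStep^[n] r
  have hf : ∀ n, f (n + 1) = newtonStep (f n) := fun n => Function.iterate_succ_apply' _ _ _
  have h1 : ∀ n, ‖f n - f n * f n‖ ≤ q / 2 ^ n := by
    intro n
    induction n with
    | zero => simp [f, q]
    | succ n ih =>
      rw [hf]
      refine (norm_newtonStep_defect_le ih ?_).trans (le_of_eq (by rw [pow_succ]; ring))
      exact (div_le_self hq (one_le_pow₀ (by norm_num))).trans h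
  -- the factors `1 + 2 q / 2 ^ n` have bounded product, so that `‖1 - 2 * f n‖` stays below `2 * K`
  have h2 : ∀ n, ‖1 - 2 * f n‖ ≤ K * (2 - 1 / 2 ^ n) := by
    intro n
    induction n with
    | zero =>
      simp [f, K]
      norm_num
    | succ n ih =>
      have hp : (0 : ℝ) < 1 / 2 ^ n := by positivity
      have hp1 : (1 : ℝ) / 2 ^ n ≤ 1 := by
        rw [div_le_one (by positivity)]
        exact one_le_pow₀ (by norm_num)
      have e1 : ‖(1 : R) - 2 * f n + (1 - 2 * f n) * (2 * (f n - f n * f n))‖ ≤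
          K * (2 - 1 / 2 ^ n) + K * (2 - 1 / 2 ^ n) * (2 * (q / 2 ^ n)) := by
        refine norm_add_le_of_le ih ((norm_mul_le _ _).trans ?_)
        refine mul_le_mul ih ?_ (norm_nonneg _) (by nlinarith)
        rw [two_mul, two_mul]
        exact norm_add_le_of_le (h1 n) (h1 n)
      have e2 : (1 : R) - 2 * f (n + 1) =
          1 - 2 * f n + (1 - 2 * f n) * (2 * (f n - f n * f n)) := by
        rw [hf, one_sub_two_mul_newtonStep]
        noncomm_ring
      rw [e2]
      refine e1.trans ?_
      have e3 : q / 2 ^ n = q * (1 / 2 ^ n) := by ring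
      have e4 : (1 : ℝ) / 2 ^ (n + 1) = 1 / 2 ^ n / 2 := by rw [pow_succ]; ring
      rw [e3, e4]
      generalize (1 : ℝ) / 2 ^ n = c at hp hp1
      have : (2 - c) + (2 - c) * (2 * (q * c)) ≤ 2 - c / 2 := by nlinarith [mul_nonneg hq hp.le]
      nlinarith
  have h3 : ∀ n, dist (f n) (f (n + 1)) ≤ 4 * K * q * 2 / 2 / 2 / 2 ^ n := by
    intro n
    have hp : (0 : ℝ) < 1 / 2 ^ n := by positivity
    rw [hf, newtonStep, dist_self_add_right, ← norm_neg, ← neg_mul, neg_sub]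
    refine (norm_mul_le _ _).trans ((mul_le_mul (h2 n) (h1 n) (norm_nonneg _) ?_).trans ?_)
    · exact (norm_nonneg _).trans (h2 n)
    · have : K * (2 - 1 / 2 ^ n) ≤ K * 2 := by nlinarith
      calc K * (2 - 1 / 2 ^ n) * (q / 2 ^ n) ≤ K * 2 * (q / 2 ^ n) := by gcongr
        _ = _ := by ring
  obtain ⟨e, he⟩ := cauchySeq_tendsto_of_complete (cauchySeq_of_le_geometric_two h3)
  refine ⟨e, ?_, ?_⟩
  · have t1 : Tendsto (fun n => f n - f n * f n) atTop (𝓝 (e - e * e)) := he.sub (he.mul he)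
    have t2 : Tendsto (fun n => f n - f n * f n) atTop (𝓝 0) := by
      refine squeeze_zero_norm h1 ?_
      have := (tendsto_pow_atTop_nhds_zero_of_lt_one (r := (1 / 2 : ℝ)) (by norm_num)
        (by norm_num)).const_mul q
      simpa [div_eq_mul_inv] using this
    exact (sub_eq_zero.1 (tendsto_nhds_unique t1 t2)).symm
  · have := dist_le_of_le_geometric_two_of_tendsto₀ h3 he
    rw [dist_comm, dist_eq_norm] at this
    refine this.trans (le_of_eq ?_)
    ring

end Newton

section Units

variable {R ι : Type*} [NormedRing R] [CompleteSpace R] [Fintype ι] [DecidableEq ι]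

attribute [local instance] Matrix.linftyOpNormedRing

theorem completeSpace_matrix : @CompleteSpace (Matrix ι ι R)
    (Matrix.linftyOpNormedRing (n := ι) (α := R)).toUniformSpace :=
  inferInstanceAs (CompleteSpace (ι → ι → R))

attribute [local instance] completeSpace_matrix

theorem isOpen_isUnit_matrix : IsOpen {x : Matrix ι ι R | IsUnit x} :=
  Units.isOpen (R := Matrix ι ι R)

theorem isOpenEmbedding_units_matrix :
    Topology.IsOpenEmbedding (Units.val : (Matrix ι ι R)ˣ → Matrix ι ι R) :=
  Units.isOpenEmbedding_val (R := Matrix ι ι R)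

/-- A continuous family of invertible matrices is a path in the general linear group. -/
theorem joined_of_continuous (w : ℝ → (Matrix ι ι R)ˣ)
    (hw : Continuous fun t => (w t : Matrix ι ι R)) : Joined (w 0) (w 1) := by
  have h : Continuous w := isOpenEmbedding_units_matrix.isInducing.continuous_iff.2 hw
  exact ⟨⟨⟨fun t => w t, h.comp continuous_subtype_val⟩, by simp, by simp⟩⟩

variable (R ι) in
theorem locallyPathConnectedSpace_units [NormedSpace ℝ R] :
    LocallyPathConnectedSpace (Matrix ι ι R)ˣ :=
  haveI : LocallyPathConnectedSpace (Matrix ι ι R) :=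
    inferInstanceAs (LocallyPathConnectedSpace (ι → ι → R))
  isOpenEmbedding_units_matrix.locallyPathConnectedSpace

/-- If `z = e f + (1 - e) (1 - f)` is invertible, then `z f = e z`, so `e` and `f` are similar. -/
theorem mvN_of_isUnit {R ι : Type*} [Ring R] [Fintype ι] [DecidableEq ι] {e f : Matrix ι ι R}
    (he : e * e = e) (hf : f * f = f) (h : IsUnit (e * f + (1 - e) * (1 - f))) : MvN e f := by
  obtain ⟨z, hz⟩ := h
  have h1 : (z : Matrix ι ι R) * f = e * z := by
    rw [hz, add_mul, mul_add, mul_assoc, hf, mul_assoc, sub_mul 1 f, hf, ← mul_assoc e e, he,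
      ← mul_assoc, mul_sub e, he]
    simp
  have h2 : f * (↑z⁻¹ : Matrix ι ι R) = (↑z⁻¹ : Matrix ι ι R) * e := by
    rw [Units.mul_inv_eq_iff_eq_mul, mul_assoc, ← h1, Units.inv_mul_cancel_left]
  refine ⟨(z : Matrix ι ι R) * f, f * (↑z⁻¹ : Matrix ι ι R), ?_, ?_⟩
  · rw [mul_assoc, ← mul_assoc f f, hf, h2, Units.mul_inv_cancel_left]
  · rw [mul_assoc, Units.inv_mul_cancel_left, hf]

/-- Idempotents close to a given idempotent are equivalent to it. -/
theorem eventually_mvN {e : Matrix ι ι R} (he : e * e = e) :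
    ∀ᶠ f in 𝓝 e, f * f = f → MvN e f := by
  have hc : Continuous fun f : Matrix ι ι R => e * f + (1 - e) * (1 - f) := by fun_prop
  have h1 : IsUnit (e * e + (1 - e) * (1 - e)) := by
    have : e * e + (1 - e) * (1 - e) = 1 := by
      simp [mul_sub, sub_mul, he]
    rw [this]
    exact isUnit_one
  filter_upwards [hc.continuousAt.eventually (isOpen_isUnit_matrix.mem_nhds h1)] with f hf h
  exact mvN_of_isUnit he h hf

/-- The endpoints of a path of idempotents are equivalent. -/
theorem mvN_of_continuous (e : ℝ → Matrix ι ι R) (hc : Continuous e)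
    (he : ∀ t, e t * e t = e t) : MvN (e 0) (e 1) := by
  refine PreconnectedSpace.induction₂' (fun s t : ℝ => MvN (e s) (e t)) (fun s => ?_) ?_ 0 1
  · filter_upwards [hc.continuousAt.eventually (eventually_mvN (he s))] with t ht
    exact ⟨ht (he t), (ht (he t)).symm⟩
  · exact ⟨fun a b c h h' => MvN.trans (he a) (he c) h h'⟩

end Units

section ComplexUnits

/-- The group `GL_n(ℂ)` is path connected: the complex line through `1` and `u` meets the zero set
of the determinant in finitely many points only. -/
theorem joined_one_complex {n : ℕ} (u : GLn ℂ n) : Joined 1 u := by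
  let P : Polynomial ℂ := (((1 : Matrix (Fin n) (Fin n) (Polynomial ℂ)) +
    (Polynomial.X : Polynomial ℂ) • ((u : Matrix (Fin n) (Fin n) ℂ) - 1).map Polynomial.C)).det
  have hP : ∀ z : ℂ, P.eval z = (1 + z • ((u : Matrix (Fin n) (Fin n) ℂ) - 1)).det := by
    intro z
    rw [← Polynomial.coe_evalRingHom, RingHom.map_det]
    congr 1
    ext i j
    simp only [RingHom.mapMatrix_apply, Matrix.map_apply, Matrix.add_apply, Matrix.smul_apply,
      smul_eq_mul, map_add, Polynomial.coe_evalRingHom, Matrix.one_apply]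
    split_ifs <;> simp
  have hP0 : P.eval 0 = 1 := by rw [hP]; simp
  have hne : P ≠ 0 := by
    rintro h
    rw [h] at hP0
    simp at hP0
  have hc : ({z : ℂ | P.IsRoot z}).Countable :=
    (Polynomial.finite_setOfPred_isRoot hne).countable
  have hpc := hc.isPathConnected_compl_of_one_lt_rank (by rw [Complex.rank_real_complex]; norm_num)
  have h0 : (0 : ℂ) ∈ ({z : ℂ | P.IsRoot z})ᶜ := by
    change ¬ P.eval 0 = 0
    rw [hP0]; norm_num
  have h1 : (1 : ℂ) ∈ ({z : ℂ | P.IsRoot z})ᶜ := by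
    change ¬ P.eval 1 = 0
    rw [hP, one_smul, add_sub_cancel]
    exact ((Matrix.isUnit_iff_isUnit_det _).1 u.isUnit).ne_zero
  obtain ⟨γ, hγ⟩ := hpc.joinedIn 0 h0 1 h1
  have hu : ∀ t, IsUnit (1 + γ t • ((u : Matrix (Fin n) (Fin n) ℂ) - 1)) := fun t => by
    rw [Matrix.isUnit_iff_isUnit_det, ← hP]
    exact isUnit_iff_ne_zero.2 (hγ t)
  refine ⟨⟨⟨fun t => (hu t).unit, ?_⟩, ?_, ?_⟩⟩
  · refine isOpenEmbedding_units_matrix.isInducing.continuous_iff.2 ?_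
    change Continuous fun t => 1 + γ t • ((u : Matrix (Fin n) (Fin n) ℂ) - 1)
    fun_prop
  · refine Units.ext ?_
    simp
  · refine Units.ext ?_
    simp

end ComplexUnits

end KTheory
end

noncomputable section

/-! ### Homomorphisms into matrix algebras and their unital extensions -/

namespace KTheory

section Homs

variable {A B κ : Type*} [NonUnitalNormedRing A] [NormedSpace ℂ A] [IsScalarTower ℂ A A]
  [SMulCommClass ℂ A A] [NonUnitalNormedRing B] [NormedSpace ℂ B] [IsScalarTower ℂ B B]
  [SMulCommClass ℂ B B]

variable (A) in
/-- The inclusion `A → A⁺`. -/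
def inrHom : A →ₙₐ[ℂ] Unitized A :=
  ((WithLp.unitizationAlgEquiv (𝕜 := ℂ) (A := A) ℂ).symm : Unitization ℂ A →ₙₐ[ℂ] Unitized A).comp
    (Unitization.inrNonUnitalAlgHom ℂ A)

theorem inrHom_apply (a : A) : inrHom A a = WithLp.toLp 1 (a : Unitization ℂ A) := rfl

theorem continuous_inrHom : Continuous (inrHom A) :=
  (WithLp.unitization_isometry_inr (𝕜 := ℂ) (A := A)).continuous

/-- The unital extension `B⁺ → C` of a homomorphism from `B` to a unital algebra. -/
def unitalLift {C : Type*} [Ring C] [Algebra ℂ C] (φ : B →ₙₐ[ℂ] C) : Unitized B →ₐ[ℂ] C :=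
  (Unitization.lift φ).comp (WithLp.unitizationAlgEquiv (𝕜 := ℂ) (A := B) ℂ).toAlgHom

theorem unitalLift_apply {C : Type*} [Ring C] [Algebra ℂ C] (φ : B →ₙₐ[ℂ] C) (x : Unitized B) :
    unitalLift φ x = algebraMap ℂ C x.ofLp.fst + φ x.ofLp.snd := rfl

/-- The unital extension `B⁺ → A⁺` of a homomorphism `B → A`. -/
def plus (f : B →ₙₐ[ℂ] A) : Unitized B →ₐ[ℂ] Unitized A := unitalLift ((inrHom A).comp f)

variable [Fintype κ] [DecidableEq κ]

variable (A κ) in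
/-- The entrywise inclusion of matrices over `A` into matrices over `A⁺`. -/
def inrMatrix : Matrix κ κ A →ₙₐ[ℂ] Matrix κ κ (Unitized A) where
  toFun M := M.map (inrHom A)
  map_smul' c M := by
    ext i j
    exact map_smul (inrHom A) c (M i j)
  map_zero' := Matrix.map_zero _ (map_zero (inrHom A))
  map_add' M N := Matrix.map_add _ (map_add (inrHom A)) M N
  map_mul' M N := by
    refine Matrix.ext fun i j => ?_
    simp only [Matrix.map_apply, Matrix.mul_apply, map_sum, map_mul]

/-- The extension of a homomorphism `B → M_κ(A)` to matrices over the unitizations. -/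
def amplify (φ : B →ₙₐ[ℂ] Matrix κ κ A) (n : ℕ) :
    Matrix (Fin n) (Fin n) (Unitized B) →+* Matrix (Fin n × κ) (Fin n × κ) (Unitized A) :=
  (Matrix.compRingEquiv (Fin n) κ (Unitized A)).toRingHom.comp
    (unitalLift ((inrMatrix A κ).comp φ)).toRingHom.mapMatrix

theorem amplify_apply (φ : B →ₙₐ[ℂ] Matrix κ κ A) (n : ℕ)
    (x : Matrix (Fin n) (Fin n) (Unitized B)) (p q : Fin n) (i j : κ) :
    amplify φ n x (p, i) (q, j) =
      algebraMap ℂ (Matrix κ κ (Unitized A)) (x p q).ofLp.fst i j +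
        inrHom A (φ (x p q).ofLp.snd i j) := rfl

/-- The diagonal homomorphism `b ↦ diag(f_i(b))`. -/
def diagHom (f : κ → B →ₙₐ[ℂ] A) : B →ₙₐ[ℂ] Matrix κ κ A where
  toFun b := Matrix.diagonal fun i => f i b
  map_smul' c b := by
    ext i j
    by_cases h : i = j <;> simp [h, Matrix.diagonal]
  map_zero' := by simp
  map_add' b b' := by simp
  map_mul' b b' := by simp

theorem amplify_diagHom (f : κ → B →ₙₐ[ℂ] A) (n : ℕ)
    (x : Matrix (Fin n) (Fin n) (Unitized B)) :
    amplify (diagHom f) n x = Matrix.blockDiagonal fun i => x.map (plus (f i)) := by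
  refine Matrix.ext fun ⟨p, i⟩ ⟨q, j⟩ => ?_
  rw [amplify_apply, Matrix.blockDiagonal_apply, Matrix.algebraMap_matrix_apply]
  by_cases h : i = j
  · subst h
    simp [diagHom, plus, unitalLift_apply]
  · simp [diagHom, h]

/-- Two homomorphisms `B → M_κ(A)` are homotopic if a pointwise continuous family of homomorphisms
connects them. -/
def Homotopic (φ ψ : B →ₙₐ[ℂ] Matrix κ κ A) : Prop :=
  ∃ h : ℝ → B →ₙₐ[ℂ] Matrix κ κ A, (∀ b, Continuous fun t => h t b) ∧ h 0 = φ ∧ h 1 = ψ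

theorem continuous_amplify {h : ℝ → B →ₙₐ[ℂ] Matrix κ κ A} (hc : ∀ b, Continuous fun t => h t b)
    (n : ℕ) (x : Matrix (Fin n) (Fin n) (Unitized B)) :
    Continuous fun t => amplify (h t) n x := by
  refine continuous_matrix fun ⟨p, i⟩ ⟨q, j⟩ => ?_
  simp only [amplify_apply]
  exact continuous_const.add (continuous_inrHom.comp ((hc _).matrix_elem i j))

theorem Homotopic.joined [CompleteSpace A] {φ ψ : B →ₙₐ[ℂ] Matrix κ κ A} (h : Homotopic φ ψ)
    {n : ℕ} (u : GLn (Unitized B) n) :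
    Joined (Units.map (amplify φ n).toMonoidHom u) (Units.map (amplify ψ n).toMonoidHom u) := by
  obtain ⟨h, hc, rfl, rfl⟩ := h
  exact joined_of_continuous (fun t => Units.map (amplify (h t) n).toMonoidHom u)
    (continuous_amplify hc n u)

theorem Homotopic.mvN [CompleteSpace A] {φ ψ : B →ₙₐ[ℂ] Matrix κ κ A} (h : Homotopic φ ψ)
    {n : ℕ} {e : Matrix (Fin n) (Fin n) (Unitized B)} (he : e * e = e) :
    MvN (amplify φ n e) (amplify ψ n e) := by
  obtain ⟨h, hc, rfl, rfl⟩ := h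
  exact mvN_of_continuous (fun t => amplify (h t) n e) (continuous_amplify hc n e)
    fun t => by rw [← map_mul, he]

omit [IsScalarTower ℂ B B] [SMulCommClass ℂ B B] in
/-- A rotation moves a homomorphism from the third to the second diagonal place. -/
theorem homotopic_rotate (f : B →ₙₐ[ℂ] A) :
    Homotopic (diagHom ![0, 0, f]) (diagHom ![0, f, 0]) := by
  let c : ℝ → Fin 3 → ℂ := fun t =>
    ![0, (Real.sin (t * (Real.pi / 2)) : ℝ), (Real.cos (t * (Real.pi / 2)) : ℝ)]
  have hc : ∀ t, ∑ i, c t i * c t i = 1 := fun t => by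
    have h := Real.sin_sq_add_cos_sq (t * (Real.pi / 2))
    simp only [c, Fin.sum_univ_three, Matrix.cons_val]
    norm_cast
    rw [← h]
    ring
  refine ⟨fun t =>
    { toFun := fun b => Matrix.of fun i j => (c t i * c t j) • f b
      map_smul' := fun z b => by
        ext i j
        simp [smul_comm z]
      map_zero' := by
        ext i j
        simp
      map_add' := fun b b' => by
        ext i j
        simp
      map_mul' := fun b b' => by
        ext i j
        simp only [Matrix.mul_apply, Matrix.of_apply, map_mul, smul_mul_smul_comm]
        rw [← Finset.sum_smul]
        congr 1
        calc c t i * c t j = c t i * c t j * ∑ k, c t k * c t k := by rw [hc, mul_one]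
          _ = _ := by
            rw [Finset.mul_sum]
            exact Finset.sum_congr rfl fun k _ => by ring }, fun b => ?_, ?_, ?_⟩
  · refine continuous_matrix fun i j => ?_
    have h1 : ∀ i, Continuous fun t => c t i := by
      intro i
      fin_cases i
      · exact continuous_const
      · exact Complex.continuous_ofReal.comp (by fun_prop)
      · exact Complex.continuous_ofReal.comp (by fun_prop)
    exact ((h1 i).mul (h1 j)).smul continuous_const
  · ext b i j
    fin_cases i <;> fin_cases j <;> simp [c, diagHom]
  · ext b i j
    fin_cases i <;> fin_cases j <;> simp [c, diagHom]

end Homs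

end KTheory
end

noncomputable section

/-! ### Swindles and the vanishing of `K`-theory -/

namespace KTheory

section VMonoid

variable {R S : Type*} [Ring R] [Ring S]

/-- The class in `V(R)` of an idempotent matrix. -/
def V.mk (e : Idem R) : V R := Quotient.mk (idemSetoid R) e

theorem V.sound {e f : Idem R} (h : MvN e.mat f.mat) : V.mk e = V.mk f :=
  Quotient.sound (s := idemSetoid R) h

theorem V.mk_sum (e f : Idem R) : V.mk (e.sum f) = V.mk e + V.mk f := rfl

theorem V.map_mk (φ : R →+* S) (e : Idem R) : V.map φ (V.mk e) = V.mk (e.map φ) := rfl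

/-- Three blocks of size `n`, as pairs of an index and a block number. -/
def blockEquiv (n : ℕ) : (Fin n ⊕ Fin n) ⊕ Fin n ≃ Fin n × Fin 3 where
  toFun := Sum.elim (Sum.elim (·, 0) (·, 1)) (·, 2)
  invFun q := ![Sum.inl (Sum.inl q.1), Sum.inl (Sum.inr q.1), Sum.inr q.1] q.2
  left_inv := by rintro ((p | p) | p) <;> rfl
  right_inv := by
    rintro ⟨p, i⟩
    fin_cases i <;> rfl

theorem blockDiagonal_idem {n : ℕ} {M : Fin 3 → Matrix (Fin n) (Fin n) R}
    (hM : ∀ i, M i * M i = M i) :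
    Matrix.blockDiagonal M * Matrix.blockDiagonal M = Matrix.blockDiagonal M := by
  rw [← Matrix.blockDiagonal_mul]
  exact congrArg _ (funext hM)

theorem mvN_blockDiagonal_sum {n : ℕ} {M : Fin 3 → Matrix (Fin n) (Fin n) R}
    (hM : ∀ i, M i * M i = M i) :
    MvN (Matrix.blockDiagonal M)
      ((Idem.sum (Idem.sum ⟨n, M 0, hM 0⟩ ⟨n, M 1, hM 1⟩) ⟨n, M 2, hM 2⟩)).mat := by
  have h1 := MvN.submatrix (blockDiagonal_idem hM) (blockEquiv n)
  have h2 : (Matrix.blockDiagonal M).submatrix (blockEquiv n) (blockEquiv n) =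
      Matrix.fromBlocks (Matrix.fromBlocks (M 0) 0 0 (M 1)) 0 0 (M 2) := by
    ext ((p | p) | p) ((q | q) | q) <;> rfl
  rw [h2] at h1
  have hB := fromBlocks_idem (fromBlocks_idem (hM 0) (hM 1)) (hM 2)
  refine MvN.trans (blockDiagonal_idem hM) (Idem.idem _) h1.symm ?_
  have h3 := (Idem.sum_mvN ⟨n, M 0, hM 0⟩ ⟨n, M 1, hM 1⟩).symm
  exact MvN.trans hB (Idem.idem _) (MvN.fromBlocks h3 (MvN.refl (hM 2)))
    (Idem.sum_mvN (Idem.sum ⟨n, M 0, hM 0⟩ ⟨n, M 1, hM 1⟩) ⟨n, M 2, hM 2⟩).symm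

theorem V.mk_blockDiagonal {n : ℕ} {M N : Fin 3 → Matrix (Fin n) (Fin n) R}
    (hM : ∀ i, M i * M i = M i) (hN : ∀ i, N i * N i = N i)
    (h : MvN (Matrix.blockDiagonal M) (Matrix.blockDiagonal N)) :
    V.mk ⟨n, M 0, hM 0⟩ + V.mk ⟨n, M 1, hM 1⟩ + V.mk ⟨n, M 2, hM 2⟩ =
      V.mk ⟨n, N 0, hN 0⟩ + V.mk ⟨n, N 1, hN 1⟩ + V.mk ⟨n, N 2, hN 2⟩ := by
  simp only [← V.mk_sum]
  refine V.sound (MvN.trans (Idem.idem _) (Idem.idem _) (mvN_blockDiagonal_sum hM).symm ?_)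
  exact MvN.trans (blockDiagonal_idem hM) (Idem.idem _) h (mvN_blockDiagonal_sum hN)

theorem K0Unital.map_of (φ : R →+* S) (x : V R) :
    K0Unital.map φ (Algebra.GrothendieckAddGroup.of x) =
      Algebra.GrothendieckAddGroup.of (V.map φ x) :=
  DFunLike.congr_fun (Algebra.GrothendieckAddGroup.lift.symm_apply_apply
    (Algebra.GrothendieckAddGroup.of.comp (V.map φ))) x

/-- If every idempotent matrix over `R` is stably equivalent to the one obtained from it through
`φ : R → S` and `ψ : S → R`, then `K₀(R) → K₀(S)` is injective. -/
theorem K0Unital.ker_subsingleton (φ : R →+* S) (ψ : S →+* R)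
    (h : ∀ e : Idem R, Algebra.GrothendieckAddGroup.of (V.mk e) =
      Algebra.GrothendieckAddGroup.of (V.mk ((e.map φ).map ψ))) :
    Subsingleton (K0Unital.map φ).ker := by
  have h1 : (K0Unital.map ψ).comp (K0Unital.map φ) = AddMonoidHom.id (K0Unital R) := by
    refine Algebra.GrothendieckAddGroup.lift.symm.injective (AddMonoidHom.ext ?_)
    rintro ⟨e⟩
    change K0Unital.map ψ (K0Unital.map φ (Algebra.GrothendieckAddGroup.of (V.mk e))) =
      Algebra.GrothendieckAddGroup.of (V.mk e)
    rw [K0Unital.map_of, K0Unital.map_of, V.map_mk, V.map_mk, ← h e]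
  refine ⟨fun x y => Subtype.ext ?_⟩
  have hx := DFunLike.congr_fun h1 (x : K0Unital R)
  have hy := DFunLike.congr_fun h1 (y : K0Unital R)
  simp only [AddMonoidHom.comp_apply, AddMonoidHom.id_apply] at hx hy
  rw [← hx, ← hy, AddMonoidHom.mem_ker.1 x.2, AddMonoidHom.mem_ker.1 y.2]

end VMonoid

section Swindle

variable {A B : Type*} [NonUnitalNormedRing A] [NormedSpace ℂ A] [IsScalarTower ℂ A A]
  [SMulCommClass ℂ A A] [NonUnitalNormedRing B] [NormedSpace ℂ B] [IsScalarTower ℂ B B]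
  [SMulCommClass ℂ B B]

/-- A swindle for `f : B → A`: a homomorphism `Φ` and homotopies
`diag(f, Φ, 0) ∼ diag(f, Φ', 0) ∼ diag(0, 0, Φ)`, which cancel the class of `f` in `K`-theory. -/
def HasSwindle (f : B →ₙₐ[ℂ] A) : Prop :=
  ∃ Φ Φ' : B →ₙₐ[ℂ] A, Homotopic (diagHom ![f, Φ, 0]) (diagHom ![f, Φ', 0]) ∧
    Homotopic (diagHom ![f, Φ', 0]) (diagHom ![0, 0, Φ])

theorem plus_zero_eq (f : B →ₙₐ[ℂ] A) (x : Unitized B) :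
    plus (0 : B →ₙₐ[ℂ] A) x = algebraMap ℂ (Unitized A) (augmentation A (plus f x)) := by
  have h : ∀ c : ℂ, ((algebraMap ℂ (Unitization ℂ A)) c).toProd.1 = c := fun c => rfl
  simp [plus, unitalLift_apply, augmentation, inrHom_apply, WithLp.unitization_algebraMap, h]

/-- A swindle for `f` identifies the class of the image of an idempotent under `f` with that of
its scalar part. -/
theorem HasSwindle.of_mk_eq [CompleteSpace A] {f : B →ₙₐ[ℂ] A} (hf : HasSwindle f)
    (e : Idem (Unitized B)) :
    Algebra.GrothendieckAddGroup.of (V.mk (e.map (plus f : Unitized B →+* Unitized A))) =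
      Algebra.GrothendieckAddGroup.of
        (V.mk (e.map (plus (0 : B →ₙₐ[ℂ] A) : Unitized B →+* Unitized A))) := by
  obtain ⟨Φ, Φ', h1, h2⟩ := hf
  obtain ⟨n, e, he⟩ := e
  have hi : ∀ g : B →ₙₐ[ℂ] A, e.map (plus g) * e.map (plus g) = e.map (plus g) := fun g =>
    ((⟨n, e, he⟩ : Idem (Unitized B)).map (plus g : Unitized B →+* Unitized A)).idem
  have hs : ∀ φ : B →ₙₐ[ℂ] Matrix (Fin 3) (Fin 3) A, amplify φ n e * amplify φ n e = amplify φ n e :=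
    fun φ => by rw [← map_mul, he]
  have h3 := MvN.trans (hs _) (hs _) (MvN.trans (hs _) (hs _) (h1.mvN he) (h2.mvN he))
    ((homotopic_rotate Φ).mvN he)
  rw [amplify_diagHom, amplify_diagHom] at h3
  have h4 := V.mk_blockDiagonal (fun i => hi _) (fun i => hi _) h3
  have h5 := congrArg Algebra.GrothendieckAddGroup.of h4
  simp only [map_add] at h5
  exact add_right_cancel (add_right_cancel h5)

/-- The identification of `Fin n × Fin 3` with `Fin (3 * n)` that lists the first block first. -/
def blockIndex (n : ℕ) : Fin n × Fin 3 ≃ Fin (3 * n) :=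
  (Equiv.prodComm _ _).trans finProdFinEquiv

theorem padMatrix_eq_blockDiagonal {R : Type*} [Ring R] {n : ℕ} (a : Matrix (Fin n) (Fin n) R) :
    padMatrix n (3 * n) a =
      (Matrix.blockDiagonal ![a, 1, 1]).submatrix (blockIndex n).symm (blockIndex n).symm := by
  refine Matrix.ext fun x y => ?_
  obtain ⟨⟨p, i⟩, rfl⟩ := (blockIndex n).surjective x
  obtain ⟨⟨q, j⟩, rfl⟩ := (blockIndex n).surjective y
  have hv : ∀ (p : Fin n) (i : Fin 3), (blockIndex n (p, i) : ℕ) = p + n * i := fun p i => rfl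
  have h1 : ∀ (p : Fin n) (i : Fin 3), (blockIndex n (p, i) : ℕ) < n ↔ i = 0 := by
    intro p i
    rw [hv]
    constructor
    · intro h
      by_contra h'
      have : 1 ≤ (i : ℕ) := Nat.one_le_iff_ne_zero.2 fun h0 => h' (Fin.ext h0)
      nlinarith
    · rintro rfl
      simp
  simp only [padMatrix, Matrix.of_apply, Matrix.submatrix_apply, Equiv.symm_apply_apply,
    Matrix.blockDiagonal_apply, EmbeddingLike.apply_eq_iff_eq, Prod.mk.injEq]
  by_cases hi : i = 0
  · subst hi
    by_cases hj : j = 0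
    · subst hj
      rw [dif_pos ⟨(h1 p 0).2 rfl, (h1 q 0).2 rfl⟩, if_pos rfl]
      simp only [Matrix.cons_val_zero]
      congr 1
    · rw [dif_neg fun h => hj ((h1 q j).1 h.2), if_neg fun h => hj h.2.symm,
        if_neg fun h => hj h.symm]
  · rw [dif_neg fun h => hi ((h1 p i).1 h.1)]
    by_cases hij : i = j
    · subst hij
      fin_cases i
      · exact absurd rfl hi
      · change (if _ then (1 : R) else 0) = (1 : Matrix (Fin n) (Fin n) R) p q
        simp only [Matrix.one_apply, and_true]
      · change (if _ then (1 : R) else 0) = (1 : Matrix (Fin n) (Fin n) R) p q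
        simp only [Matrix.one_apply, and_true]
    · rw [if_neg fun h => hij h.2, if_neg hij]

/-- A swindle for `f` connects the image of an invertible matrix under `f` with its scalar part,
after stabilization. -/
theorem HasSwindle.joined [CompleteSpace A] {f : B →ₙₐ[ℂ] A} (hf : HasSwindle f) {n : ℕ}
    (u : GLn (Unitized B) n) :
    Joined 1 (padGL n (3 * n) (by omega)
      (Units.map (plus f : Unitized B →+* Unitized A).mapMatrix.toMonoidHom u *
        (Units.map (plus (0 : B →ₙₐ[ℂ] A) : Unitized B →+* Unitized A).mapMatrix.toMonoidHom u)⁻¹)) := by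
  obtain ⟨Φ, Φ', h1, h2⟩ := hf
  have h3 := ((h1.joined u).trans (h2.joined u)).trans ((homotopic_rotate Φ).joined u)
  let D : (Fin 3 → B →ₙₐ[ℂ] A) → (Matrix (Fin n × Fin 3) (Fin n × Fin 3) (Unitized A))ˣ :=
    fun g => Units.map (amplify (diagHom g) n).toMonoidHom u
  have h4 : Joined 1 (D ![f, Φ, 0] * (D ![0, Φ, 0])⁻¹) := by
    have := h3.symm.mul (Joined.refl (D ![0, Φ, 0])⁻¹)
    rwa [mul_inv_cancel] at this
  let ρ : (Matrix (Fin n × Fin 3) (Fin n × Fin 3) (Unitized A))ˣ →* GLn (Unitized A) (3 * n) :=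
    Units.map (Matrix.reindexRingEquiv (Unitized A) (blockIndex n)).toMonoidHom
  have hρ : Continuous ρ := Continuous.units_map _ (by
    change Continuous fun M : Matrix (Fin n × Fin 3) (Fin n × Fin 3) (Unitized A) =>
      M.submatrix (blockIndex n).symm (blockIndex n).symm
    fun_prop)
  have h5 := h4.map hρ
  rw [map_one] at h5
  convert h5 using 1
  set w := Units.map (plus f : Unitized B →+* Unitized A).mapMatrix.toMonoidHom u *
        (Units.map (plus (0 : B →ₙₐ[ℂ] A) : Unitized B →+* Unitized A).mapMatrix.toMonoidHom u)⁻¹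
    with hw
  rw [map_mul ρ, map_inv ρ, eq_mul_inv_iff_mul_eq]
  refine Units.ext ?_
  have hD : ∀ g, (ρ (D g) : Matrix _ _ (Unitized A)) =
      (Matrix.blockDiagonal fun i => (u : Matrix _ _ (Unitized B)).map (plus (g i))).submatrix
        (blockIndex n).symm (blockIndex n).symm := fun g => by
    rw [← amplify_diagHom]
    rfl
  rw [Units.val_mul, hD, hD]
  change padMatrix n (3 * n) (w : Matrix _ _ (Unitized A)) * _ = _
  rw [padMatrix_eq_blockDiagonal, Matrix.submatrix_mul_equiv, ← Matrix.blockDiagonal_mul]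
  congr 2
  have h6 : w * Units.map (plus (0 : B →ₙₐ[ℂ] A) : Unitized B →+* Unitized A).mapMatrix.toMonoidHom u
      = Units.map (plus f : Unitized B →+* Unitized A).mapMatrix.toMonoidHom u := by
    rw [hw, inv_mul_cancel_right]
  have h7 := congrArg Units.val h6
  funext i
  fin_cases i
  · exact h7
  · exact one_mul _
  · exact one_mul _

end Swindle

end KTheory
end

noncomputable section

/-! ### Approximation by matrices over a subalgebra -/

namespace KTheory

attribute [local instance] Matrix.linftyOpNormedRing completeSpace_matrix

section Approximation

variable {A B : Type*} [NonUnitalNormedRing A] [NormedSpace ℂ A] [IsScalarTower ℂ A A]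
  [SMulCommClass ℂ A A] [NonUnitalNormedRing B] [NormedSpace ℂ B] [IsScalarTower ℂ B B]
  [SMulCommClass ℂ B B]

theorem nnnorm_plus {f : B →ₙₐ[ℂ] A} (hf : ∀ b, ‖f b‖₊ = ‖b‖₊) (x : Unitized B) :
    ‖plus f x‖₊ = ‖x‖₊ := by
  have h : ∀ c : ℂ, ((algebraMap ℂ (Unitization ℂ A)) c).toProd = (c, 0) := fun c => rfl
  rw [WithLp.unitization_nnnorm_def, WithLp.unitization_nnnorm_def, ← hf]
  simp [plus, unitalLift_apply, inrHom_apply, WithLp.unitization_algebraMap, h]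

theorem norm_map_plus {f : B →ₙₐ[ℂ] A} (hf : ∀ b, ‖f b‖₊ = ‖b‖₊) {n : ℕ}
    (x : Matrix (Fin n) (Fin n) (Unitized B)) :
    ‖(plus f : Unitized B →+* Unitized A).mapMatrix x‖ = ‖x‖ := by
  rw [Matrix.linfty_opNorm_def, Matrix.linfty_opNorm_def]
  simp [nnnorm_plus hf]

/-- Every matrix over `A⁺` is approximated by matrices with the same scalar parts whose `A`-parts
lie in a given dense subset of `A`. -/
theorem exists_approx {A₀ : Set A} (hA₀ : Dense A₀) {n : ℕ}
    (x : Matrix (Fin n) (Fin n) (Unitized A)) {P : Matrix (Fin n) (Fin n) (Unitized A) → Prop}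
    (hP : ∀ᶠ y in 𝓝 x, P y) :
    ∃ (c : Fin n → Fin n → ℂ) (a : Fin n → Fin n → A), (∀ i j, a i j ∈ A₀) ∧
      P (Matrix.of fun i j => algebraMap ℂ (Unitized A) (c i j) + inrHom A (a i j)) := by
  let c : Fin n → Fin n → ℂ := fun i j => (x i j).ofLp.fst
  let g : (Fin n → Fin n → A) → Matrix (Fin n) (Fin n) (Unitized A) := fun a =>
    Matrix.of fun i j => algebraMap ℂ (Unitized A) (c i j) + inrHom A (a i j)
  have hg : Continuous g := by
    refine continuous_matrix fun i j => ?_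
    exact continuous_const.add (continuous_inrHom.comp
      ((continuous_apply j).comp (continuous_apply i)))
  have hx : g (fun i j => (x i j).ofLp.snd) = x := by
    refine Matrix.ext fun i j => WithLp.ofLp_injective 1 ?_
    exact Unitization.inl_fst_add_inr_snd_eq _
  have hd : Dense {a : Fin n → Fin n → A | ∀ i j, a i j ∈ A₀} := by
    have := dense_pi Set.univ fun (i : Fin n) _ => dense_pi Set.univ fun (j : Fin n) _ => hA₀
    convert this using 1
    ext a
    simp [Set.mem_pi]
  have hev : ∀ᶠ a in 𝓝 (fun i j => (x i j).ofLp.snd), P (g a) := by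
    refine hg.continuousAt.eventually ?_
    rwa [hx]
  obtain ⟨a, ha, ha'⟩ := (hd.inter_nhds_nonempty hev)
  exact ⟨c, a, ha, ha'⟩

/-- The matrices over `A⁺` with `A`-parts in the range of `f : B → A` come from matrices over
`B⁺`. -/
theorem exists_preimage (f : B →ₙₐ[ℂ] A) {n : ℕ} (c : Fin n → Fin n → ℂ) {a : Fin n → Fin n → A}
    (ha : ∀ i j, a i j ∈ Set.range f) : ∃ x : Matrix (Fin n) (Fin n) (Unitized B),
      (plus f : Unitized B →+* Unitized A).mapMatrix x =
        Matrix.of fun i j => algebraMap ℂ (Unitized A) (c i j) + inrHom A (a i j) := by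
  choose b hb using ha
  refine ⟨Matrix.of fun i j => algebraMap ℂ (Unitized B) (c i j) + inrHom B (b i j), ?_⟩
  refine Matrix.ext fun i j => ?_
  change plus f (algebraMap ℂ (Unitized B) (c i j) + inrHom B (b i j)) = _
  rw [map_add, AlgHom.commutes]
  simp only [Matrix.of_apply]
  rw [← hb]
  simp [plus, unitalLift_apply, inrHom_apply]

variable [CompleteSpace A] [CompleteSpace B]

/-- An idempotent matrix over `A⁺` is equivalent to the image of an idempotent matrix over `B⁺` if
it is close enough to a matrix over `B⁺`. -/
theorem eventually_exists_idem {n : ℕ} {e : Matrix (Fin n) (Fin n) (Unitized A)}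
    (he : e * e = e) : ∀ᶠ r in 𝓝 e, ∀ (B : Type _) [NonUnitalNormedRing B] [NormedSpace ℂ B]
      [IsScalarTower ℂ B B] [SMulCommClass ℂ B B] [CompleteSpace B] (f : B →ₙₐ[ℂ] A),
      (∀ b, ‖f b‖₊ = ‖b‖₊) → ∀ x : Matrix (Fin n) (Fin n) (Unitized B),
      (plus f : Unitized B →+* Unitized A).mapMatrix x = r →
      ∃ e' : Matrix (Fin n) (Fin n) (Unitized B), e' * e' = e' ∧
        MvN e ((plus f : Unitized B →+* Unitized A).mapMatrix e') := by
  obtain ⟨δ, hδ, h⟩ := Metric.eventually_nhds_iff_ball.1 (eventually_mvN he)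
  have h1 : ∀ᶠ r in 𝓝 e, ‖r - r * r‖ < 1 / 8 := by
    have hc : Continuous fun r : Matrix (Fin n) (Fin n) (Unitized A) => ‖r - r * r‖ := by fun_prop
    refine hc.continuousAt.eventually (Iio_mem_nhds ?_)
    simp [he]
  have h2 : ∀ᶠ r in 𝓝 e, 4 * ‖1 - 2 * r‖ * ‖r - r * r‖ + ‖r - e‖ < δ := by
    have hc : Continuous fun r : Matrix (Fin n) (Fin n) (Unitized A) =>
      4 * ‖1 - 2 * r‖ * ‖r - r * r‖ + ‖r - e‖ := by fun_prop
    refine hc.continuousAt.eventually (Iio_mem_nhds ?_)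
    simpa [he] using hδ
  filter_upwards [h1, h2] with r hr1 hr2 B _ _ _ _ _ f hf x hx
  subst hx
  set F := (plus f : Unitized B →+* Unitized A).mapMatrix (m := Fin n)
  have hF : ∀ x, ‖F x‖ = ‖x‖ := norm_map_plus hf
  rw [← map_mul, ← map_sub, hF] at hr1
  obtain ⟨e', he', hn⟩ := exists_idempotent_near x hr1.le
  refine ⟨e', he', h _ ?_ (by rw [← map_mul, he'])⟩
  rw [mem_ball_iff_norm]
  calc ‖F e' - e‖ = ‖F (e' - x) + (F x - e)‖ := by rw [map_sub]; congr 1; abel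
    _ ≤ 4 * ‖1 - 2 * x‖ * ‖x - x * x‖ + ‖F x - e‖ := by
      refine norm_add_le_of_le ?_ le_rfl
      rw [hF]
      exact hn
    _ < δ := by
      have e1 : F (1 - 2 * x) = 1 - 2 * F x := by
        rw [map_sub, map_one, two_mul, two_mul, map_add]
      rwa [← hF (1 - 2 * x), e1, ← hF (x - x * x), map_sub, map_mul]

omit [CompleteSpace A] in
/-- If the images over `A⁺` of two matrices over `B⁺` are nearly inverse to each other, then the
matrices themselves are invertible. -/
theorem isUnit_of_near {f : B →ₙₐ[ℂ] A} (hf : ∀ b, ‖f b‖₊ = ‖b‖₊) {n : ℕ}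
    {x y : Matrix (Fin n) (Fin n) (Unitized B)}
    (h1 : ‖1 - (plus f : Unitized B →+* Unitized A).mapMatrix x *
      (plus f : Unitized B →+* Unitized A).mapMatrix y‖ < 1)
    (h2 : ‖1 - (plus f : Unitized B →+* Unitized A).mapMatrix y *
      (plus f : Unitized B →+* Unitized A).mapMatrix x‖ < 1) : IsUnit x := by
  rw [← map_mul, ← map_one ((plus f : Unitized B →+* Unitized A).mapMatrix (m := Fin n)),
    ← map_sub, norm_map_plus hf] at h1 h2
  have h3 := isUnit_one_sub_of_norm_lt_one h1
  have h4 := isUnit_one_sub_of_norm_lt_one h2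
  rw [sub_sub_cancel] at h3 h4
  obtain ⟨u, hu⟩ := h3
  obtain ⟨v, hv⟩ := h4
  refine isUnit_iff_exists.2 ?_
  have e1 : x * (y * (↑u⁻¹ : Matrix (Fin n) (Fin n) (Unitized B))) = 1 := by
    rw [← mul_assoc, ← hu, Units.mul_inv]
  have e2 : ((↑v⁻¹ : Matrix (Fin n) (Fin n) (Unitized B)) * y) * x = 1 := by
    rw [mul_assoc, ← hv, Units.inv_mul]
  refine ⟨y * (↑u⁻¹ : Matrix (Fin n) (Fin n) (Unitized B)), e1, ?_⟩
  rwa [← left_inv_eq_right_inv e2 e1]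

/-- Matrices over `A⁺` close to an invertible one lie in its path component. -/
theorem eventually_joined {n : ℕ} (u : GLn (Unitized A) n) :
    ∀ᶠ r in 𝓝 (u : Matrix (Fin n) (Fin n) (Unitized A)),
      ∃ v : GLn (Unitized A) n, (v : Matrix (Fin n) (Fin n) (Unitized A)) = r ∧ Joined v u := by
  have := locallyPathConnectedSpace_units (Unitized A) (Fin n)
  have h := (isOpenEmbedding_units_matrix (R := Unitized A) (ι := Fin n)).isOpenMap _
    (IsOpen.pathComponent u)
  filter_upwards [h.mem_nhds ⟨u, mem_pathComponent_self u, rfl⟩] with r hr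
  obtain ⟨v, hv, rfl⟩ := hr
  exact ⟨v, rfl, Joined.symm hv⟩

end Approximation

section Vanishing

universe u

variable {A : Type u} [NonUnitalNormedRing A] [NormedSpace ℂ A] [IsScalarTower ℂ A A]
  [SMulCommClass ℂ A A]

/-- A subset of `A` is absorbed by a swindle if it lies in the image of an isometric homomorphism
`B → A` of Banach algebras that has a swindle. -/
def Absorbed (F : Set A) : Prop :=
  ∃ (B : Type u) (_ : NonUnitalNormedRing B) (_ : NormedSpace ℂ B) (_ : IsScalarTower ℂ B B)
    (_ : SMulCommClass ℂ B B) (_ : CompleteSpace B) (f : B →ₙₐ[ℂ] A),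
    (∀ b, ‖f b‖₊ = ‖b‖₊) ∧ F ⊆ Set.range f ∧ HasSwindle f

variable [CompleteSpace A]

/-- `K₀` vanishes if every finite subset of a dense set is absorbed by a swindle: an idempotent
matrix over `A⁺` is equivalent to one whose entries come from `B⁺`, for some absorbing `B → A`. -/
theorem subsingleton_K0 {A₀ : Set A} (hA₀ : Dense A₀)
    (h : ∀ F : Set A, F.Finite → F ⊆ A₀ → Absorbed F) : Subsingleton (K0 A) := by
  refine K0Unital.ker_subsingleton _ (algebraMap ℂ (Unitized A)) fun e => ?_
  obtain ⟨c, a, ha, hP⟩ := exists_approx hA₀ e.mat (eventually_exists_idem e.idem)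
  obtain ⟨B, _, _, _, _, _, f, hf, hF, hs⟩ :=
    h (Set.range fun q : Fin e.size × Fin e.size => a q.1 q.2) (Set.finite_range _)
      (Set.range_subset_iff.2 fun q => ha _ _)
  obtain ⟨x, hx⟩ := exists_preimage f c fun i j => hF ⟨(i, j), rfl⟩
  obtain ⟨e', he', hm⟩ := hP B f hf x hx
  have h1 : V.mk e = V.mk ((⟨_, e', he'⟩ : Idem (Unitized B)).map
    (plus f : Unitized B →+* Unitized A)) := V.sound hm
  rw [← V.map_mk, ← V.map_mk, h1, hs.of_mk_eq, ← V.map_mk, V.map_mk, V.map_mk]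
  refine congrArg (fun q => Algebra.GrothendieckAddGroup.of (V.mk q)) ?_
  simp only [Idem.map, Idem.mk.injEq, heq_eq_eq, true_and]
  refine Matrix.ext fun i j => ?_
  exact plus_zero_eq f (e' i j)

theorem mapMatrix_plus_zero {A B : Type*} [NonUnitalNormedRing A] [NormedSpace ℂ A]
    [IsScalarTower ℂ A A] [SMulCommClass ℂ A A] [NonUnitalNormedRing B] [NormedSpace ℂ B]
    [IsScalarTower ℂ B B] [SMulCommClass ℂ B B] (f : B →ₙₐ[ℂ] A) {n : ℕ}
    (x : Matrix (Fin n) (Fin n) (Unitized B)) :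
    (plus (0 : B →ₙₐ[ℂ] A) : Unitized B →+* Unitized A).mapMatrix x =
      (algebraMap ℂ (Unitized A)).mapMatrix ((augmentation A).mapMatrix
        ((plus f : Unitized B →+* Unitized A).mapMatrix x)) := by
  refine Matrix.ext fun i j => ?_
  simp only [RingHom.mapMatrix_apply, Matrix.map_apply]
  exact plus_zero_eq f (x i j)

/-- The scalar part of an invertible matrix lies in the path component of the identity. -/
theorem joined_one_plus_zero {A B : Type*} [NonUnitalNormedRing A] [NormedSpace ℂ A]
    [IsScalarTower ℂ A A] [SMulCommClass ℂ A A] [NonUnitalNormedRing B] [NormedSpace ℂ B]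
    [IsScalarTower ℂ B B] [SMulCommClass ℂ B B] (f : B →ₙₐ[ℂ] A) {n : ℕ}
    (v : GLn (Unitized B) n) : Joined 1 (Units.map
      (plus (0 : B →ₙₐ[ℂ] A) : Unitized B →+* Unitized A).mapMatrix.toMonoidHom v) := by
  let σ : GLn ℂ n →* GLn (Unitized A) n :=
    Units.map (algebraMap ℂ (Unitized A)).mapMatrix.toMonoidHom
  have hσ : Continuous σ := Continuous.units_map _ (by
    change Continuous fun M : Matrix (Fin n) (Fin n) ℂ => M.map (algebraMap ℂ (Unitized A))
    exact continuous_id.matrix_map (algebraMapCLM ℂ (Unitized A)).continuous)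
  have h2 := (joined_one_complex (Units.map (augmentation A).mapMatrix.toMonoidHom
    (Units.map (plus f : Unitized B →+* Unitized A).mapMatrix.toMonoidHom v))).map hσ
  rw [map_one] at h2
  convert h2 using 1
  exact Units.ext (mapMatrix_plus_zero f _)

/-- `K₁` vanishes if every finite subset of a dense set is absorbed by a swindle. To see that a
nearby matrix over `B⁺` is invertible over `B⁺`, the inverse has to be approximated as well. -/
theorem subsingleton_K1 {A₀ : Set A} (hA₀ : Dense A₀)
    (h : ∀ F : Set A, F.Finite → F ⊆ A₀ → Absorbed F) : Subsingleton (K1 A) := by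
  suffices hsuff : ∀ (n : ℕ) (u : GLn (Unitized A) n),
      ∃ (m : ℕ) (hm : n ≤ m), Joined 1 (padGL n m hm u) by
    have h1 : ∀ x : K1 A, x = 1 := by
      intro x
      induction x using DirectLimit.induction with
      | _ n x =>
        obtain ⟨u, rfl⟩ := QuotientGroup.mk_surjective x
        obtain ⟨m, hm, hj⟩ := hsuff n u
        rw [DirectLimit.one_def m]
        refine (DirectLimit.eq_of_le _ m hm).trans ?_
        refine congrArg (fun y => (⟦⟨m, y⟩⟧ : K1 A)) ?_
        exact (QuotientGroup.eq_one_iff _).2 hj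
    exact ⟨fun x y => (h1 x).trans (h1 y).symm⟩
  intro n u
  have hprod : ∀ᶠ q : Matrix (Fin n) (Fin n) (Unitized A) × Matrix (Fin n) (Fin n) (Unitized A)
      in 𝓝 (u : Matrix (Fin n) (Fin n) (Unitized A)) ×ˢ 𝓝 (↑u⁻¹ : Matrix (Fin n) (Fin n) (Unitized A)),
      ‖1 - q.1 * q.2‖ < 1 ∧ ‖1 - q.2 * q.1‖ < 1 := by
    rw [← nhds_prod_eq]
    have c1 : Continuous fun q : Matrix (Fin n) (Fin n) (Unitized A) ×
      Matrix (Fin n) (Fin n) (Unitized A) => ‖1 - q.1 * q.2‖ := by fun_prop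
    have c2 : Continuous fun q : Matrix (Fin n) (Fin n) (Unitized A) ×
      Matrix (Fin n) (Fin n) (Unitized A) => ‖1 - q.2 * q.1‖ := by fun_prop
    refine (c1.continuousAt.eventually (Iio_mem_nhds ?_)).and
      (c2.continuousAt.eventually (Iio_mem_nhds ?_)) <;> simp
  obtain ⟨P, hP, Q, hQ, hPQ⟩ := eventually_prod_iff.1 hprod
  obtain ⟨c, a, ha, hP', w, hw, hwu⟩ := exists_approx hA₀ _ (hP.and (eventually_joined u))
  obtain ⟨c', a', ha', hQ'⟩ := exists_approx hA₀ _ hQ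
  have hnear := hPQ hP' hQ'
  obtain ⟨B, _, _, _, _, _, f, hf, hF, hs⟩ :=
    h ((Set.range fun q : Fin n × Fin n => a q.1 q.2) ∪
      Set.range fun q : Fin n × Fin n => a' q.1 q.2)
      ((Set.finite_range _).union (Set.finite_range _))
      (Set.union_subset (Set.range_subset_iff.2 fun q => ha _ _)
        (Set.range_subset_iff.2 fun q => ha' _ _))
  obtain ⟨x, hx⟩ := exists_preimage f c fun i j => hF (Or.inl ⟨(i, j), rfl⟩)
  obtain ⟨y, hy⟩ := exists_preimage f c' fun i j => hF (Or.inr ⟨(i, j), rfl⟩)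
  simp only at hnear
  rw [← hx, ← hy] at hnear
  obtain ⟨v, rfl⟩ := isUnit_of_near hf hnear.1 hnear.2
  have hwv : w = Units.map (plus f : Unitized B →+* Unitized A).mapMatrix.toMonoidHom v :=
    Units.ext (hw.trans hx.symm)
  have h3n : n ≤ 3 * n := by omega
  refine ⟨3 * n, h3n, ?_⟩
  have h4 := (hs.joined v).mul ((joined_one_plus_zero f v).map (continuous_padGL n (3 * n) h3n))
  rw [map_one, one_mul, ← map_mul, inv_mul_cancel_right, ← hwv] at h4
  exact h4.trans (hwu.map (continuous_padGL n (3 * n) h3n))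

end Vanishing

end KTheory
end

noncomputable section

/-! ### Operators on `ℓᵖ` spaces given by matrices with few nonzero entries -/

namespace LpRoe

section Flatten

variable {I J E : Type*} [NormedAddCommGroup E] [NormedSpace ℂ E] {p : ℝ≥0∞} [Fact (1 ≤ p)]

theorem toReal_pos_of_ne_top (hp : p ≠ ⊤) : 0 < p.toReal :=
  ENNReal.toReal_pos (one_pos.trans_le Fact.out).ne' hp

theorem one_le_toReal (hp : p ≠ ⊤) : 1 ≤ p.toReal := by
  have := ENNReal.toReal_mono hp (Fact.out : 1 ≤ p)
  simpa using this

omit [NormedSpace ℂ E] in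
theorem summable_flatten (hp : p ≠ ⊤) (f : lp (fun _ : I => lp (fun _ : J => E) p) p) :
    Summable fun q : I × J => ‖f q.1 q.2‖ ^ p.toReal := by
  have h := toReal_pos_of_ne_top hp
  refine (summable_prod_of_nonneg fun q => by positivity).2
    ⟨fun i => (lp.memℓp (f i)).summable h, ?_⟩
  refine ((lp.memℓp f).summable h).congr fun i => ?_
  exact lp.norm_rpow_eq_tsum h (f i)

/-- The identification `ℓᵖ(I, ℓᵖ(J, E)) = ℓᵖ(I × J, E)`. -/
def lpFlatten (hp : p ≠ ⊤) : lp (fun _ : I => lp (fun _ : J => E) p) p ≃ₗᵢ[ℂ]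
    lp (fun _ : I × J => E) p where
  toFun f := ⟨fun q => f q.1 q.2, memℓp_gen (summable_flatten hp f)⟩
  map_add' _ _ := rfl
  map_smul' _ _ := rfl
  invFun f :=
    have h := toReal_pos_of_ne_top hp
    have hs := (summable_prod_of_nonneg fun q => by positivity).1 ((lp.memℓp f).summable h)
    ⟨fun i => ⟨fun j => f (i, j), memℓp_gen (hs.1 i)⟩, memℓp_gen (hs.2.congr fun i =>
      (lp.norm_rpow_eq_tsum h (⟨fun j => f (i, j), memℓp_gen (hs.1 i)⟩ :
        lp (fun _ : J => E) p)).symm)⟩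
  left_inv _ := rfl
  right_inv _ := rfl
  norm_map' f := by
    have h := toReal_pos_of_ne_top hp
    have hs := summable_flatten hp f
    refine (Real.rpow_left_inj (norm_nonneg _) (norm_nonneg _) h.ne').1 ?_
    rw [lp.norm_rpow_eq_tsum h, lp.norm_rpow_eq_tsum h]
    refine (hs.tsum_prod).trans (tsum_congr fun i => ?_)
    exact (lp.norm_rpow_eq_tsum h (f i)).symm

end Flatten

section Kernel

variable {I J : Type*} {p : ℝ≥0∞} [Fact (1 ≤ p)]

/-- The matrix `κ` has entries bounded by `c`, and at most `M` nonzero entries in each row and each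
column. -/
structure IsSchur (κ : J → I → ℂ) (M : ℕ) (c : ℝ) : Prop where
  row : ∀ j, ∃ s : Finset I, s.card ≤ M ∧ ∀ i ∉ s, κ j i = 0
  col : ∀ i, ∃ s : Finset J, s.card ≤ M ∧ ∀ j ∉ s, κ j i = 0
  bound : ∀ j i, ‖κ j i‖ ≤ c

theorem IsSchur.transpose {κ : J → I → ℂ} {M : ℕ} {c : ℝ} (h : IsSchur κ M c) :
    IsSchur (fun i j => κ j i) M c :=
  ⟨h.col, h.row, fun i j => h.bound j i⟩

theorem IsSchur.sub {κ κ' : J → I → ℂ} {M M' : ℕ} {c c' ε : ℝ} (h : IsSchur κ M c)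
    (h' : IsSchur κ' M' c') (hε : ∀ j i, ‖κ j i - κ' j i‖ ≤ ε) :
    IsSchur (fun j i => κ j i - κ' j i) (M + M') ε := by
  classical
  refine ⟨fun j => ?_, fun i => ?_, hε⟩
  · obtain ⟨s, hs, h1⟩ := h.row j
    obtain ⟨s', hs', h1'⟩ := h'.row j
    refine ⟨s ∪ s', (Finset.card_union_le _ _).trans (add_le_add hs hs'), fun i hi => ?_⟩
    rw [Finset.notMem_union] at hi
    rw [h1 i hi.1, h1' i hi.2, sub_zero]
  · obtain ⟨s, hs, h1⟩ := h.col i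
    obtain ⟨s', hs', h1'⟩ := h'.col i
    refine ⟨s ∪ s', (Finset.card_union_le _ _).trans (add_le_add hs hs'), fun j hj => ?_⟩
    rw [Finset.notMem_union] at hj
    rw [h1 j hj.1, h1' j hj.2, sub_zero]

/-- Schur's estimate: by the power mean inequality each row contributes at most
`M ^ (p - 1) * c ^ p * ∑ ‖ξ i‖ ^ p` over its nonzero entries, and each `i` occurs in at most `M`
rows. -/
theorem IsSchur.sum_rpow_le {κ : J → I → ℂ} {M : ℕ} {c : ℝ} (h : IsSchur κ M c) (hc : 0 ≤ c)
    (hp : p ≠ ⊤) (ξ : lp (fun _ : I => ℂ) p) (T : Finset J) :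
    ∑ j ∈ T, ‖∑' i, κ j i * ξ i‖ ^ p.toReal ≤ (M * c * ‖ξ‖) ^ p.toReal := by
  classical
  have hr := toReal_pos_of_ne_top hp
  have hr1 := one_le_toReal hp
  set r := p.toReal
  have hrow : ∀ j, ∃ s : Finset I, s.card ≤ M ∧ ∀ i, i ∈ s ↔ κ j i ≠ 0 := fun j => by
    obtain ⟨s, hs, h1⟩ := h.row j
    refine ⟨s.filter fun i => κ j i ≠ 0, (Finset.card_filter_le _ _).trans hs, fun i => ?_⟩
    rw [Finset.mem_filter, and_iff_right_iff_imp]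
    intro hi
    by_contra h2
    exact hi (h1 i h2)
  choose s hs hmem using hrow
  have h1 : ∀ j, ‖∑' i, κ j i * ξ i‖ ^ r ≤ (M : ℝ) ^ (r - 1) * c ^ r * ∑ i ∈ s j, ‖ξ i‖ ^ r := by
    intro j
    rw [tsum_eq_sum (s := s j) fun i hi => by
      rw [not_not.1 (mt (hmem j i).2 hi), zero_mul]]
    calc ‖∑ i ∈ s j, κ j i * ξ i‖ ^ r ≤ (∑ i ∈ s j, |c * ‖ξ i‖|) ^ r := by
          refine Real.rpow_le_rpow (norm_nonneg _) ((norm_sum_le _ _).trans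
            (Finset.sum_le_sum fun i _ => ?_)) hr.le
          rw [norm_mul]
          refine le_trans ?_ (le_abs_self _)
          gcongr
          exact h.bound j i
      _ ≤ ((s j).card : ℝ) ^ (r - 1) * ∑ i ∈ s j, |c * ‖ξ i‖| ^ r :=
          Real.rpow_sum_le_const_mul_sum_rpow _ _ hr1
      _ ≤ (M : ℝ) ^ (r - 1) * ∑ i ∈ s j, |c * ‖ξ i‖| ^ r := by
          gcongr
          exact hs j
      _ = _ := by
          rw [mul_assoc, Finset.mul_sum _ _ (c ^ r)]
          congr 1
          refine Finset.sum_congr rfl fun i _ => ?_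
          rw [abs_of_nonneg (by positivity), Real.mul_rpow hc (norm_nonneg _)]
  have h2 : ∑ j ∈ T, ∑ i ∈ s j, ‖ξ i‖ ^ r ≤ M * ‖ξ‖ ^ r := by
    have e1 : ∀ j ∈ T, ∑ i ∈ s j, ‖ξ i‖ ^ r =
        ∑ i ∈ T.biUnion s, if i ∈ s j then ‖ξ i‖ ^ r else 0 := fun j hj => by
      rw [← Finset.sum_filter]
      refine Finset.sum_congr (Finset.ext fun i => ?_) fun _ _ => rfl
      rw [Finset.mem_filter]
      exact ⟨fun hi => ⟨Finset.mem_biUnion.2 ⟨j, hj, hi⟩, hi⟩, fun hi => hi.2⟩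
    rw [Finset.sum_congr rfl e1, Finset.sum_comm]
    calc _ ≤ ∑ i ∈ T.biUnion s, M * ‖ξ i‖ ^ r := by
          refine Finset.sum_le_sum fun i _ => ?_
          rw [← Finset.sum_filter, Finset.sum_const, nsmul_eq_mul]
          gcongr
          obtain ⟨u, hu, hu'⟩ := h.col i
          refine (Finset.card_le_card fun j hj => ?_).trans hu
          by_contra h3
          exact (hmem j i).1 (Finset.mem_filter.1 hj).2 (hu' j h3)
      _ ≤ _ := by
          rw [← Finset.mul_sum]
          gcongr
          exact lp.sum_rpow_le_norm_rpow hr ξ _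
  calc _ ≤ ∑ j ∈ T, (M : ℝ) ^ (r - 1) * c ^ r * ∑ i ∈ s j, ‖ξ i‖ ^ r :=
        Finset.sum_le_sum fun j _ => h1 j
    _ ≤ (M : ℝ) ^ (r - 1) * c ^ r * (M * ‖ξ‖ ^ r) := by
        rw [← Finset.mul_sum]
        gcongr
    _ = _ := by
        rw [Real.mul_rpow (by positivity) (norm_nonneg _), Real.mul_rpow (by positivity) hc]
        have : (M : ℝ) ^ r = (M : ℝ) ^ (r - 1) * M := by
          rcases Nat.eq_zero_or_pos M with rfl | hM
          · simp [hr.ne']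
          · rw [← Real.rpow_add_one (by positivity)]
            congr 1
            ring
        rw [this]
        ring

theorem IsSchur.exists_operator {κ : J → I → ℂ} {M : ℕ} {c : ℝ} (h : IsSchur κ M c) (hc : 0 ≤ c)
    (hp : p ≠ ⊤) : ∃ T : lp (fun _ : I => ℂ) p →L[ℂ] lp (fun _ : J => ℂ) p, ‖T‖ ≤ M * c ∧
      ∀ ξ j, T ξ j = ∑' i, κ j i * ξ i := by
  have hr := toReal_pos_of_ne_top hp
  have hmem : ∀ ξ : lp (fun _ : I => ℂ) p, Memℓp (fun j => ∑' i, κ j i * ξ i) p := fun ξ =>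
    memℓp_gen' (h.sum_rpow_le hc hp ξ)
  have hsum : ∀ (ξ : lp (fun _ : I => ℂ) p) j, Summable fun i => κ j i * ξ i := fun ξ j => by
    obtain ⟨s, -, hs⟩ := h.row j
    exact summable_of_ne_finset_zero (s := s) fun i hi => by rw [hs i hi, zero_mul]
  let T : lp (fun _ : I => ℂ) p →ₗ[ℂ] lp (fun _ : J => ℂ) p :=
    { toFun := fun ξ => ⟨fun j => ∑' i, κ j i * ξ i, hmem ξ⟩
      map_add' := fun ξ η => lp.ext (funext fun j => by
        change ∑' i, κ j i * (ξ i + η i) = (∑' i, κ j i * ξ i) + ∑' i, κ j i * η i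
        rw [← (hsum ξ j).tsum_add (hsum η j)]
        simp only [mul_add])
      map_smul' := fun a ξ => lp.ext (funext fun j => by
        change ∑' i, κ j i * (a * ξ i) = a * ∑' i, κ j i * ξ i
        rw [← tsum_mul_left]
        exact tsum_congr fun i => by ring) }
  refine ⟨T.mkContinuous (M * c) fun ξ => ?_, T.mkContinuous_norm_le (by positivity) _,
    fun _ _ => rfl⟩
  exact lp.norm_le_of_forall_sum_le hr (by positivity) (h.sum_rpow_le hc hp ξ)

open scoped Classical in
/-- The operator `(T ξ)(j) = ∑ᵢ κ j i ξ(i)` with matrix `κ`; it is `0` if there is no such bounded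
operator. -/
def kernelOp (p : ℝ≥0∞) [Fact (1 ≤ p)] (κ : J → I → ℂ) :
    lp (fun _ : I => ℂ) p →L[ℂ] lp (fun _ : J => ℂ) p :=
  if h : ∃ T : lp (fun _ : I => ℂ) p →L[ℂ] lp (fun _ : J => ℂ) p,
    ∀ ξ j, T ξ j = ∑' i, κ j i * ξ i then h.choose else 0

theorem IsSchur.kernelOp_apply {κ : J → I → ℂ} {M : ℕ} {c : ℝ} (h : IsSchur κ M c)
    (hp : p ≠ ⊤) (ξ : lp (fun _ : I => ℂ) p) (j : J) :
    kernelOp p κ ξ j = ∑' i, κ j i * ξ i := by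
  have h0 : IsSchur κ M (max c 0) := ⟨h.row, h.col, fun j i => (h.bound j i).trans (le_max_left _ _)⟩
  obtain ⟨T, -, hT⟩ := h0.exists_operator (le_max_right _ _) hp
  have hex : ∃ T : lp (fun _ : I => ℂ) p →L[ℂ] lp (fun _ : J => ℂ) p,
    ∀ ξ j, T ξ j = ∑' i, κ j i * ξ i := ⟨T, hT⟩
  rw [kernelOp, dif_pos hex]
  exact hex.choose_spec ξ j

theorem IsSchur.norm_kernelOp_le {κ : J → I → ℂ} {M : ℕ} {c : ℝ} (h : IsSchur κ M c) (hc : 0 ≤ c)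
    (hp : p ≠ ⊤) : ‖kernelOp p κ‖ ≤ M * c := by
  obtain ⟨T, hT, hT'⟩ := h.exists_operator hc hp
  have : kernelOp p κ = T := ContinuousLinearMap.ext fun ξ => lp.ext (funext fun j => by
    rw [h.kernelOp_apply hp, hT'])
  rwa [this]

theorem IsSchur.kernelOp_sub {κ κ' : J → I → ℂ} {M M' : ℕ} {c c' ε : ℝ} (h : IsSchur κ M c)
    (h' : IsSchur κ' M' c') (hε : ∀ j i, ‖κ j i - κ' j i‖ ≤ ε) (hp : p ≠ ⊤) :
    kernelOp p κ - kernelOp p κ' = kernelOp p fun j i => κ j i - κ' j i := by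
  refine ContinuousLinearMap.ext fun ξ => lp.ext (funext fun j => ?_)
  rw [(h.sub h' hε).kernelOp_apply hp]
  change kernelOp p κ ξ j - kernelOp p κ' ξ j = _
  rw [h.kernelOp_apply hp, h'.kernelOp_apply hp, ← Summable.tsum_sub]
  · exact tsum_congr fun i => (sub_mul _ _ _).symm
  · obtain ⟨s, -, hs⟩ := h.row j
    exact summable_of_ne_finset_zero (s := s) fun i hi => by rw [hs i hi, zero_mul]
  · obtain ⟨s, -, hs⟩ := h'.row j
    exact summable_of_ne_finset_zero (s := s) fun i hi => by rw [hs i hi, zero_mul]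

end Kernel

end LpRoe
end

noncomputable section

/-! ### Compressing an operator by weighted partial isometries -/

namespace LpRoe

section Entries

variable {Γ : Type*} [Group Γ] {l : ProperLength Γ} {s : ℝ} {X : Type*} {p : ℝ≥0∞} [Fact (1 ≤ p)]

open scoped Classical in
theorem entry_apply (T : RipsSpace l s X p →L[ℂ] RipsSpace l s X p) (y z : RatRips l s)
    (ξ : FibreSpace Γ X p) : entry T y z ξ = T (lp.single p z ξ) y := by
  simp only [entry]
  congr!

omit [Group Γ] in
open scoped Classical in
theorem atPoint_apply (S : FibreSpace Γ X p →L[ℂ] FibreSpace Γ X p) (x : X)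
    (v : CoeffSpace Γ p) : atPoint S x v = S (lp.single p x v) x := by
  simp only [atPoint]
  congr!

omit [Group Γ] in
theorem atPoint_zero (x : X) :
    atPoint (0 : FibreSpace Γ X p →L[ℂ] FibreSpace Γ X p) x = 0 := by
  simp [atPoint]

theorem hasSum_entry_mul (hp : p ≠ ⊤) (T S : RipsSpace l s X p →L[ℂ] RipsSpace l s X p)
    (y z : RatRips l s) (ξ : FibreSpace Γ X p) :
    HasSum (fun w => entry T y w (entry S w z ξ)) (entry (T * S) y z ξ) := by
  classical
  have h := (lp.hasSum_single hp (S (lp.single p z ξ))).map T T.continuous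
  have h' := h.map (lp.evalCLM ℂ (fun _ : RatRips l s => FibreSpace Γ X p) p y)
    (ContinuousLinearMap.continuous _)
  rw [entry_apply]
  convert h' using 2 with w
  · rw [entry_apply, entry_apply]
    rfl
  · rfl

/-- The entries of a product, when only finitely many products of entries are nonzero. -/
theorem entry_mul_of_finite (hp : p ≠ ⊤) (T S : RipsSpace l s X p →L[ℂ] RipsSpace l s X p)
    (y z : RatRips l s) (F : Finset (RatRips l s))
    (hF : ∀ w, entry T y w ≠ 0 → entry S w z ≠ 0 → w ∈ F) :
    entry (T * S) y z = ∑ w ∈ F, entry T y w * entry S w z := by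
  refine ContinuousLinearMap.ext fun ξ => (hasSum_entry_mul hp T S y z ξ).unique ?_
  rw [sum_apply]
  refine hasSum_sum_of_ne_finset_zero fun w hw => ?_
  by_cases h1 : entry T y w = 0
  · rw [h1]; rfl
  · have h2 : entry S w z = 0 := not_not.1 fun h2 => hw (hF w h1 h2)
    rw [h2]
    exact map_zero _

omit [Group Γ] in
theorem exists_atPoint_ne [TopologicalSpace X] {S : FibreSpace Γ X p →L[ℂ] FibreSpace Γ X p}
    (hS : S ∈ coeffAlgebra Γ X p) (h : S ≠ 0) : ∃ x, atPoint S x ≠ 0 := by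
  classical
  obtain ⟨k, -, hk⟩ := hS
  by_contra! h0
  refine h (ContinuousLinearMap.ext fun ξ => lp.ext (funext fun x => ?_))
  have := congrArg (fun A => A (ξ x)) (h0 x)
  simp only [atPoint_apply, hk, lp.single_apply_self] at this
  rw [hk, this]
  rfl

/-- An operator of `ℂ[Γ ↷ X; s]` has only finitely many nonzero entries in the rows `z` whose
simplex meets a given finite set of vertices. -/
theorem finite_entries [TopologicalSpace X] [MulAction Γ X]
    {b : RipsSpace l s X p →L[ℂ] RipsSpace l s X p} (hb : b ∈ algebraicRoe l s X p)
    (B : Finset Γ) : {q : RatRips l s × RatRips l s | (∃ g ∈ q.1.point.supp, g ∈ B) ∧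
      entry b q.1 q.2 ≠ 0}.Finite := by
  classical
  obtain ⟨r, hr⟩ := ENat.ne_top_iff_exists.1 hb.2.2.ne
  have h1 : (⋃ h ∈ B, {g | (l (g * h⁻¹) : ℝ) ≤ s}).Finite := B.finite_toSet.biUnion fun h _ =>
    (l.finite_ball_real s).preimage (mul_left_injective h⁻¹).injOn
  have h2 : (⋃ h ∈ B, {g | l (g * h⁻¹) ≤ r}).Finite := B.finite_toSet.biUnion fun h _ =>
    (l.finite_ball r).preimage (mul_left_injective h⁻¹).injOn
  refine (hb.2.1.finite _ (Rips.isCompact_of_finset (l := l) (s := s)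
    (h1.toFinset ∪ h2.toFinset))).subset ?_
  rintro ⟨z, w⟩ ⟨⟨g, hg, hgB⟩, hne⟩
  refine ⟨fun k hk => ?_, fun k hk => ?_, hne⟩
  · exact Finset.mem_union_left _ ((Set.Finite.mem_toFinset h1).2
      (Set.mem_iUnion₂.2 ⟨g, hgB, z.point.length_le k hk g hg⟩))
  · refine Finset.mem_union_right _ ((Set.Finite.mem_toFinset h2).2
      (Set.mem_iUnion₂.2 ⟨g, hgB, ?_⟩))
    have h3 := groupPropagation_le_iff.1 hr.ge z w hne g hg k hk
    have h4 : l (k * g⁻¹) = l (g * k⁻¹) := by rw [← l.inv_eq]; simp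
    change l (k * g⁻¹) ≤ r
    rw [h4]
    exact_mod_cast h3

end Entries

section Dilation

variable {Γ : Type*} [Group Γ] {l : ProperLength Γ} {s : ℝ} {X : Type*} [TopologicalSpace X]
  [MulAction Γ X] {p : ℝ≥0∞} [Fact (1 ≤ p)]

/-- Every entry `S_{u,z}` of `S` is multiplication by the function `β u z` of `x ∈ X`, times an operator on
`ℓᵖ ⊗ ℓᵖ(Γ)` that does not depend on `x`. -/
def HasWeights (S : RipsSpace l s X p →L[ℂ] RipsSpace l s X p)
    (β : RatRips l s → RatRips l s → X → ℝ) : Prop :=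
  ∀ u z, ∃ W : CoeffSpace Γ p →L[ℂ] CoeffSpace Γ p, ∀ ξ x,
    entry S u z ξ x = (β u z x : ℂ) • W (ξ x)

/-- `L` and `M` are `Γ`-invariant operators with entries weighted by `β` and by its transpose; the
weights are continuous, move points by a bounded distance, and are column finite. -/
structure IsWeighted (β : RatRips l s → RatRips l s → X → ℝ)
    (L M : RipsSpace l s X p →L[ℂ] RipsSpace l s X p) : Prop where
  left : HasWeights L β
  right : HasWeights M fun z u => β u z
  continuous : ∀ u z, Continuous (β u z)
  column : ∀ z, {u | ∃ x, β u z x ≠ 0}.Finite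
  bounded : ∃ r : ℕ, ∀ u z x, β u z x ≠ 0 → ∀ g ∈ u.point.supp, ∀ h ∈ z.point.supp,
    l (g * h⁻¹) ≤ r
  left_comm : ∀ g, ripsAction l s X p g * L = L * ripsAction l s X p g
  right_comm : ∀ g, ripsAction l s X p g * M = M * ripsAction l s X p g

omit [TopologicalSpace X] [MulAction Γ X] in
theorem HasWeights.exists_ne {S : RipsSpace l s X p →L[ℂ] RipsSpace l s X p}
    {β : RatRips l s → RatRips l s → X → ℝ} (h : HasWeights S β) {u z : RatRips l s}
    (h0 : entry S u z ≠ 0) : ∃ x, β u z x ≠ 0 := by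
  by_contra! h1
  obtain ⟨W, hW⟩ := h u z
  refine h0 (ContinuousLinearMap.ext fun ξ => lp.ext (funext fun x => ?_))
  rw [hW, h1, Complex.ofReal_zero, zero_smul]
  rfl

variable {β β' : RatRips l s → RatRips l s → X → ℝ}
  {L M L' M' b : RipsSpace l s X p →L[ℂ] RipsSpace l s X p}

theorem IsWeighted.finite_entries (h : IsWeighted β L M) (hb : b ∈ algebraicRoe l s X p)
    (B : Finset Γ) : {q : RatRips l s × RatRips l s | (∃ u, u.point.supp ⊆ B ∧ entry L u q.1 ≠ 0) ∧
      entry b q.1 q.2 ≠ 0}.Finite := by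
  classical
  obtain ⟨r, hr⟩ := h.bounded
  have hB : (⋃ h ∈ B, {g | l (g * h⁻¹) ≤ r}).Finite := B.finite_toSet.biUnion fun h _ =>
    (l.finite_ball r).preimage (mul_left_injective h⁻¹).injOn
  refine (LpRoe.finite_entries hb hB.toFinset).subset ?_
  rintro ⟨z, w⟩ ⟨⟨u, hu, hne⟩, h0⟩
  obtain ⟨g, hg⟩ := z.point.supp_nonempty
  obtain ⟨k, hk⟩ := u.point.supp_nonempty
  obtain ⟨x, hx⟩ := h.left.exists_ne hne
  have h4 : l (g * k⁻¹) = l (k * g⁻¹) := by rw [← l.inv_eq]; simp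
  refine ⟨⟨g, hg, (Set.Finite.mem_toFinset hB).2 (Set.mem_iUnion₂.2 ⟨k, hu hk, ?_⟩)⟩, h0⟩
  change l (g * k⁻¹) ≤ r
  rw [h4]
  exact hr u z x hx k hk g hg

/-- The entries of the compression `L b M'` are finite sums, although neither the rows of `L` nor
those of `M'` are assumed finite: an entry of `b` that contributes lies in one of finitely many
rows, because the weights move points by a bounded distance. -/
theorem IsWeighted.entry_eq_sum (hp : p ≠ ⊤) (h : IsWeighted β L M)
    (hb : b ∈ algebraicRoe l s X p) (u u' : RatRips l s) :
    ∃ F F' : Finset (RatRips l s), entry (L * b * M') u u' =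
      ∑ w ∈ F', (∑ z ∈ F, entry L u z * entry b z w) * entry M' w u' := by
  classical
  have hfin := h.finite_entries hb u.point.supp
  refine ⟨hfin.toFinset.image Prod.fst, hfin.toFinset.image Prod.snd, ?_⟩
  have hrow : ∀ w, entry (L * b) u w = ∑ z ∈ hfin.toFinset.image Prod.fst,
      entry L u z * entry b z w := fun w => by
    refine entry_mul_of_finite hp L b u w _ fun z h1 h2 => ?_
    exact Finset.mem_image.2 ⟨(z, w), (Set.Finite.mem_toFinset hfin).2
      ⟨⟨u, subset_rfl, h1⟩, h2⟩, rfl⟩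
  rw [entry_mul_of_finite hp (L * b) M' u u' (hfin.toFinset.image Prod.snd) fun w h1 _ => ?_]
  · exact Finset.sum_congr rfl fun w _ => by rw [hrow]
  · obtain ⟨z, h2, h3⟩ := exists_entry_ne (algebraicRoe_column hb w) h1
    exact Finset.mem_image.2 ⟨(z, w), (Set.Finite.mem_toFinset hfin).2
      ⟨⟨u, subset_rfl, h2⟩, h3⟩, rfl⟩

omit [Group Γ] [MulAction Γ X] in
theorem mem_coeffAlgebra_of_weights {S S' A : FibreSpace Γ X p →L[ℂ] FibreSpace Γ X p}
    {c c' : X → ℝ} (hc : Continuous c) (hc' : Continuous c')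
    {W W' : CoeffSpace Γ p →L[ℂ] CoeffSpace Γ p} (hS : ∀ ξ x, S ξ x = (c x : ℂ) • W (ξ x))
    (hS' : ∀ ξ x, S' ξ x = (c' x : ℂ) • W' (ξ x)) (hA : A ∈ coeffAlgebra Γ X p) :
    S * A * S' ∈ coeffAlgebra Γ X p := by
  obtain ⟨k, hk, hA⟩ := hA
  refine ⟨⟨fun x => ((c x : ℂ) * (c' x : ℂ)) • (W * k x * W'), by fun_prop⟩, fun x => ?_,
    fun ξ x => ?_⟩
  · exact (((hk x).clm_comp W).comp_clm W').smul ((c x : ℂ) * (c' x : ℂ))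
  · change S (A (S' ξ)) x = ((c x : ℂ) * (c' x : ℂ)) • W (k x (W' (ξ x)))
    rw [hS, hA, hS', map_smul, map_smul, smul_smul]

theorem IsWeighted.entry_mem (hp : p ≠ ⊤) (h : IsWeighted β L M) (h' : IsWeighted β' L' M')
    (hb : b ∈ algebraicRoe l s X p) (u u' : RatRips l s) :
    entry (L * b * M') u u' ∈ coeffAlgebra Γ X p := by
  obtain ⟨F, F', hF⟩ := h.entry_eq_sum (M' := M') hp hb u u'
  rw [hF]
  refine sum_mem fun w _ => ?_
  rw [Finset.sum_mul]
  refine sum_mem fun z _ => ?_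
  obtain ⟨W, hW⟩ := h.left u z
  obtain ⟨W', hW'⟩ := h'.right w u'
  exact mem_coeffAlgebra_of_weights (h.continuous u z) (h'.continuous u' w) hW hW'
    (hb.2.1.entry_mem z w)

/-- Where the compression `L b M'` lives: over `x`, its entry at `(u, u')` involves only entries
`b_{z,w}(x)` for which the weights `β u z x` and `β' u' w x` are nonzero. -/
theorem IsWeighted.exists_of_atPoint_ne (hp : p ≠ ⊤) (h : IsWeighted β L M)
    (h' : IsWeighted β' L' M') (hb : b ∈ algebraicRoe l s X p) {u u' : RatRips l s} {x : X}
    (hx : atPoint (entry (L * b * M') u u') x ≠ 0) :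
    ∃ z w, β u z x ≠ 0 ∧ β' u' w x ≠ 0 ∧ atPoint (entry b z w) x ≠ 0 := by
  classical
  obtain ⟨F, F', hF⟩ := h.entry_eq_sum (M' := M') hp hb u u'
  by_contra! h0
  refine hx (ContinuousLinearMap.ext fun v => ?_)
  rw [atPoint_apply, hF, sum_apply, lp.coeFn_sum, Finset.sum_apply]
  refine Finset.sum_eq_zero fun w _ => ?_
  rw [Finset.sum_mul, sum_apply, lp.coeFn_sum, Finset.sum_apply]
  refine Finset.sum_eq_zero fun z _ => ?_
  obtain ⟨W, hW⟩ := h.left u z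
  obtain ⟨W', hW'⟩ := h'.right w u'
  obtain ⟨k, -, hk⟩ := hb.2.1.entry_mem z w
  change entry L u z (entry b z w (entry M' w u' (lp.single p x v))) x = 0
  rw [hW, hk, hW', lp.single_apply_self]
  by_cases h1 : β u z x = 0
  · rw [h1, Complex.ofReal_zero, zero_smul]
  by_cases h2 : β' u' w x = 0
  · beta_reduce
    rw [h2, Complex.ofReal_zero, zero_smul, map_zero, map_zero, smul_zero]
  have h3 := congrArg (fun A => A (W' v)) (h0 z w h1 h2)
  simp only [atPoint_apply, hk, lp.single_apply_self] at h3
  rw [map_smul, h3]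
  simp

theorem IsWeighted.mem_algebraicRoe (hp : p ≠ ⊤) (h : IsWeighted β L M)
    (h' : IsWeighted β' L' M') (hb : b ∈ algebraicRoe l s X p) :
    L * b * M' ∈ algebraicRoe l s X p := by
  classical
  have hne : ∀ u u', entry (L * b * M') u u' ≠ 0 → ∃ z w x, β u z x ≠ 0 ∧ β' u' w x ≠ 0 ∧
      entry b z w ≠ 0 := fun u u' hu => by
    obtain ⟨x, hx⟩ := exists_atPoint_ne (h.entry_mem hp h' hb u u') hu
    obtain ⟨z, w, h1, h2, h3⟩ := h.exists_of_atPoint_ne hp h' hb hx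
    exact ⟨z, w, x, h1, h2, fun h4 => h3 (by rw [h4, atPoint_zero])⟩
  obtain ⟨r, hr⟩ := h.bounded
  obtain ⟨r', hr'⟩ := h'.bounded
  refine ⟨fun g => ?_, ⟨h.entry_mem hp h' hb, fun F hF => ?_⟩, ?_⟩
  · have h1 : ripsAction l s X p g * ripsAction l s X p g⁻¹ = 1 := by
      simpa using ripsAction_inv_mul l s X p g⁻¹
    have h2 : ripsAction l s X p g * b = b * ripsAction l s X p g := by
      conv_rhs => rw [← hb.1 g]
      rw [mul_assoc _ _ (ripsAction l s X p g), ripsAction_inv_mul, mul_one]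
    calc ripsAction l s X p g * (L * b * M') * ripsAction l s X p g⁻¹
        = (ripsAction l s X p g * L) * b * M' * ripsAction l s X p g⁻¹ := by
          simp only [mul_assoc]
      _ = L * (ripsAction l s X p g * b) * M' * ripsAction l s X p g⁻¹ := by
          rw [h.left_comm]; simp only [mul_assoc]
      _ = L * b * (ripsAction l s X p g * M') * ripsAction l s X p g⁻¹ := by
          rw [h2]; simp only [mul_assoc]
      _ = L * b * M' * (ripsAction l s X p g * ripsAction l s X p g⁻¹) := by
          rw [h'.right_comm]; simp only [mul_assoc]
      _ = _ := by rw [h1, mul_one]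
  · obtain ⟨B, hB⟩ := Rips.exists_finset_of_isCompact hF
    have hB' : (⋃ h ∈ B, {g | l (g * h⁻¹) ≤ r}).Finite := B.finite_toSet.biUnion fun h _ =>
      (l.finite_ball r).preimage (mul_left_injective h⁻¹).injOn
    have hfin := LpRoe.finite_entries hb hB'.toFinset
    refine Set.Finite.subset (hfin.toFinset.finite_toSet.biUnion fun q _ =>
      (h.column q.1).prod (h'.column q.2)) ?_
    rintro ⟨u, u'⟩ ⟨hu, -, h0⟩
    obtain ⟨z, w, x, h1, h2, h3⟩ := hne u u' h0
    obtain ⟨g, hg⟩ := z.point.supp_nonempty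
    obtain ⟨k, hk⟩ := u.point.supp_nonempty
    refine Set.mem_iUnion₂.2 ⟨(z, w), (Set.Finite.mem_toFinset hfin).2 ⟨⟨g, hg, ?_⟩, h3⟩,
      ⟨x, h1⟩, ⟨x, h2⟩⟩
    refine (Set.Finite.mem_toFinset hB').2 (Set.mem_iUnion₂.2 ⟨k, hB _ hu hk, ?_⟩)
    have h4 : l (g * k⁻¹) = l (k * g⁻¹) := by rw [← l.inv_eq]; simp
    change l (g * k⁻¹) ≤ r
    rw [h4]
    exact hr u z x h1 k hk g hg
  · obtain ⟨q, hq⟩ := ENat.ne_top_iff_exists.1 hb.2.2.ne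
    refine lt_of_le_of_lt (b := ((r + q + r' : ℕ) : ℕ∞)) ?_ (ENat.natCast_lt_top _)
    refine groupPropagation_le_iff.2 fun u u' h0 g hg g' hg' => ?_
    obtain ⟨z, w, x, h1, h2, h3⟩ := hne u u' h0
    obtain ⟨k, hk⟩ := z.point.supp_nonempty
    obtain ⟨k', hk'⟩ := w.point.supp_nonempty
    have e1 := hr u z x h1 g hg k hk
    have e2 := hr' u' w x h2 g' hg' k' hk'
    have e3 : (l (k * k'⁻¹) : ℕ∞) ≤ q := groupPropagation_le_iff.1 hq.ge z w h3 k hk k' hk'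
    have e4 : l (k * k'⁻¹) ≤ q := by exact_mod_cast e3
    have e5 : l (k' * g'⁻¹) = l (g' * k'⁻¹) := by rw [← l.inv_eq]; simp
    have e6 := l.mul_le (g * k⁻¹ * (k * k'⁻¹)) (k' * g'⁻¹)
    have e7 := l.mul_le (g * k⁻¹) (k * k'⁻¹)
    have e8 : g * k⁻¹ * (k * k'⁻¹) * (k' * g'⁻¹) = g * g'⁻¹ := by group
    rw [e8] at e6
    exact_mod_cast (by lia : l (g * g'⁻¹) ≤ r + q + r')

end Dilation

end LpRoe
end

noncomputable section

/-! ### The isometry of `ℓᵖ(ℕ, E_s)` into `E_s` defined by a frame -/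

namespace LpRoe

variable {Γ : Type*} [Group Γ] {l : ProperLength Γ} {s : ℝ} {X : Type*}

/-- Weights `β k u z x` that spread the point `z ∈ Z_s`, over `x ∈ X` and in the `k`-th copy of `E_s`,
over at most `M` points `u`, with sum of squares one. They are continuous in `x`, column finite,
invariant under `Γ`, and move points by a distance bounded for each `k`. -/
structure IsFrame [TopologicalSpace X] [MulAction Γ X]
    (β : ℕ → RatRips l s → RatRips l s → X → ℝ) (M : ℕ) : Prop where
  abs_le_one : ∀ k u z x, |β k u z x| ≤ 1
  card_le : ∀ k z x, ∃ F : Finset (RatRips l s), F.card ≤ M ∧ ∀ u ∉ F, β k u z x = 0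
  hasSum_sq : ∀ k z x, HasSum (fun u => β k u z x ^ 2) 1
  continuous : ∀ k u z, Continuous (β k u z)
  column : ∀ k z, {u | ∃ x, β k u z x ≠ 0}.Finite
  bounded : ∀ k, ∃ r : ℕ, ∀ u z x, β k u z x ≠ 0 → ∀ g ∈ u.point.supp, ∀ h ∈ z.point.supp,
    l (g * h⁻¹) ≤ r
  equivariant : ∀ k g u z x,
    β k (RatRips.translate g u) (RatRips.translate g z) (g⁻¹ • x) = β k u z x

theorem RatRips.translate_symm (g : Γ) :
    (RatRips.translate g : RatRips l s ≃ RatRips l s).symm = RatRips.translate g⁻¹ :=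
  Equiv.ext fun _ => rfl

theorem RatRips.translate_translate (g h : Γ) (z : RatRips l s) :
    RatRips.translate g (RatRips.translate h z) = RatRips.translate (h * g) z := by
  refine RatRips.ext (Rips.ext (Finsupp.ext fun k => ?_))
  simp [RatRips.translate, Rips.translate_apply, mul_assoc]

section Kernels

open scoped Classical in
/-- The matrix of the isometry of `ℓᵖ ⊗ ℓᵖ(Γ)` that sends `δ_n ⊗ δ_h` to `δ_m ⊗ δ_h`, where `m` is the
code of `(k, z h, n)`. -/
def labelKernel (e : ℕ × RatRips l s × ℕ ≃ ℕ) (k : ℕ) (z : RatRips l s) (a b : ℕ × Γ) : ℂ :=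
  if a.2 = b.2 ∧ e (k, RatRips.translate b.2 z, b.1) = a.1 then 1 else 0

open scoped Classical in
/-- The matrix sending `δ_k ⊗ δ_z ⊗ δ_x ⊗ δ_n ⊗ δ_h` to `∑_u β k u z x δ_u ⊗ δ_x ⊗ δ_m ⊗ δ_h`, where
`m` is the code of `(k, z h, n)`. -/
def frameKernel (e : ℕ × RatRips l s × ℕ ≃ ℕ) (β : ℕ → RatRips l s → RatRips l s → X → ℝ)
    (j : (RatRips l s × X) × (ℕ × Γ)) (i : ((ℕ × RatRips l s) × X) × (ℕ × Γ)) : ℂ :=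
  if i.1.2 = j.1.2 then β i.1.1.1 j.1.1 i.1.1.2 i.1.2 * labelKernel e i.1.1.1 i.1.1.2 j.2 i.2 else 0

theorem labelKernel_isSchur (e : ℕ × RatRips l s × ℕ ≃ ℕ) (k : ℕ) (z : RatRips l s) :
    IsSchur (labelKernel e k z) 1 1 := by
  classical
  refine ⟨fun a => ⟨{((e.symm a.1).2.2, a.2)}, by simp, fun b hb => ?_⟩,
    fun b => ⟨{(e (k, RatRips.translate b.2 z, b.1), b.2)}, by simp, fun a ha => ?_⟩,
    fun a b => ?_⟩
  · refine if_neg fun h => hb (Finset.mem_singleton.2 ?_)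
    rw [← h.2, Equiv.symm_apply_apply, h.1]
  · refine if_neg fun h => ha (Finset.mem_singleton.2 ?_)
    rw [h.2, ← h.1]
  · rw [labelKernel]
    split_ifs <;> simp

variable [TopologicalSpace X] [MulAction Γ X] {β β' : ℕ → RatRips l s → RatRips l s → X → ℝ} {M : ℕ}

omit [TopologicalSpace X] [MulAction Γ X] in
/-- Each row of `frameKernel` has at most one nonzero entry, since `e` is injective. -/
theorem frameKernel_eq_zero (e : ℕ × RatRips l s × ℕ ≃ ℕ)
    (β : ℕ → RatRips l s → RatRips l s → X → ℝ) (j : (RatRips l s × X) × (ℕ × Γ))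
    {i : ((ℕ × RatRips l s) × X) × (ℕ × Γ)}
    (hi : i ≠ ((((e.symm j.2.1).1, RatRips.translate j.2.2⁻¹ (e.symm j.2.1).2.1), j.1.2),
      ((e.symm j.2.1).2.2, j.2.2))) : frameKernel e β j i = 0 := by
  by_contra h
  rw [frameKernel] at h
  split_ifs at h with h1
  · rw [labelKernel] at h
    split_ifs at h with h2
    · refine hi ?_
      rw [← h2.2, Equiv.symm_apply_apply, h2.1, ← h1]
      simp only
      rw [← RatRips.translate_symm, Equiv.symm_apply_apply]
    · exact h (mul_zero _)
  · exact h rfl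

theorem frameKernel_isSchur (e : ℕ × RatRips l s × ℕ ≃ ℕ) (h : IsFrame β M) :
    IsSchur (frameKernel e β) (max M 1) 1 := by
  classical
  refine ⟨fun j => ⟨_, (Finset.card_singleton _).le.trans (le_max_right _ _), fun i hi =>
    frameKernel_eq_zero e β j fun h => hi (Finset.mem_singleton.2 h)⟩, fun i => ?_, fun j i => ?_⟩
  · obtain ⟨F, hF, h0⟩ := h.card_le i.1.1.1 i.1.1.2 i.1.2
    refine ⟨F.image fun u =>
      ((u, i.1.2), (e (i.1.1.1, RatRips.translate i.2.2 i.1.1.2, i.2.1), i.2.2)),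
      Finset.card_image_le.trans (hF.trans (le_max_left _ _)), fun j hj => ?_⟩
    by_contra hne
    rw [frameKernel] at hne
    split_ifs at hne with h1
    · rw [labelKernel] at hne
      split_ifs at hne with h2
      · refine hj (Finset.mem_image.2 ⟨j.1.1, ?_, ?_⟩)
        · by_contra h3
          exact hne (by rw [h0 _ h3]; simp)
        · rw [h1, h2.2, ← h2.1]
      · exact hne (mul_zero _)
    · exact hne rfl
  · rw [frameKernel, labelKernel]
    split_ifs
    · simpa using h.abs_le_one _ _ _ _
    · simp
    · simp

omit [TopologicalSpace X] [MulAction Γ X] in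
theorem norm_frameKernel_sub_le (e : ℕ × RatRips l s × ℕ ≃ ℕ) {ε : ℝ} (hε : 0 ≤ ε)
    (h : ∀ k u z x, |β k u z x - β' k u z x| ≤ ε) (j : (RatRips l s × X) × (ℕ × Γ))
    (i : ((ℕ × RatRips l s) × X) × (ℕ × Γ)) :
    ‖frameKernel e β j i - frameKernel e β' j i‖ ≤ ε := by
  rw [frameKernel, frameKernel, labelKernel]
  split_ifs
  · rw [mul_one, mul_one, ← Complex.ofReal_sub, Complex.norm_real]
    exact h _ _ _ _
  · simpa using hε
  · simpa using hε

end Kernels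

section Operators

variable {p : ℝ≥0∞} [Fact (1 ≤ p)]

variable (l s X p) in
/-- The space `ℓᵖ(ℕ, E_s)`. -/
abbrev AmpSpace : Type _ := lp (fun _ : ℕ => RipsSpace l s X p) p

/-- The identification of `E_s` with a scalar `ℓᵖ` space. -/
def flattenRips (hp : p ≠ ⊤) : RipsSpace l s X p ≃ₗᵢ[ℂ]
    lp (fun _ : (RatRips l s × X) × (ℕ × Γ) => ℂ) p :=
  (lpFlatten (I := RatRips l s) (J := X) (E := CoeffSpace Γ p) hp).trans
    (lpFlatten (I := RatRips l s × X) (J := ℕ × Γ) (E := ℂ) hp)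

/-- The identification of `ℓᵖ(ℕ, E_s)` with a scalar `ℓᵖ` space. -/
def flattenAmp (hp : p ≠ ⊤) : AmpSpace l s X p ≃ₗᵢ[ℂ]
    lp (fun _ : ((ℕ × RatRips l s) × X) × (ℕ × Γ) => ℂ) p :=
  ((lpFlatten (I := ℕ) (J := RatRips l s) (E := FibreSpace Γ X p) hp).trans
    (lpFlatten (I := ℕ × RatRips l s) (J := X) (E := CoeffSpace Γ p) hp)).trans
    (lpFlatten (I := (ℕ × RatRips l s) × X) (J := ℕ × Γ) (E := ℂ) hp)

/-- The operator `W T U`, for isometric isomorphisms `U` and `W`. -/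
def transport {E₁ E₂ E₃ E₄ : Type*} [NormedAddCommGroup E₁]
    [NormedSpace ℂ E₁] [NormedAddCommGroup E₂] [NormedSpace ℂ E₂] [NormedAddCommGroup E₃]
    [NormedSpace ℂ E₃] [NormedAddCommGroup E₄] [NormedSpace ℂ E₄] (U : E₁ ≃ₗᵢ[ℂ] E₂)
    (W : E₃ ≃ₗᵢ[ℂ] E₄) (T : E₂ →L[ℂ] E₃) : E₁ →L[ℂ] E₄ :=
  (W.toContinuousLinearEquiv : E₃ →L[ℂ] E₄).comp
    (T.comp (U.toContinuousLinearEquiv : E₁ →L[ℂ] E₂))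

section Transport

variable {E₁ E₂ E₃ E₄ : Type*} [NormedAddCommGroup E₁]
    [NormedSpace ℂ E₁] [NormedAddCommGroup E₂] [NormedSpace ℂ E₂] [NormedAddCommGroup E₃]
    [NormedSpace ℂ E₃] [NormedAddCommGroup E₄] [NormedSpace ℂ E₄] (U : E₁ ≃ₗᵢ[ℂ] E₂)
    (W : E₃ ≃ₗᵢ[ℂ] E₄)

theorem transport_sub (T T' : E₂ →L[ℂ] E₃) :
    transport U W T - transport U W T' = transport U W (T - T') := by
  simp only [transport, ContinuousLinearMap.comp_sub, ContinuousLinearMap.sub_comp]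

theorem norm_transport_le (T : E₂ →L[ℂ] E₃) : ‖transport U W T‖ ≤ ‖T‖ := by
  refine ContinuousLinearMap.opNorm_le_bound _ (norm_nonneg _) fun ξ => ?_
  change ‖W (T (U ξ))‖ ≤ _
  rw [W.norm_map]
  refine (T.le_opNorm _).trans_eq ?_
  rw [U.norm_map]

end Transport

/-- The operator `ℓᵖ(ℕ, E_s) → E_s` with matrix `frameKernel`. -/
def synthesis (hp : p ≠ ⊤) (e : ℕ × RatRips l s × ℕ ≃ ℕ)
    (β : ℕ → RatRips l s → RatRips l s → X → ℝ) : AmpSpace l s X p →L[ℂ] RipsSpace l s X p :=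
  transport (flattenAmp hp) (flattenRips (l := l) (s := s) (X := X) hp).symm
    (kernelOp p (frameKernel e β))

/-- The operator `E_s → ℓᵖ(ℕ, E_s)` with the transposed matrix. -/
def analysis (hp : p ≠ ⊤) (e : ℕ × RatRips l s × ℕ ≃ ℕ)
    (β : ℕ → RatRips l s → RatRips l s → X → ℝ) : RipsSpace l s X p →L[ℂ] AmpSpace l s X p :=
  transport (flattenRips hp) (flattenAmp (l := l) (s := s) (X := X) hp).symm
    (kernelOp p fun i j => frameKernel e β j i)

variable [TopologicalSpace X] [MulAction Γ X] {β β' : ℕ → RatRips l s → RatRips l s → X → ℝ} {M : ℕ}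

theorem synthesis_apply (hp : p ≠ ⊤) (e : ℕ × RatRips l s × ℕ ≃ ℕ) (h : IsFrame β M)
    (ξ : AmpSpace l s X p) (u : RatRips l s) (x : X) (m : ℕ) (g : Γ) :
    synthesis hp e β ξ u x (m, g) =
      β (e.symm m).1 u (RatRips.translate g⁻¹ (e.symm m).2.1) x *
        ξ (e.symm m).1 (RatRips.translate g⁻¹ (e.symm m).2.1) x ((e.symm m).2.2, g) := by
  have h1 : synthesis hp e β ξ u x (m, g) =
      kernelOp p (frameKernel e β) (flattenAmp hp ξ) ((u, x), (m, g)) := rfl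
  rw [h1, (frameKernel_isSchur e h).kernelOp_apply hp, tsum_eq_single
    (((((e.symm m).1, RatRips.translate g⁻¹ (e.symm m).2.1), x), ((e.symm m).2.2, g)) :
      ((ℕ × RatRips l s) × X) × (ℕ × Γ))
    fun i hi => by rw [frameKernel_eq_zero e β ((u, x), (m, g)) hi, zero_mul]]
  have h2 : e ((e.symm m).1, RatRips.translate g (RatRips.translate g⁻¹ (e.symm m).2.1),
      (e.symm m).2.2) = m := by
    rw [← RatRips.translate_symm, Equiv.apply_symm_apply]
    exact e.apply_symm_apply m
  rw [frameKernel, if_pos rfl, labelKernel, if_pos ⟨rfl, h2⟩, mul_one]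
  rfl

theorem analysis_apply (hp : p ≠ ⊤) (e : ℕ × RatRips l s × ℕ ≃ ℕ) (h : IsFrame β M)
    (ξ : RipsSpace l s X p) (k : ℕ) (z : RatRips l s) (x : X) (n : ℕ) (g : Γ)
    {F : Finset (RatRips l s)} (hF : ∀ u ∉ F, β k u z x = 0) :
    analysis hp e β ξ k z x (n, g) =
      ∑ u ∈ F, β k u z x * ξ u x (e (k, RatRips.translate g z, n), g) := by
  classical
  have h1 : analysis hp e β ξ k z x (n, g) =
      kernelOp p (fun i j => frameKernel e β j i) (flattenRips hp ξ) (((k, z), x), (n, g)) := rfl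
  have hinj : Set.InjOn (fun u : RatRips l s =>
      (((u, x), (e (k, RatRips.translate g z, n), g)) : (RatRips l s × X) × (ℕ × Γ))) F :=
    fun u _ u' _ huu' => congrArg (fun j => j.1.1) huu'
  rw [h1, (frameKernel_isSchur e h).transpose.kernelOp_apply hp, tsum_eq_sum
    (s := F.image fun u => ((u, x), (e (k, RatRips.translate g z, n), g))), Finset.sum_image hinj]
  · refine Finset.sum_congr rfl fun u _ => ?_
    rw [frameKernel, if_pos rfl, labelKernel, if_pos ⟨rfl, rfl⟩, mul_one]
    rfl
  · rintro ⟨⟨u, x'⟩, m, g'⟩ hj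
    rw [frameKernel]
    split_ifs with h2
    · have h2' : x = x' := h2
      subst h2'
      rw [labelKernel]
      split_ifs with h3
      · have h4 : u ∉ F := fun hu => hj (Finset.mem_image.2 ⟨u, hu, by
          obtain ⟨h5, h6⟩ := h3
          simp only at h5 h6
          rw [h6, h5]⟩)
        simp [hF u h4]
      · simp
    · simp

/-- Synthesis is injective with left inverse the analysis operator, because the squares of the
weights sum to one. -/
theorem analysis_comp_synthesis (hp : p ≠ ⊤) (e : ℕ × RatRips l s × ℕ ≃ ℕ) (h : IsFrame β M) :
    (analysis hp e β).comp (synthesis hp e β) = ContinuousLinearMap.id ℂ (AmpSpace l s X p) := by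
  refine ContinuousLinearMap.ext fun ξ => lp.ext (funext fun k => lp.ext (funext fun z =>
    lp.ext (funext fun x => lp.ext (funext fun a => ?_))))
  obtain ⟨n, g⟩ := a
  obtain ⟨F, -, hF⟩ := h.card_le k z x
  change analysis hp e β (synthesis hp e β ξ) k z x (n, g) = ξ k z x (n, g)
  rw [analysis_apply hp e h _ k z x n g hF]
  have h1 : ∀ u, synthesis hp e β ξ u x (e (k, RatRips.translate g z, n), g) =
      β k u z x * ξ k z x (n, g) := fun u => by
    rw [synthesis_apply hp e h, Equiv.symm_apply_apply]
    simp only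
    rw [← RatRips.translate_symm, Equiv.symm_apply_apply]
  have h2 : ∑ u ∈ F, β k u z x ^ 2 = 1 :=
    (hasSum_sum_of_ne_finset_zero fun u hu => by rw [hF u hu]; simp).unique (h.hasSum_sq k z x)
  calc _ = ((∑ u ∈ F, β k u z x ^ 2 : ℝ) : ℂ) * ξ k z x (n, g) := by
        rw [Complex.ofReal_sum, Finset.sum_mul]
        refine Finset.sum_congr rfl fun u _ => ?_
        rw [h1]
        push_cast
        ring
    _ = _ := by rw [h2, Complex.ofReal_one, one_mul]

theorem norm_synthesis_le (hp : p ≠ ⊤) (e : ℕ × RatRips l s × ℕ ≃ ℕ) (h : IsFrame β M) :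
    ‖synthesis (p := p) hp e β‖ ≤ (max M 1 : ℕ) := by
  refine (norm_transport_le _ _ _).trans ?_
  simpa using (frameKernel_isSchur e h).norm_kernelOp_le zero_le_one hp

theorem norm_analysis_le (hp : p ≠ ⊤) (e : ℕ × RatRips l s × ℕ ≃ ℕ) (h : IsFrame β M) :
    ‖analysis (p := p) hp e β‖ ≤ (max M 1 : ℕ) := by
  refine (norm_transport_le _ _ _).trans ?_
  simpa using (frameKernel_isSchur e h).transpose.norm_kernelOp_le zero_le_one hp

theorem norm_synthesis_sub_le (hp : p ≠ ⊤) (e : ℕ × RatRips l s × ℕ ≃ ℕ) (h : IsFrame β M)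
    (h' : IsFrame β' M) {ε : ℝ} (hε : 0 ≤ ε) (hβ : ∀ k u z x, |β k u z x - β' k u z x| ≤ ε) :
    ‖synthesis (p := p) hp e β - synthesis hp e β'‖ ≤ (max M 1 + max M 1 : ℕ) * ε := by
  have hs := frameKernel_isSchur e h
  have hs' := frameKernel_isSchur e h'
  have hd := norm_frameKernel_sub_le e hε hβ
  rw [synthesis, synthesis, transport_sub, hs.kernelOp_sub hs' hd hp]
  exact (norm_transport_le _ _ _).trans ((hs.sub hs' hd).norm_kernelOp_le hε hp)

theorem norm_analysis_sub_le (hp : p ≠ ⊤) (e : ℕ × RatRips l s × ℕ ≃ ℕ) (h : IsFrame β M)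
    (h' : IsFrame β' M) {ε : ℝ} (hε : 0 ≤ ε) (hβ : ∀ k u z x, |β k u z x - β' k u z x| ≤ ε) :
    ‖analysis (p := p) hp e β - analysis hp e β'‖ ≤ (max M 1 + max M 1 : ℕ) * ε := by
  have hs := (frameKernel_isSchur e h).transpose
  have hs' := (frameKernel_isSchur e h').transpose
  have hd := fun i j => norm_frameKernel_sub_le e hε hβ j i
  rw [analysis, analysis, transport_sub, hs.kernelOp_sub hs' hd hp]
  exact (norm_transport_le _ _ _).trans ((hs.sub hs' hd).norm_kernelOp_le hε hp)

/-- The restriction of the synthesis operator to the `k`-th summand, and the `k`-th component of the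
analysis operator, have entries weighted by `β k`. -/
theorem IsFrame.isWeighted (hp : p ≠ ⊤) (e : ℕ × RatRips l s × ℕ ≃ ℕ) (h : IsFrame β M) (k : ℕ) :
    IsWeighted (p := p) (β k)
      ((synthesis hp e β).comp (lp.singleContinuousLinearMap ℂ (fun _ => RipsSpace l s X p) p k))
      ((lp.evalCLM ℂ (fun _ => RipsSpace l s X p) p k).comp (analysis hp e β)) := by
  classical
  set L := (synthesis hp e β).comp
    (lp.singleContinuousLinearMap ℂ (fun _ => RipsSpace l s X p) p k) with hL
  have hLa : ∀ ξ u x m g, L ξ u x (m, g) = if (e.symm m).1 = k then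
      β k u (RatRips.translate g⁻¹ (e.symm m).2.1) x *
        ξ (RatRips.translate g⁻¹ (e.symm m).2.1) x ((e.symm m).2.2, g) else 0 := by
    intro ξ u x m g
    change synthesis hp e β (lp.single p k ξ) u x (m, g) = _
    rw [synthesis_apply hp e h]
    split_ifs with h1
    · rw [h1, lp.single_apply_self]
    · rw [lp.single_apply_ne _ _ _ h1]
      exact mul_zero _
  set A := (lp.evalCLM ℂ (fun _ => RipsSpace l s X p) p k).comp (analysis hp e β) with hA
  have hAa : ∀ (ξ : RipsSpace l s X p) z x n g (F : Finset (RatRips l s)),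
      (∀ u ∉ F, β k u z x = 0) → A ξ z x (n, g) =
      ∑ u ∈ F, β k u z x * ξ u x (e (k, RatRips.translate g z, n), g) :=
    fun ξ z x n g F hF => analysis_apply hp e h ξ k z x n g hF
  have hact : ∀ (g : Γ) (ξ : RipsSpace l s X p) z x n h',
      ripsAction l s X p g ξ z x (n, h') = ξ (RatRips.translate g z) (g⁻¹ • x) (n, g⁻¹ * h') :=
    fun _ _ _ _ _ _ => rfl
  refine ⟨fun u z => ⟨kernelOp p (labelKernel e k z), fun ξ x => lp.ext (funext fun a => ?_)⟩,
    fun z u => ⟨kernelOp p fun i j => labelKernel e k z j i, fun ξ x =>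
      lp.ext (funext fun a => ?_)⟩,
    h.continuous k, h.column k, h.bounded k, fun g => ?_, fun g => ?_⟩
  · obtain ⟨m, g⟩ := a
    change _ = (β k u z x : ℂ) * kernelOp p (labelKernel e k z) (ξ x) (m, g)
    rw [entry_apply, hLa, (labelKernel_isSchur e k z).kernelOp_apply hp,
      tsum_eq_single ((e.symm m).2.2, g)]
    · by_cases h1 : (e.symm m).1 = k ∧ RatRips.translate g⁻¹ (e.symm m).2.1 = z
      · rw [if_pos h1.1, h1.2, lp.single_apply_self, labelKernel, if_pos, one_mul]
        refine ⟨rfl, ?_⟩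
        rw [← h1.1, ← h1.2]
        simp only
        rw [← RatRips.translate_symm, Equiv.apply_symm_apply]
        exact e.apply_symm_apply m
      · have h2 : labelKernel e k z (m, g) ((e.symm m).2.2, g) = 0 := by
          refine if_neg fun h3 => h1 ?_
          have h4 : e.symm m = (k, RatRips.translate g z, (e.symm m).2.2) := by
            rw [Equiv.symm_apply_eq]
            exact h3.2.symm
          constructor
          · rw [h4]
          · rw [h4]
            simp only
            rw [← RatRips.translate_symm, Equiv.symm_apply_apply]
        rw [h2, zero_mul, mul_zero]
        split_ifs with h3
        · rw [lp.single_apply_ne _ _ _ fun h4 => h1 ⟨h3, h4⟩]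
          exact mul_zero _
        · rfl
    · rintro ⟨n, g'⟩ hne
      rw [labelKernel, if_neg, zero_mul]
      rintro ⟨h3, h4⟩
      refine hne ?_
      simp only at h3 h4
      rw [← h4, Equiv.symm_apply_apply, h3]
  · obtain ⟨n, g⟩ := a
    change _ = (β k u z x : ℂ) * kernelOp p (fun i j => labelKernel e k z j i) (ξ x) (n, g)
    obtain ⟨F, -, hF⟩ := h.card_le k z x
    rw [entry_apply, hAa _ z x n g (insert u F) fun v hv => hF v fun hv' =>
        hv (Finset.mem_insert_of_mem hv'), Finset.sum_eq_single u,
      (labelKernel_isSchur e k z).transpose.kernelOp_apply hp,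
      tsum_eq_single (e (k, RatRips.translate g z, n), g), labelKernel, if_pos ⟨rfl, rfl⟩, one_mul,
      lp.single_apply_self]
    · rintro ⟨m, g'⟩ hne
      rw [labelKernel, if_neg, zero_mul]
      rintro ⟨h3, h4⟩
      refine hne ?_
      simp only at h3 h4
      rw [← h4, h3]
    · intro v _ hv
      rw [lp.single_apply_ne _ _ _ hv]
      exact mul_zero _
    · exact fun hu => absurd (Finset.mem_insert_self _ _) hu
  · refine ContinuousLinearMap.ext fun ξ => lp.ext (funext fun u => lp.ext (funext fun x =>
      lp.ext (funext fun a => ?_)))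
    obtain ⟨m, g'⟩ := a
    change ripsAction l s X p g (L ξ) u x (m, g') = L (ripsAction l s X p g ξ) u x (m, g')
    rw [hact, hLa, hLa, hact]
    split_ifs with h1
    · have h2 : RatRips.translate (g⁻¹ * g')⁻¹ (e.symm m).2.1 =
          RatRips.translate g (RatRips.translate g'⁻¹ (e.symm m).2.1) := by
        rw [RatRips.translate_translate, mul_inv_rev, inv_inv]
      rw [h2, h.equivariant]
    · rfl
  · refine ContinuousLinearMap.ext fun ξ => lp.ext (funext fun z => lp.ext (funext fun x =>
      lp.ext (funext fun a => ?_)))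
    obtain ⟨n, g'⟩ := a
    change ripsAction l s X p g (A ξ) z x (n, g') = A (ripsAction l s X p g ξ) z x (n, g')
    obtain ⟨F, -, hF⟩ := h.card_le k z x
    rw [hact, hAa _ z x n g' F hF,
      hAa _ _ _ n _ (F.map (RatRips.translate g).toEmbedding), Finset.sum_map]
    · refine Finset.sum_congr rfl fun u _ => ?_
      rw [hact]
      have h2 : RatRips.translate (g⁻¹ * g') (RatRips.translate g z) = RatRips.translate g' z := by
        rw [RatRips.translate_translate, mul_inv_cancel_left]
      rw [h2]
      change (β k (RatRips.translate g u) (RatRips.translate g z) (g⁻¹ • x) : ℂ) * _ = _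
      rw [h.equivariant]
      rfl
    · intro u hu
      obtain ⟨v, rfl⟩ := (RatRips.translate g : RatRips l s ≃ RatRips l s).surjective u
      rw [h.equivariant]
      refine hF v fun hv => hu ?_
      exact Finset.mem_map_of_mem (RatRips.translate g).toEmbedding hv

theorem isWeighted_zero : IsWeighted (p := p) (fun _ _ _ => 0 : RatRips l s → RatRips l s → X → ℝ)
    0 0 where
  left u z := ⟨0, fun ξ x => by rw [entry_zero]; simp⟩
  right u z := ⟨0, fun ξ x => by rw [entry_zero]; simp⟩
  continuous _ _ := continuous_const
  column z := by simp
  bounded := ⟨0, fun u z x h => absurd rfl h⟩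
  left_comm g := by simp
  right_comm g := by simp

open scoped Classical in
theorem isWeighted_one : IsWeighted (p := p)
    (fun u z _ => if u = z then 1 else 0 : RatRips l s → RatRips l s → X → ℝ) 1 1 := by
  have h1 : ∀ u z : RatRips l s, ∃ W : CoeffSpace Γ p →L[ℂ] CoeffSpace Γ p,
      ∀ (ξ : FibreSpace Γ X p) (x : X), entry (1 : RipsSpace l s X p →L[ℂ] RipsSpace l s X p) u z ξ x =
        (((if u = z then 1 else 0 : ℝ)) : ℂ) • W (ξ x) := fun u z => by
    refine ⟨1, fun ξ x => ?_⟩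
    rw [entry_apply]
    change (lp.single p z ξ : RipsSpace l s X p) u x = _
    split_ifs with h
    · rw [h, lp.single_apply_self]
      simp
    · rw [lp.single_apply_ne _ _ _ h]
      simp
  refine ⟨h1, fun z u => ?_, fun _ _ => continuous_const, fun z => ?_, ⟨⌊s⌋₊, ?_⟩, fun g => ?_,
    fun g => ?_⟩
  · obtain ⟨W, hW⟩ := h1 z u
    exact ⟨W, fun ξ x => by rw [hW]; simp only [eq_comm]⟩
  · refine (Set.finite_singleton z).subset ?_
    rintro u ⟨x, hx⟩
    by_contra hne
    exact hx (if_neg hne)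
  · intro u z x hx g hg h hh
    have huz : u = z := by
      by_contra hne
      exact hx (if_neg hne)
    subst huz
    exact Nat.le_floor (u.point.length_le g hg h hh)
  · rw [mul_one, one_mul]
  · rw [mul_one, one_mul]

end Operators

end LpRoe
end

noncomputable section

/-! ### Uniformly continuous families of operators and time delays -/

namespace LpRoe

open KTheory

section Families

variable {E F G : Type*} [NormedAddCommGroup E] [NormedSpace ℂ E] [NormedAddCommGroup F]
  [NormedSpace ℂ F] [NormedAddCommGroup G] [NormedSpace ℂ G]

/-- A bounded, uniformly continuous family of operators. -/
structure IsUCFamily (V : ℝ≥0 → E →L[ℂ] F) : Prop where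
  bounded : ∃ C, ∀ t, ‖V t‖ ≤ C
  uniformContinuous : UniformContinuous V

theorem isUCFamily_const (T : E →L[ℂ] F) : IsUCFamily fun _ => T :=
  ⟨⟨‖T‖, fun _ => le_rfl⟩, uniformContinuous_const⟩

theorem IsUCFamily.comp {V : ℝ≥0 → F →L[ℂ] G} {W : ℝ≥0 → E →L[ℂ] F} (hV : IsUCFamily V)
    (hW : IsUCFamily W) : IsUCFamily fun t => (V t).comp (W t) := by
  obtain ⟨C, hC⟩ := hV.bounded
  obtain ⟨C', hC'⟩ := hW.bounded
  have h0 : 0 ≤ C := (norm_nonneg _).trans (hC 0)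
  have h0' : 0 ≤ C' := (norm_nonneg _).trans (hC' 0)
  refine ⟨⟨C * C', fun t => (ContinuousLinearMap.opNorm_comp_le _ _).trans
    (mul_le_mul (hC t) (hC' t) (norm_nonneg _) h0)⟩, Metric.uniformContinuous_iff.2 fun ε hε => ?_⟩
  obtain ⟨δ, hδ, h⟩ := Metric.uniformContinuous_iff.1 hV.uniformContinuous (ε / (C + C' + 1))
    (by positivity)
  obtain ⟨δ', hδ', h'⟩ := Metric.uniformContinuous_iff.1 hW.uniformContinuous (ε / (C + C' + 1))
    (by positivity)
  refine ⟨min δ δ', lt_min hδ hδ', fun {t u} htu => ?_⟩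
  have e1 := h (htu.trans_le (min_le_left _ _))
  have e2 := h' (htu.trans_le (min_le_right _ _))
  rw [dist_eq_norm] at e1 e2 ⊢
  have e3 : (V t).comp (W t) - (V u).comp (W u) =
      (V t).comp (W t - W u) + (V t - V u).comp (W u) := by
    simp only [ContinuousLinearMap.comp_sub, ContinuousLinearMap.sub_comp]
    abel
  rw [e3]
  calc _ ≤ C * (ε / (C + C' + 1)) + (ε / (C + C' + 1)) * C' := by
        refine (norm_add_le _ _).trans (add_le_add
          ((ContinuousLinearMap.opNorm_comp_le _ _).trans ?_)
          ((ContinuousLinearMap.opNorm_comp_le _ _).trans ?_))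
        · exact mul_le_mul (hC t) e2.le (norm_nonneg _) h0
        · exact mul_le_mul e1.le (hC' u) (norm_nonneg _) (by positivity)
    _ = ε * ((C + C') / (C + C' + 1)) := by ring
    _ < ε * 1 := by
        refine mul_lt_mul_of_pos_left ?_ hε
        rw [div_lt_one (by positivity)]
        linarith
    _ = ε := mul_one ε

theorem isClosed_uniformlyContinuousFun :
    IsClosed (uniformlyContinuousFun (E →L[ℂ] E) : Set (BddFun (E →L[ℂ] E))) := by
  refine isClosed_of_closure_subset fun a ha => ?_
  change UniformContinuous a
  refine Metric.uniformContinuous_iff.2 fun ε hε => ?_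
  obtain ⟨b, hb, hab⟩ := Metric.mem_closure_iff.1 ha (ε / 3) (by positivity)
  obtain ⟨δ, hδ, h⟩ := Metric.uniformContinuous_iff.1 (show UniformContinuous b from hb) (ε / 3)
    (by positivity)
  refine ⟨δ, hδ, fun {t u} htu => ?_⟩
  have h1 := (BoundedContinuousFunction.dist_coe_le_dist (f := a) (g := b) t).trans_lt hab
  have h2 := (BoundedContinuousFunction.dist_coe_le_dist (f := a) (g := b) u).trans_lt hab
  have h3 := h htu
  rw [dist_comm] at h2
  have := dist_triangle4 (a t) (b t) (b u) (a u)
  linarith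

/-- The time delay `t ↦ b(t - τ)`, with `b(t - τ) = b(0)` for `t ≤ τ`. -/
def delay (τ : ℝ≥0) (b : BddFun (E →L[ℂ] E)) : BddFun (E →L[ℂ] E) :=
  b.compContinuous ⟨fun t => t - τ, by fun_prop⟩

theorem delay_apply (τ : ℝ≥0) (b : BddFun (E →L[ℂ] E)) (t : ℝ≥0) : delay τ b t = b (t - τ) := rfl

theorem dist_tsub_tsub_le (t u τ τ' : ℝ≥0) : dist (t - τ) (u - τ') ≤ dist t u + dist τ τ' := by
  rw [NNReal.dist_eq, NNReal.dist_eq, NNReal.dist_eq, NNReal.coe_sub_def, NNReal.coe_sub_def]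
  refine (abs_max_sub_max_le_abs _ _ _).trans ?_
  have : (t - τ - (u - τ') : ℝ) = (t - u) - (τ - τ') := by ring
  rw [this]
  exact abs_sub _ _

theorem delay_mem {τ : ℝ≥0} {b : BddFun (E →L[ℂ] E)} (hb : b ∈ uniformlyContinuousFun (E →L[ℂ] E)) :
    delay τ b ∈ uniformlyContinuousFun (E →L[ℂ] E) := by
  have hb' : UniformContinuous b := hb
  change UniformContinuous fun t => b (t - τ)
  refine hb'.comp (Metric.uniformContinuous_iff.2 fun ε hε => ⟨ε, hε, fun {t u} h => ?_⟩)
  have := dist_tsub_tsub_le t u τ τ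
  rw [dist_self, add_zero] at this
  exact this.trans_lt h

/-- A uniformly continuous function depends continuously on a time delay. -/
theorem continuous_delay {b : BddFun (E →L[ℂ] E)} (hb : b ∈ uniformlyContinuousFun (E →L[ℂ] E)) :
    Continuous fun τ => delay τ b := by
  refine Metric.continuous_iff.2 fun τ ε hε => ?_
  obtain ⟨δ, hδ, h⟩ := Metric.uniformContinuous_iff.1 (show UniformContinuous b from hb) (ε / 2)
    (by positivity)
  refine ⟨δ, hδ, fun τ' hτ => ?_⟩
  refine ((BoundedContinuousFunction.dist_le (by positivity)).2 fun t => ?_).trans_lt (half_lt_self hε)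
  refine (h ((dist_tsub_tsub_le t t τ' τ).trans_lt ?_)).le
  rwa [dist_self, zero_add]

end Families

section Amplification

variable {E : Type*} [NormedAddCommGroup E] [NormedSpace ℂ E] {p : ℝ≥0∞} [Fact (1 ≤ p)]

/-- The diagonal operator on `ℓᵖ(ℕ, E)` with entries `b(t), b(t - 1), b(t - 2), …`. -/
def ampDiag (p : ℝ≥0∞) [Fact (1 ≤ p)] (b : BddFun (E →L[ℂ] E)) (t : ℝ≥0) :
    lp (fun _ : ℕ => E) p →L[ℂ] lp (fun _ : ℕ => E) p :=
  lp.mapCLM p (fun k : ℕ => b (t - k)) (norm_nonneg b) fun _ => b.norm_coe_le_norm _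

theorem ampDiag_apply (b : BddFun (E →L[ℂ] E)) (t : ℝ≥0) (ξ : lp (fun _ : ℕ => E) p) (k : ℕ) :
    ampDiag p b t ξ k = b (t - k) (ξ k) := rfl

theorem norm_ampDiag_le (b : BddFun (E →L[ℂ] E)) (t : ℝ≥0) : ‖ampDiag p b t‖ ≤ ‖b‖ :=
  lp.norm_mapCLM_le _ _ _ _

theorem isUCFamily_ampDiag {b : BddFun (E →L[ℂ] E)}
    (hb : b ∈ uniformlyContinuousFun (E →L[ℂ] E)) : IsUCFamily (ampDiag p b) := by
  refine ⟨⟨‖b‖, norm_ampDiag_le b⟩, Metric.uniformContinuous_iff.2 fun ε hε => ?_⟩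
  obtain ⟨δ, hδ, h⟩ := Metric.uniformContinuous_iff.1 (show UniformContinuous b from hb) (ε / 2)
    (by positivity)
  refine ⟨δ, hδ, fun {t u} htu => ?_⟩
  have h1 : ∀ k : ℕ, ‖b (t - k) - b (u - k)‖ ≤ ε / 2 := fun k => by
    rw [← dist_eq_norm]
    refine (h ((dist_tsub_tsub_le t u k k).trans_lt ?_)).le
    rwa [dist_self, add_zero]
  have h2 : ampDiag p b t - ampDiag p b u =
      lp.mapCLM p (fun k : ℕ => b (t - k) - b (u - k)) (by positivity) h1 := by
    refine ContinuousLinearMap.ext fun ξ => lp.ext (funext fun k => ?_)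
    rfl
  rw [dist_eq_norm, h2]
  exact (lp.norm_mapCLM_le _ _ _ _).trans_lt (half_lt_self hε)

/-- The backward shift `(ξ₀, ξ₁, …) ↦ (ξ₁, ξ₂, …)`. -/
def shiftLeft (hp : p ≠ ⊤) : lp (fun _ : ℕ => E) p →L[ℂ] lp (fun _ : ℕ => E) p :=
  have hs : ∀ ξ : lp (fun _ : ℕ => E) p, Summable fun k => ‖ξ (k + 1)‖ ^ p.toReal := fun ξ =>
    (summable_nat_add_iff 1).2 ((lp.memℓp ξ).summable (toReal_pos_of_ne_top hp))
  LinearMap.mkContinuous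
    { toFun ξ := ⟨fun k => ξ (k + 1), memℓp_gen (hs ξ)⟩
      map_add' _ _ := rfl
      map_smul' _ _ := rfl } 1 fun ξ => by
    refine lp.norm_le_of_tsum_le (toReal_pos_of_ne_top hp) (by positivity) ?_
    rw [one_mul, lp.norm_rpow_eq_tsum (toReal_pos_of_ne_top hp),
      ((lp.memℓp ξ).summable (toReal_pos_of_ne_top hp)).tsum_eq_zero_add]
    exact le_add_of_nonneg_left (by positivity)

/-- The sequence `(0, f 0, f 1, …)`. -/
def consZero (f : ℕ → E) : ℕ → E
  | 0 => 0
  | k + 1 => f k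

omit [NormedSpace ℂ E] in
theorem summable_consZero (hp : p ≠ ⊤) (ξ : lp (fun _ : ℕ => E) p) :
    Summable fun k => ‖consZero ξ k‖ ^ p.toReal :=
  (summable_nat_add_iff 1).1 ((lp.memℓp ξ).summable (toReal_pos_of_ne_top hp))

omit [NormedSpace ℂ E] in
theorem consZero_add (f g : ℕ → E) : consZero (f + g) = consZero f + consZero g := by
  funext k
  cases k
  · exact (add_zero 0).symm
  · rfl

theorem consZero_smul (c : ℂ) (f : ℕ → E) : consZero (c • f) = c • consZero f := by
  funext k
  cases k
  · exact (smul_zero c).symm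
  · rfl

/-- The forward shift `(ξ₀, ξ₁, …) ↦ (0, ξ₀, ξ₁, …)`. -/
def shiftRight (hp : p ≠ ⊤) : lp (fun _ : ℕ => E) p →L[ℂ] lp (fun _ : ℕ => E) p :=
  LinearMap.mkContinuous
    { toFun ξ := ⟨consZero ξ, memℓp_gen (summable_consZero hp ξ)⟩
      map_add' ξ η := lp.ext (consZero_add ξ η)
      map_smul' c ξ := lp.ext (consZero_smul c ξ) } 1 fun ξ => by
    have h := toReal_pos_of_ne_top hp
    refine lp.norm_le_of_tsum_le h (by positivity) (le_of_eq ?_)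
    rw [one_mul, lp.norm_rpow_eq_tsum h]
    refine (summable_consZero hp ξ).tsum_eq_zero_add.trans ?_
    have h0 : ‖consZero ξ 0‖ ^ p.toReal = 0 := by
      change ‖(0 : E)‖ ^ p.toReal = 0
      rw [norm_zero, Real.zero_rpow h.ne']
    rw [h0, zero_add]
    rfl

theorem shiftLeft_apply (hp : p ≠ ⊤) (ξ : lp (fun _ : ℕ => E) p) (k : ℕ) :
    shiftLeft hp ξ k = ξ (k + 1) := rfl

theorem shiftRight_apply_zero (hp : p ≠ ⊤) (ξ : lp (fun _ : ℕ => E) p) :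
    shiftRight hp ξ 0 = 0 := rfl

theorem shiftRight_apply_succ (hp : p ≠ ⊤) (ξ : lp (fun _ : ℕ => E) p) (k : ℕ) :
    shiftRight hp ξ (k + 1) = ξ k := rfl

/-- The map `b ↦ (t ↦ V(t) diag(b(t), b(t - 1), …) V'(t))`. -/
def compress {V : ℝ≥0 → lp (fun _ : ℕ => E) p →L[ℂ] E} {V' : ℝ≥0 → E →L[ℂ] lp (fun _ : ℕ => E) p}
    (hV : IsUCFamily V) (hV' : IsUCFamily V') :
    uniformlyContinuousFun (E →L[ℂ] E) →ₗ[ℂ] BddFun (E →L[ℂ] E) where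
  toFun b := BoundedContinuousFunction.ofNormedAddCommGroup
    (fun t => (V t).comp ((ampDiag p b.1 t).comp (V' t)))
    (hV.comp ((isUCFamily_ampDiag b.2).comp hV')).uniformContinuous.continuous _
    (hV.comp ((isUCFamily_ampDiag b.2).comp hV')).bounded.choose_spec
  map_add' b b' := by
    ext t ξ
    have : ampDiag p (b.1 + b'.1) t (V' t ξ) = ampDiag p b.1 t (V' t ξ) + ampDiag p b'.1 t (V' t ξ) :=
      lp.ext (funext fun k => rfl)
    change V t (ampDiag p (b.1 + b'.1) t (V' t ξ)) =
      V t (ampDiag p b.1 t (V' t ξ)) + V t (ampDiag p b'.1 t (V' t ξ))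
    rw [this, map_add]
  map_smul' c b := by
    ext t ξ
    have : ampDiag p (c • b.1) t (V' t ξ) = c • ampDiag p b.1 t (V' t ξ) :=
      lp.ext (funext fun k => rfl)
    change V t (ampDiag p (c • b.1) t (V' t ξ)) = c • V t (ampDiag p b.1 t (V' t ξ))
    rw [this, map_smul]

section Compress

variable {V : ℝ≥0 → lp (fun _ : ℕ => E) p →L[ℂ] E} {V' : ℝ≥0 → E →L[ℂ] lp (fun _ : ℕ => E) p}
  (hV : IsUCFamily V) (hV' : IsUCFamily V')

theorem uniformContinuous_compress (b : uniformlyContinuousFun (E →L[ℂ] E)) :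
    compress hV hV' b ∈ uniformlyContinuousFun (E →L[ℂ] E) :=
  (hV.comp ((isUCFamily_ampDiag b.2).comp hV')).uniformContinuous

theorem continuous_compress : Continuous (compress hV hV') := by
  obtain ⟨C, hC⟩ := hV.bounded
  obtain ⟨C', hC'⟩ := hV'.bounded
  have h0 : 0 ≤ C := (norm_nonneg _).trans (hC 0)
  have h0' : 0 ≤ C' := (norm_nonneg _).trans (hC' 0)
  refine AddMonoidHomClass.continuous_of_bound (compress hV hV') (C * C') fun b => ?_
  refine (BoundedContinuousFunction.norm_le (by positivity)).2 fun t => ?_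
  change ‖(V t).comp ((ampDiag p b.1 t).comp (V' t))‖ ≤ C * C' * ‖b.1‖
  calc _ ≤ C * (‖b.1‖ * C') := by
        refine (ContinuousLinearMap.opNorm_comp_le _ _).trans
          (mul_le_mul (hC t) ?_ (norm_nonneg _) h0)
        exact (ContinuousLinearMap.opNorm_comp_le _ _).trans
          (mul_le_mul (norm_ampDiag_le _ _) (hC' t) (norm_nonneg _) (norm_nonneg _))
    _ = _ := by ring

end Compress

end Amplification

end LpRoe
end

noncomputable section

/-! ### The swindle in an algebra of uniformly continuous functions -/

namespace LpRoe

open KTheory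

section AbstractSwindle

variable {C : Type*} [NormedRing C] [NormedAlgebra ℂ C] {U A : NonUnitalSubalgebra ℂ (BddFun C)}

/-- A family `Λ i j` of maps, thought of as `b ↦ Pᵢ D(b) Pⱼ'` for a representation `D` such that
`P₀' P₀ + P₁' P₁ = 1 = P₂' P₂` and `P₀ D(b) P₀' = b`, with a homotopy `Ψ` from `Λ 2 2` to `Λ 1 1`. -/
structure IsSwindle (Λ : Fin 3 → Fin 3 → U →ₗ[ℂ] BddFun C) (Ψ : ℝ≥0 → U →ₗ[ℂ] BddFun C) :
    Prop where
  continuous : ∀ i j, Continuous (Λ i j)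
  continuous_left : ∀ τ, Continuous (Ψ τ)
  continuous_right : ∀ b, Continuous fun τ => Ψ τ b
  mul_two : ∀ i j a b, Λ i 2 a * Λ 2 j b = Λ i j (a * b)
  mul_zero_add_one : ∀ i j a b, Λ i 0 a * Λ 0 j b + Λ i 1 a * Λ 1 j b = Λ i j (a * b)
  zero_zero : ∀ b, Λ 0 0 b = b
  zero_one : ∀ b, Λ 0 1 b = 0
  one_zero : ∀ b, Λ 1 0 b = 0
  homotopy_zero : Ψ 0 = Λ 2 2
  homotopy_one : Ψ 1 = Λ 1 1
  homotopy_mul : ∀ τ a b, Ψ τ (a * b) = Ψ τ a * Ψ τ b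

/-- The elements that all the maps of a swindle send into `A`. -/
def swindleAlgebra {Λ : Fin 3 → Fin 3 → U →ₗ[ℂ] BddFun C} {Ψ : ℝ≥0 → U →ₗ[ℂ] BddFun C}
    (h : IsSwindle Λ Ψ) (A : NonUnitalSubalgebra ℂ (BddFun C)) : NonUnitalSubalgebra ℂ U where
  carrier := {b | (∀ i j, Λ i j b ∈ A) ∧ ∀ τ, Ψ τ b ∈ A}
  zero_mem' := ⟨fun i j => by rw [map_zero]; exact zero_mem _,
    fun τ => by rw [map_zero]; exact zero_mem _⟩
  add_mem' := fun ha hb => ⟨fun i j => by rw [map_add]; exact add_mem (ha.1 i j) (hb.1 i j),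
    fun τ => by rw [map_add]; exact add_mem (ha.2 τ) (hb.2 τ)⟩
  smul_mem' := fun c _ ha => ⟨fun i j => by rw [map_smul]; exact SMulMemClass.smul_mem c (ha.1 i j),
    fun τ => by rw [map_smul]; exact SMulMemClass.smul_mem c (ha.2 τ)⟩
  mul_mem' := fun ha hb => ⟨fun i j => by rw [← h.mul_two]; exact mul_mem (ha.1 i 2) (hb.1 2 j),
    fun τ => by rw [h.homotopy_mul]; exact mul_mem (ha.2 τ) (hb.2 τ)⟩

instance (S : NonUnitalSubalgebra ℂ U) : NormedSpace ℂ S where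
  norm_smul_le c a := norm_smul_le c (a : U)

variable {Λ : Fin 3 → Fin 3 → U →ₗ[ℂ] BddFun C} {Ψ : ℝ≥0 → U →ₗ[ℂ] BddFun C}

theorem IsSwindle.isClosed_swindleAlgebra (h : IsSwindle Λ Ψ)
    (hA : IsClosed (A : Set (BddFun C))) : IsClosed (swindleAlgebra h A : Set U) := by
  have : (swindleAlgebra h A : Set U) =
      (⋂ i, ⋂ j, Λ i j ⁻¹' (A : Set (BddFun C))) ∩ ⋂ τ, Ψ τ ⁻¹' (A : Set (BddFun C)) := by
    ext b
    simp only [Set.mem_inter_iff, Set.mem_iInter]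
    rfl
  rw [this]
  exact (isClosed_iInter fun i => isClosed_iInter fun j => hA.preimage (h.continuous i j)).inter
    (isClosed_iInter fun τ => hA.preimage (h.continuous_left τ))

/-- The homomorphism `b ↦ Ψ τ b` on the swindle algebra. -/
def IsSwindle.homotopyHom (h : IsSwindle Λ Ψ) (A : NonUnitalSubalgebra ℂ (BddFun C)) (τ : ℝ≥0) :
    swindleAlgebra h A →ₙₐ[ℂ] A where
  toFun b := ⟨Ψ τ b.1, b.2.2 τ⟩
  map_smul' c b := Subtype.ext (map_smul (Ψ τ) c b.1)
  map_zero' := Subtype.ext (map_zero (Ψ τ))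
  map_add' a b := Subtype.ext (map_add (Ψ τ) a.1 b.1)
  map_mul' a b := Subtype.ext (h.homotopy_mul τ a.1 b.1)

/-- The inclusion of the swindle algebra in `A`. -/
def IsSwindle.inclusion (h : IsSwindle Λ Ψ) (A : NonUnitalSubalgebra ℂ (BddFun C)) :
    swindleAlgebra h A →ₙₐ[ℂ] A where
  toFun b := ⟨b.1.1, by rw [← h.zero_zero]; exact b.2.1 0 0⟩
  map_smul' _ _ := rfl
  map_zero' := rfl
  map_add' _ _ := rfl
  map_mul' _ _ := rfl

/-- For scalars with `c₁ = c₀` and `c₀² + c₂² = 1`, the map `b ↦ (cᵢ cⱼ Λ i j b)` is a homomorphism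
into the `3 × 3` matrices. -/
def IsSwindle.rotation (h : IsSwindle Λ Ψ) (A : NonUnitalSubalgebra ℂ (BddFun C)) (c : Fin 3 → ℂ)
    (hc : c 1 = c 0) (hc' : c 0 * c 0 + c 2 * c 2 = 1) :
    swindleAlgebra h A →ₙₐ[ℂ] Matrix (Fin 3) (Fin 3) A where
  toFun b := Matrix.of fun i j =>
    ⟨(c i * c j) • Λ i j b.1, SMulMemClass.smul_mem _ (b.2.1 i j)⟩
  map_smul' z b := Matrix.ext fun i j => Subtype.ext (by
    change (c i * c j) • Λ i j (z • b.1) = z • (c i * c j) • Λ i j b.1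
    rw [map_smul, smul_comm])
  map_zero' := Matrix.ext fun i j => Subtype.ext (by
    change (c i * c j) • Λ i j 0 = 0
    rw [map_zero, smul_zero])
  map_add' a b := Matrix.ext fun i j => Subtype.ext (by
    change (c i * c j) • Λ i j (a.1 + b.1) = (c i * c j) • Λ i j a.1 + (c i * c j) • Λ i j b.1
    rw [map_add, smul_add])
  map_mul' a b := Matrix.ext fun i j => Subtype.ext (by
    rw [Matrix.mul_apply, Fin.sum_univ_three]
    change (c i * c j) • Λ i j (a.1 * b.1) =
      (c i * c 0) • Λ i 0 a.1 * (c 0 * c j) • Λ 0 j b.1 +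
      (c i * c 1) • Λ i 1 a.1 * (c 1 * c j) • Λ 1 j b.1 +
      (c i * c 2) • Λ i 2 a.1 * (c 2 * c j) • Λ 2 j b.1
    simp only [smul_mul_smul_comm, hc, h.mul_two]
    rw [← smul_add, h.mul_zero_add_one, ← add_smul]
    congr 1
    linear_combination (-(c i * c j)) * hc')

/-- The homotopy `Ψ` connects `diag(b, Λ 2 2 b, 0)` to `diag(b, Λ 1 1 b, 0)`, and the rotations with
`c = (cos, cos, sin)` connect the latter to `diag(0, 0, Λ 2 2 b)`. -/
theorem IsSwindle.hasSwindle (h : IsSwindle Λ Ψ) (A : NonUnitalSubalgebra ℂ (BddFun C)) :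
    HasSwindle (A := A) (B := swindleAlgebra h A) (h.inclusion A) := by
  refine ⟨h.homotopyHom A 0, h.homotopyHom A 1, ?_, ?_⟩
  · refine ⟨fun t => diagHom ![h.inclusion A, h.homotopyHom A t.toNNReal, 0], fun b => ?_, ?_, ?_⟩
    · refine continuous_matrix fun i j => ?_
      change Continuous fun t : ℝ => Matrix.diagonal
        (fun i => (![h.inclusion A, h.homotopyHom A t.toNNReal, 0] : Fin 3 → _) i b) i j
      simp only [Matrix.diagonal_apply]
      split_ifs with hij
      · fin_cases i
        · exact continuous_const
        · exact ((h.continuous_right b.1).comp continuous_real_toNNReal).subtype_mk _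
        · exact continuous_const
      · exact continuous_const
    · simp
    · simp
  · let c : ℝ → Fin 3 → ℂ := fun t =>
      ![(Real.cos (t * (Real.pi / 2)) : ℝ), (Real.cos (t * (Real.pi / 2)) : ℝ),
        (Real.sin (t * (Real.pi / 2)) : ℝ)]
    have hc : ∀ t, c t 0 * c t 0 + c t 2 * c t 2 = 1 := fun t => by
      have h := Real.sin_sq_add_cos_sq (t * (Real.pi / 2))
      change ((Real.cos (t * (Real.pi / 2)) : ℝ) : ℂ) * (Real.cos (t * (Real.pi / 2)) : ℝ) +
        ((Real.sin (t * (Real.pi / 2)) : ℝ) : ℂ) * (Real.sin (t * (Real.pi / 2)) : ℝ) = 1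
      rw [← Complex.ofReal_mul, ← Complex.ofReal_mul, ← Complex.ofReal_add, ← Complex.ofReal_one]
      congr 1
      linear_combination h
    have hcont : ∀ i, Continuous fun t => c t i := fun i => by
      fin_cases i
      · change Continuous fun t : ℝ => ((Real.cos (t * (Real.pi / 2)) : ℝ) : ℂ)
        fun_prop
      · change Continuous fun t : ℝ => ((Real.cos (t * (Real.pi / 2)) : ℝ) : ℂ)
        fun_prop
      · change Continuous fun t : ℝ => ((Real.sin (t * (Real.pi / 2)) : ℝ) : ℂ)
        fun_prop
    refine ⟨fun t => h.rotation A (c t) rfl (hc t), fun b => ?_, ?_, ?_⟩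
    · refine continuous_matrix fun i j => Continuous.subtype_mk ?_ _
      exact ((hcont i).mul (hcont j)).smul continuous_const
    · have c0 : c 0 0 = 1 := by
        change ((Real.cos (0 * (Real.pi / 2)) : ℝ) : ℂ) = 1
        simp
      have c1 : c 0 1 = 1 := c0
      have c2 : c 0 2 = 0 := by
        change ((Real.sin (0 * (Real.pi / 2)) : ℝ) : ℂ) = 0
        simp
      refine NonUnitalAlgHom.ext fun b => Matrix.ext fun i j => Subtype.ext ?_
      change (c 0 i * c 0 j) • Λ i j b.1 = ((Matrix.diagonal
        (fun i => (![h.inclusion A, h.homotopyHom A 1, 0] : Fin 3 → _) i b) i j : A) : BddFun C)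
      rw [Matrix.diagonal_apply]
      fin_cases i <;> fin_cases j
      · change (c 0 0 * c 0 0) • Λ 0 0 b.1 = b.1.1
        rw [c0, h.zero_zero, mul_one, one_smul]
      · change (c 0 0 * c 0 1) • Λ 0 1 b.1 = 0
        rw [h.zero_one, smul_zero]
      · change (c 0 0 * c 0 2) • Λ 0 2 b.1 = 0
        rw [c2, mul_zero, zero_smul]
      · change (c 0 1 * c 0 0) • Λ 1 0 b.1 = 0
        rw [h.one_zero, smul_zero]
      · change (c 0 1 * c 0 1) • Λ 1 1 b.1 = Ψ 1 b.1
        rw [c1, h.homotopy_one, mul_one, one_smul]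
      · change (c 0 1 * c 0 2) • Λ 1 2 b.1 = 0
        rw [c2, mul_zero, zero_smul]
      · change (c 0 2 * c 0 0) • Λ 2 0 b.1 = 0
        rw [c2, zero_mul, zero_smul]
      · change (c 0 2 * c 0 1) • Λ 2 1 b.1 = 0
        rw [c2, zero_mul, zero_smul]
      · change (c 0 2 * c 0 2) • Λ 2 2 b.1 = 0
        rw [c2, zero_mul, zero_smul]
    · have c0 : c 1 0 = 0 := by
        change ((Real.cos (1 * (Real.pi / 2)) : ℝ) : ℂ) = 0
        simp
      have c1 : c 1 1 = 0 := c0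
      have c2 : c 1 2 = 1 := by
        change ((Real.sin (1 * (Real.pi / 2)) : ℝ) : ℂ) = 1
        simp
      refine NonUnitalAlgHom.ext fun b => Matrix.ext fun i j => Subtype.ext ?_
      change (c 1 i * c 1 j) • Λ i j b.1 = ((Matrix.diagonal
        (fun i => (![0, 0, h.homotopyHom A 0] : Fin 3 → _) i b) i j : A) : BddFun C)
      rw [Matrix.diagonal_apply]
      fin_cases i <;> fin_cases j
      · change (c 1 0 * c 1 0) • Λ 0 0 b.1 = 0
        rw [c0, zero_mul, zero_smul]
      · change (c 1 0 * c 1 1) • Λ 0 1 b.1 = 0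
        rw [c0, zero_mul, zero_smul]
      · change (c 1 0 * c 1 2) • Λ 0 2 b.1 = 0
        rw [c0, zero_mul, zero_smul]
      · change (c 1 1 * c 1 0) • Λ 1 0 b.1 = 0
        rw [c1, zero_mul, zero_smul]
      · change (c 1 1 * c 1 1) • Λ 1 1 b.1 = 0
        rw [c1, zero_mul, zero_smul]
      · change (c 1 1 * c 1 2) • Λ 1 2 b.1 = 0
        rw [c1, zero_mul, zero_smul]
      · change (c 1 2 * c 1 0) • Λ 2 0 b.1 = 0
        rw [c0, mul_zero, zero_smul]
      · change (c 1 2 * c 1 1) • Λ 2 1 b.1 = 0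
        rw [c1, mul_zero, zero_smul]
      · change (c 1 2 * c 1 2) • Λ 2 2 b.1 = Ψ 0 b.1
        rw [c2, h.homotopy_zero, mul_one, one_smul]

theorem IsSwindle.absorbed [CompleteSpace C] (h : IsSwindle Λ Ψ)
    (hU : IsClosed (U : Set (BddFun C))) (hA : IsClosed (A : Set (BddFun C))) {F : Set A}
    (hF : ∀ a ∈ F, ∃ b ∈ swindleAlgebra h A, (b : BddFun C) = a) : Absorbed F := by
  have : CompleteSpace U := hU.completeSpace_coe
  refine ⟨swindleAlgebra h A, inferInstance, inferInstance, inferInstance, inferInstance,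
    (h.isClosed_swindleAlgebra hA).completeSpace_coe, h.inclusion A, fun b => rfl,
    fun a ha => ?_, h.hasSwindle A⟩
  obtain ⟨b, hb, hba⟩ := hF a ha
  exact ⟨⟨b, hb⟩, Subtype.ext hba⟩

end AbstractSwindle

section Swindle

variable {E : Type*} [NormedAddCommGroup E] [NormedSpace ℂ E] {p : ℝ≥0∞} [Fact (1 ≤ p)]
  {V : ℝ≥0 → lp (fun _ : ℕ => E) p →L[ℂ] E} {V' : ℝ≥0 → E →L[ℂ] lp (fun _ : ℕ => E) p}

/-- The operators `P₀ ξ = ξ₀`, `P₁ ξ = V (ξ₁, ξ₂, …)` and `P₂ ξ = V ξ` from `ℓᵖ(ℕ, E)` to `E`. -/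
def cornerLeft (hp : p ≠ ⊤) (V : ℝ≥0 → lp (fun _ : ℕ => E) p →L[ℂ] E) :
    Fin 3 → ℝ≥0 → lp (fun _ : ℕ => E) p →L[ℂ] E :=
  ![fun _ => lp.evalCLM ℂ (fun _ : ℕ => E) p 0, fun t => (V t).comp (shiftLeft hp), V]

/-- The operators from `E` to `ℓᵖ(ℕ, E)` dual to `P₀`, `P₁` and `P₂`. -/
def cornerRight (hp : p ≠ ⊤) (V' : ℝ≥0 → E →L[ℂ] lp (fun _ : ℕ => E) p) :
    Fin 3 → ℝ≥0 → E →L[ℂ] lp (fun _ : ℕ => E) p :=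
  ![fun _ => lp.singleContinuousLinearMap ℂ (fun _ : ℕ => E) p 0,
    fun t => (shiftRight hp).comp (V' t), V']

theorem isUCFamily_cornerLeft (hp : p ≠ ⊤) (hV : IsUCFamily V) (i : Fin 3) :
    IsUCFamily (cornerLeft hp V i) := by
  fin_cases i
  · exact isUCFamily_const _
  · exact hV.comp (isUCFamily_const _)
  · exact hV

theorem isUCFamily_cornerRight (hp : p ≠ ⊤) (hV' : IsUCFamily V') (i : Fin 3) :
    IsUCFamily (cornerRight hp V' i) := by
  fin_cases i
  · exact isUCFamily_const _
  · exact (isUCFamily_const _).comp hV'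
  · exact hV'

/-- The map `b ↦ Pᵢ diag(b(t), b(t - 1), …) Pⱼ'`. -/
def corner (hp : p ≠ ⊤) (hV : IsUCFamily V) (hV' : IsUCFamily V') (i j : Fin 3) :
    uniformlyContinuousFun (E →L[ℂ] E) →ₗ[ℂ] BddFun (E →L[ℂ] E) :=
  compress (isUCFamily_cornerLeft hp hV i) (isUCFamily_cornerRight hp hV' j)

variable (hp : p ≠ ⊤) (hV : IsUCFamily V) (hV' : IsUCFamily V') (hVV : ∀ t ξ, V' t (V t ξ) = ξ)

theorem corner_apply (i j : Fin 3) (b : uniformlyContinuousFun (E →L[ℂ] E)) (t : ℝ≥0) (ξ : E) :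
    corner hp hV hV' i j b t ξ =
      cornerLeft hp V i t (ampDiag p b.1 t (cornerRight hp V' j t ξ)) := rfl

theorem continuous_corner (i j : Fin 3) : Continuous (corner hp hV hV' i j) :=
  continuous_compress _ _

theorem corner_zero_zero (b : uniformlyContinuousFun (E →L[ℂ] E)) :
    corner hp hV hV' 0 0 b = b := by
  ext t ξ
  change b.1 (t - (0 : ℕ)) ((lp.single p 0 ξ : lp (fun _ : ℕ => E) p) 0) = b.1 t ξ
  rw [Nat.cast_zero, tsub_zero, lp.single_apply_self]

theorem corner_zero_one (b : uniformlyContinuousFun (E →L[ℂ] E)) :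
    corner hp hV hV' 0 1 b = 0 := by
  ext t ξ
  change b.1 (t - (0 : ℕ)) (shiftRight hp (V' t ξ) 0) = 0
  rw [shiftRight_apply_zero, map_zero]

theorem corner_one_zero (b : uniformlyContinuousFun (E →L[ℂ] E)) :
    corner hp hV hV' 1 0 b = 0 := by
  ext t ξ
  change V t (shiftLeft hp (ampDiag p b.1 t (lp.single p 0 ξ))) = 0
  have : shiftLeft hp (ampDiag p b.1 t (lp.single p 0 ξ)) = 0 := by
    refine lp.ext (funext fun k => ?_)
    rw [shiftLeft_apply, ampDiag_apply, lp.single_apply_ne _ _ _ (Nat.succ_ne_zero k), map_zero]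
    rfl
  rw [this, map_zero]

theorem corner_one_one (b : uniformlyContinuousFun (E →L[ℂ] E)) :
    corner hp hV hV' 1 1 b = corner hp hV hV' 2 2 ⟨delay 1 b.1, delay_mem b.2⟩ := by
  ext t ξ
  change V t (shiftLeft hp (ampDiag p b.1 t (shiftRight hp (V' t ξ)))) =
    V t (ampDiag p (delay 1 b.1) t (V' t ξ))
  congr 1
  refine lp.ext (funext fun k => ?_)
  rw [shiftLeft_apply, ampDiag_apply, shiftRight_apply_succ, ampDiag_apply, delay_apply,
    Nat.cast_add, Nat.cast_one, tsub_add_eq_tsub_tsub]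

include hVV in
theorem corner_mul_two (i j : Fin 3) (a b : uniformlyContinuousFun (E →L[ℂ] E)) :
    corner hp hV hV' i 2 a * corner hp hV hV' 2 j b = corner hp hV hV' i j (a * b) := by
  ext t ξ
  change cornerLeft hp V i t (ampDiag p a.1 t (V' t (V t (ampDiag p b.1 t
    (cornerRight hp V' j t ξ))))) = _
  rw [hVV]
  rfl

include hVV in
theorem corner_mul_zero_add_one (i j : Fin 3) (a b : uniformlyContinuousFun (E →L[ℂ] E)) :
    corner hp hV hV' i 0 a * corner hp hV hV' 0 j b +
      corner hp hV hV' i 1 a * corner hp hV hV' 1 j b = corner hp hV hV' i j (a * b) := by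
  ext t ξ
  set η := ampDiag p b.1 t (cornerRight hp V' j t ξ) with hη
  have key : lp.single p 0 (η 0) + shiftRight hp (V' t (V t (shiftLeft hp η))) = η := by
    rw [hVV]
    refine lp.ext (funext fun k => ?_)
    rw [lp.coeFn_add, Pi.add_apply]
    cases k with
    | zero => rw [shiftRight_apply_zero, add_zero, lp.single_apply_self]
    | succ k =>
      rw [shiftRight_apply_succ, shiftLeft_apply, lp.single_apply_ne _ _ _ (Nat.succ_ne_zero k),
        zero_add]
  change cornerLeft hp V i t (ampDiag p a.1 t (lp.single p 0 (η 0))) +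
    cornerLeft hp V i t (ampDiag p a.1 t (shiftRight hp (V' t (V t (shiftLeft hp η))))) = _
  rw [← map_add, ← map_add, key]
  rfl

/-- Time delays of uniformly continuous functions. -/
def delayLinear (τ : ℝ≥0) : uniformlyContinuousFun (E →L[ℂ] E) →ₗ[ℂ]
    uniformlyContinuousFun (E →L[ℂ] E) where
  toFun b := ⟨delay τ b.1, delay_mem b.2⟩
  map_add' _ _ := rfl
  map_smul' _ _ := rfl

theorem delayLinear_mul (τ : ℝ≥0) (a b : uniformlyContinuousFun (E →L[ℂ] E)) :
    delayLinear τ (a * b) = delayLinear τ a * delayLinear τ b := rfl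

theorem delayLinear_zero (b : uniformlyContinuousFun (E →L[ℂ] E)) : delayLinear 0 b = b := by
  ext t ξ
  change b.1 (t - 0) ξ = b.1 t ξ
  rw [tsub_zero]

theorem continuous_delayLinear (τ : ℝ≥0) :
    Continuous (delayLinear (E := E) τ) :=
  Continuous.subtype_mk ((BoundedContinuousFunction.continuous_compContinuous _).comp
    continuous_subtype_val) _

include hVV in
/-- The swindle identities for `Pᵢ diag(b(t), b(t - 1), …) Pⱼ'`. Deleting the first summand amounts
to the time delay by one, which is connected to the identity through delays by `τ ∈ [0, 1]`. -/
theorem isSwindle_corner : IsSwindle (corner hp hV hV')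
    fun τ => (corner hp hV hV' 2 2).comp (delayLinear τ) where
  continuous := continuous_corner hp hV hV'
  continuous_left τ := (continuous_corner hp hV hV' 2 2).comp (continuous_delayLinear τ)
  continuous_right b := (continuous_corner hp hV hV' 2 2).comp ((continuous_delay b.2).subtype_mk _)
  mul_two := corner_mul_two hp hV hV' hVV
  mul_zero_add_one := corner_mul_zero_add_one hp hV hV' hVV
  zero_zero := corner_zero_zero hp hV hV'
  zero_one := corner_zero_one hp hV hV'
  one_zero := corner_one_zero hp hV hV'
  homotopy_zero := LinearMap.ext fun b => by
    rw [LinearMap.comp_apply, delayLinear_zero]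
  homotopy_one := LinearMap.ext fun b => (corner_one_one hp hV hV' b).symm
  homotopy_mul τ a b := by
    rw [LinearMap.comp_apply, delayLinear_mul]
    exact (corner_mul_two hp hV hV' hVV 2 2 _ _).symm

end Swindle

end LpRoe
end

noncomputable section

/-! ### Frames adapted to a compact subset of the groupoid -/

namespace LpRoe

section L1

variable {Γ : Type*}

theorem l1dist_self (y : Γ →₀ ℝ) : l1dist y y = 0 := by simp [l1dist]

theorem l1dist_comm (y z : Γ →₀ ℝ) : l1dist y z = l1dist z y := by
  classical
  have h1 := Finset.subset_union_left (s₁ := y.support) (s₂ := z.support)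
  have h2 := Finset.subset_union_right (s₁ := y.support) (s₂ := z.support)
  rw [l1dist_eq h1 h2, l1dist_eq h2 h1]
  exact Finset.sum_congr rfl fun g _ => abs_sub_comm _ _

theorem l1dist_triangle (x y z : Γ →₀ ℝ) : l1dist x z ≤ l1dist x y + l1dist y z := by
  classical
  set B := x.support ∪ (y.support ∪ z.support)
  have h1 : x.support ⊆ B := Finset.subset_union_left
  have h2 : y.support ⊆ B := Finset.subset_union_left.trans Finset.subset_union_right
  have h3 : z.support ⊆ B := Finset.subset_union_right.trans Finset.subset_union_right
  rw [l1dist_eq h1 h2, l1dist_eq h2 h3, l1dist_eq h1 h3, ← Finset.sum_add_distrib]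
  exact Finset.sum_le_sum fun g _ => abs_sub_le _ _ _

theorem l1dist_nonneg (y z : Γ →₀ ℝ) : 0 ≤ l1dist y z :=
  Finset.sum_nonneg fun _ _ => abs_nonneg _

theorem l1dist_smul (c : ℝ) (y z : Γ →₀ ℝ) : l1dist (c • y) (c • z) = |c| * l1dist y z := by
  classical
  have h1 := Finset.subset_union_left (s₁ := y.support) (s₂ := z.support)
  have h2 := Finset.subset_union_right (s₁ := y.support) (s₂ := z.support)
  rw [l1dist_eq h1 h2, l1dist_eq (Finsupp.support_smul.trans h1) (Finsupp.support_smul.trans h2),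
    Finset.mul_sum]
  refine Finset.sum_congr rfl fun g _ => ?_
  rw [Finsupp.smul_apply, Finsupp.smul_apply, ← smul_sub, smul_eq_mul, abs_mul]

theorem l1dist_smul_left (a b : ℝ) (y : Γ →₀ ℝ) :
    l1dist (a • y) (b • y) = |a - b| * l1dist y 0 := by
  rw [l1dist, l1dist, sub_zero, ← sub_smul]
  rw [Finsupp.sum_of_support_subset _ Finsupp.support_smul _ (by simp), Finsupp.sum,
    Finset.mul_sum]
  refine Finset.sum_congr rfl fun g _ => ?_
  rw [Finsupp.smul_apply, smul_eq_mul, abs_mul]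

/-- The sum of the coordinates is `1`-Lipschitz for the `ℓ¹` distance. -/
theorem abs_sum_sub_sum_le (y z : Γ →₀ ℝ) :
    |(y.sum fun _ a => a) - z.sum fun _ a => a| ≤ l1dist y z := by
  classical
  have h1 := Finset.subset_union_left (s₁ := y.support) (s₂ := z.support)
  have h2 := Finset.subset_union_right (s₁ := y.support) (s₂ := z.support)
  rw [l1dist_eq h1 h2, Finsupp.sum_of_support_subset _ h1 _ (by simp),
    Finsupp.sum_of_support_subset _ h2 _ (by simp), ← Finset.sum_sub_distrib]
  exact Finset.abs_sum_le_sum_abs _ _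

variable [Group Γ] {l : ProperLength Γ} {s : ℝ}

theorem Rips.l1dist_zero (z : Rips l s) : l1dist z.coord 0 = 1 := by
  rw [l1dist, sub_zero, ← z.sum_eq_one]
  exact Finset.sum_congr rfl fun g _ => abs_of_nonneg (z.nonneg g)

theorem Rips.dist_le_two (y z : Rips l s) : dist y z ≤ 2 := by
  rw [Rips.dist_def]
  refine (l1dist_triangle _ 0 _).trans ?_
  rw [l1dist_comm 0, y.l1dist_zero, z.l1dist_zero]
  norm_num

theorem Rips.smul_sum (a : ℝ) (z : Rips l s) : ((a • z.coord).sum fun _ a => a) = a := by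
  rw [Finsupp.sum_smul_index (fun _ => rfl), ← Finsupp.mul_sum, z.sum_eq_one, mul_one]

/-- Some nonnegative multiple of the point `u` is within `C` of `v`. -/
def Near (C : ℝ) (v : Γ →₀ ℝ) (u : Rips l s) : Prop := ∃ a : ℝ, l1dist (a • u.coord) v ≤ C

theorem Near.mono {C C' : ℝ} {v v' : Γ →₀ ℝ} {u : Rips l s} (h : Near C v u)
    (h' : C + l1dist v v' ≤ C') : Near C' v' u := by
  obtain ⟨a, ha⟩ := h
  exact ⟨a, (l1dist_triangle _ v _).trans (by linarith)⟩

/-- The points of the Rips complex in the directions of two long vectors at bounded distance are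
close to each other. -/
theorem Near.dist_le {C D t : ℝ} {v v' : Γ →₀ ℝ} {u u' : Rips l s} (h : Near C v u)
    (h' : Near C v' u') (hD : l1dist v v' ≤ D) (ht : t ≤ v.sum fun _ a => a) (hC : C < t) :
    dist u u' ≤ 2 * (2 * C + D) / (t - C) := by
  obtain ⟨a, ha⟩ := h
  obtain ⟨a', ha'⟩ := h'
  have h1 : l1dist (a • u.coord) (a' • u'.coord) ≤ 2 * C + D := by
    have e1 := l1dist_triangle (a • u.coord) v (a' • u'.coord)
    have e2 := l1dist_triangle v v' (a' • u'.coord)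
    rw [l1dist_comm v'] at e2
    linarith
  have h2 : |a - a'| ≤ 2 * C + D := by
    have := abs_sum_sub_sum_le (a • u.coord) (a' • u'.coord)
    rw [Rips.smul_sum, Rips.smul_sum] at this
    exact this.trans h1
  have h3 : t - C ≤ a := by
    have := (abs_sub_le_iff.1 ((abs_sum_sub_sum_le (a • u.coord) v).trans ha)).2
    rw [Rips.smul_sum] at this
    linarith
  have h4 : a * dist u u' ≤ 2 * (2 * C + D) := by
    have e1 := l1dist_smul a u.coord u'.coord
    rw [abs_of_nonneg (by linarith)] at e1
    have e2 := l1dist_triangle (a • u.coord) (a' • u'.coord) (a • u'.coord)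
    rw [l1dist_smul_left, u'.l1dist_zero, abs_sub_comm, mul_one] at e2
    rw [Rips.dist_def]
    linarith
  rw [le_div_iff₀ (by linarith)]
  have := mul_le_mul_of_nonneg_right h3 (dist_nonneg (x := u) (y := u'))
  linarith

end L1

section Adapted

variable {Γ : Type*} [Group Γ] {l : ProperLength Γ} {s : ℝ} {X : Type*} [MulAction Γ X]

/-- Every pair of vertices of `z` and `w` is related by `K` over `x`. -/
def Related (K : Set (TransGroupoid Γ X)) (z w : RatRips l s) (x : X) : Prop :=
  ∀ g ∈ z.point.supp, ∀ h ∈ w.point.supp, (g * h⁻¹, h • x) ∈ K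

/-- A subset of the groupoid that is closed under inverses and contains the units of its
elements. -/
structure IsSymmetric (K : Set (TransGroupoid Γ X)) : Prop where
  inv_mem : ∀ (g : Γ) (x : X), (g, x) ∈ K → (g⁻¹, g • x) ∈ K
  source_mem : ∀ (g : Γ) (x : X), (g, x) ∈ K → (1, x) ∈ K

theorem Related.symm {K : Set (TransGroupoid Γ X)} (hK : IsSymmetric K) {z w : RatRips l s} {x : X}
    (h : Related K z w x) : Related K w z x := fun g hg k hk => by
  have := hK.inv_mem _ _ (h k hk g hg)
  rwa [mul_inv_rev, inv_inv, smul_smul, inv_mul_cancel_right] at this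

theorem Related.one_mem {K : Set (TransGroupoid Γ X)} (hK : IsSymmetric K) {z w : RatRips l s}
    {x : X} (h : Related K z w x) {g : Γ} (hg : g ∈ z.point.supp) : (1, g • x) ∈ K := by
  obtain ⟨k, hk⟩ := w.point.supp_nonempty
  exact hK.source_mem _ _ (h.symm hK k hk g hg)

theorem related_of_support_subset {K : Set (TransGroupoid Γ X)} {p : ℝ≥0∞} [Fact (1 ≤ p)]
    {b : RipsSpace l s X p →L[ℂ] RipsSpace l s X p} (hb : support b ⊆ K) {z w : RatRips l s} {x : X}
    (h : atPoint (entry b z w) x ≠ 0) : Related K z w x :=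
  fun g hg k hk => hb ⟨z, w, x, g, k, h, hg, hk, rfl⟩

/-- A time dependent frame is adapted to `K` if over points related by `K` it moves vertices only
within the compact set `K'`, and the points `u` it uses at time `t` are the directions, up to a
bounded error, of vectors `v t k z x` of length at least `t` that interpolate between `t z` for
`k = 0` and a vector depending only on the component of `z`. -/
structure IsAdapted (K K' : Set (TransGroupoid Γ X))
    (β : ℝ≥0 → ℕ → RatRips l s → RatRips l s → X → ℝ)
    (v : ℝ≥0 → ℕ → RatRips l s → X → Γ →₀ ℝ) (C : ℝ) : Prop where
  subset : K ⊆ K'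
  nonneg : 0 ≤ C
  vertex : ∀ {t k u z w x}, Related K z w x → β t k u z x ≠ 0 → ∀ g ∈ u.point.supp,
    ∃ h ∈ z.point.supp, (h * g⁻¹, g • x) ∈ K'
  near : ∀ {t k u z w x}, Related K z w x → β t k u z x ≠ 0 → Near C (v t k z x) u.point
  zero : ∀ t z x, v t 0 z x = (t : ℝ) • z.point.coord
  succ : ∀ {t k z w x}, Related K z w x → l1dist (v t k z x) (v t (k + 1) z x) ≤ C
  pair : ∀ {t k z w x}, Related K z w x →
    l1dist (v t k z x) (v t k w x) ≤ ((t - k : ℝ≥0) : ℝ) * dist z.point w.point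
  mass : ∀ {t : ℝ≥0} {k z w x}, Related K z w x → (t : ℝ) ≤ (v t k z x).sum fun _ a => a

open scoped Classical in
/-- The weights of the operators `Pᵢ` restricted to the `k`-th copy of `E_s`. -/
def cornerWeight (β : ℕ → RatRips l s → RatRips l s → X → ℝ) :
    Fin 3 → ℕ → RatRips l s → RatRips l s → X → ℝ :=
  ![fun k => if k = 0 then fun u z _ => if u = z then 1 else 0 else fun _ _ _ => 0,
    fun k => if k = 0 then fun _ _ _ => 0 else β (k - 1), β]

variable {K K' : Set (TransGroupoid Γ X)} {β : ℝ≥0 → ℕ → RatRips l s → RatRips l s → X → ℝ}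
  {v : ℝ≥0 → ℕ → RatRips l s → X → Γ →₀ ℝ} {C : ℝ}

theorem IsAdapted.cornerWeight_vertex (h : IsAdapted K K' β v C) (hK : IsSymmetric K) (i : Fin 3)
    {t : ℝ≥0} {k : ℕ} {u z w : RatRips l s} {x : X} (hzw : Related K z w x)
    (h0 : cornerWeight (β t) i k u z x ≠ 0) {g : Γ} (hg : g ∈ u.point.supp) :
    ∃ h ∈ z.point.supp, (h * g⁻¹, g • x) ∈ K' := by
  classical
  rcases Nat.eq_zero_or_pos k with rfl | hk
  · fin_cases i
    · have huz : u = z := by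
        by_contra hne
        exact h0 (if_neg hne)
      subst huz
      refine ⟨g, hg, ?_⟩
      rw [mul_inv_cancel]
      exact h.subset (hzw.one_mem hK hg)
    · exact absurd rfl h0
    · exact h.vertex hzw h0 g hg
  · fin_cases i
    · change (if k = 0 then fun u z _ => if u = z then 1 else 0 else fun _ _ _ => 0 :
        RatRips l s → RatRips l s → X → ℝ) u z x ≠ 0 at h0
      rw [if_neg hk.ne'] at h0
      exact absurd rfl h0
    · change (if k = 0 then fun _ _ _ => 0 else β t (k - 1) :
        RatRips l s → RatRips l s → X → ℝ) u z x ≠ 0 at h0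
      rw [if_neg hk.ne'] at h0
      exact h.vertex hzw h0 g hg
    · exact h.vertex hzw h0 g hg

theorem IsAdapted.cornerWeight_near (h : IsAdapted K K' β v C) (i : Fin 3)
    {t : ℝ≥0} {k : ℕ} {u z w : RatRips l s} {x : X} (hzw : Related K z w x)
    (h0 : cornerWeight (β t) i k u z x ≠ 0) : Near (2 * C) (v t k z x) u.point := by
  classical
  have hC := h.nonneg
  rcases Nat.eq_zero_or_pos k with rfl | hk
  · fin_cases i
    · have huz : u = z := by
        by_contra hne
        exact h0 (if_neg hne)
      subst huz
      rw [h.zero]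
      exact ⟨t, by rw [l1dist_self]; positivity⟩
    · exact absurd rfl h0
    · refine (h.near hzw h0).mono ?_
      rw [l1dist_self]
      linarith
  · fin_cases i
    · change (if k = 0 then fun u z _ => if u = z then 1 else 0 else fun _ _ _ => 0 :
        RatRips l s → RatRips l s → X → ℝ) u z x ≠ 0 at h0
      rw [if_neg hk.ne'] at h0
      exact absurd rfl h0
    · change (if k = 0 then fun _ _ _ => 0 else β t (k - 1) :
        RatRips l s → RatRips l s → X → ℝ) u z x ≠ 0 at h0
      rw [if_neg hk.ne'] at h0
      refine (h.near hzw h0).mono ?_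
      have := h.succ (t := t) (k := k - 1) hzw
      rw [Nat.sub_add_cancel hk] at this
      linarith
    · refine (h.near hzw h0).mono ?_
      rw [l1dist_self]
      linarith

variable [TopologicalSpace X] {M : ℕ} {p : ℝ≥0∞} [Fact (1 ≤ p)]

theorem IsWeighted.congr {β β' : RatRips l s → RatRips l s → X → ℝ}
    {L M L' M' : RipsSpace l s X p →L[ℂ] RipsSpace l s X p} (h : IsWeighted β L M) (hβ : β' = β)
    (hL : ∀ ξ, L' ξ = L ξ) (hM : ∀ ξ, M' ξ = M ξ) : IsWeighted β' L' M' := by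
  rwa [hβ, ContinuousLinearMap.ext hL, ContinuousLinearMap.ext hM]

theorem IsFrame.isWeighted_corner {β : ℕ → RatRips l s → RatRips l s → X → ℝ} (hp : p ≠ ⊤)
    (e : ℕ × RatRips l s × ℕ ≃ ℕ) (h : IsFrame β M)
    {V : ℝ≥0 → AmpSpace l s X p →L[ℂ] RipsSpace l s X p}
    {V' : ℝ≥0 → RipsSpace l s X p →L[ℂ] AmpSpace l s X p} {t : ℝ≥0} (hV : V t = synthesis hp e β)
    (hV' : V' t = analysis hp e β) (i : Fin 3) (k : ℕ) :
    IsWeighted (p := p) (cornerWeight β i k)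
      ((cornerLeft hp V i t).comp
        (lp.singleContinuousLinearMap ℂ (fun _ : ℕ => RipsSpace l s X p) p k))
      ((lp.evalCLM ℂ (fun _ : ℕ => RipsSpace l s X p) p k).comp (cornerRight hp V' i t)) := by
  classical
  fin_cases i
  · rcases Nat.eq_zero_or_pos k with rfl | hk
    · refine isWeighted_one.congr rfl (fun ξ => ?_) fun ξ => ?_
      · exact lp.single_apply_self (E := fun _ : ℕ => RipsSpace l s X p) p 0 ξ
      · exact lp.single_apply_self (E := fun _ : ℕ => RipsSpace l s X p) p 0 ξ
    · refine isWeighted_zero.congr (if_neg hk.ne') (fun ξ => ?_) fun ξ => ?_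
      · exact lp.single_apply_ne (E := fun _ : ℕ => RipsSpace l s X p) p k ξ hk.ne
      · exact lp.single_apply_ne (E := fun _ : ℕ => RipsSpace l s X p) p 0 ξ hk.ne'
  · cases k with
    | zero =>
      refine isWeighted_zero.congr rfl (fun ξ => ?_) fun ξ => rfl
      have : shiftLeft hp (lp.single p 0 ξ : AmpSpace l s X p) = 0 := by
        refine lp.ext (funext fun k => ?_)
        exact lp.single_apply_ne (E := fun _ : ℕ => RipsSpace l s X p) p 0 ξ (Nat.succ_ne_zero k)
      change V t (shiftLeft hp (lp.single p 0 ξ : AmpSpace l s X p)) = 0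
      rw [this, map_zero]
    | succ k =>
      refine (h.isWeighted hp e k).congr rfl (fun ξ => ?_) fun ξ => ?_
      · have : shiftLeft hp (lp.single p (k + 1) ξ : AmpSpace l s X p) = lp.single p k ξ := by
          refine lp.ext (funext fun j => ?_)
          rw [shiftLeft_apply]
          by_cases hj : j = k
          · subst hj
            rw [lp.single_apply_self, lp.single_apply_self]
          · rw [lp.single_apply_ne _ _ _ hj, lp.single_apply_ne _ _ _ (by lia)]
        change V t (shiftLeft hp (lp.single p (k + 1) ξ : AmpSpace l s X p)) =
          synthesis hp e β (lp.single p k ξ)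
        rw [hV, this]
      · change V' t ξ k = analysis hp e β ξ k
        rw [hV']
  · refine (h.isWeighted hp e k).congr rfl (fun ξ => ?_) fun ξ => ?_
    · change V t _ = synthesis hp e β _
      rw [hV]
    · change V' t ξ k = analysis hp e β ξ k
      rw [hV']

end Adapted

end LpRoe
end

noncomputable section

/-! ### The swindle maps preserve the obstruction algebra -/

namespace LpRoe

section Sum

variable {E : Type*} [NormedAddCommGroup E] [NormedSpace ℂ E] {p : ℝ≥0∞} [Fact (1 ≤ p)]
  {V : ℝ≥0 → lp (fun _ : ℕ => E) p →L[ℂ] E} {V' : ℝ≥0 → E →L[ℂ] lp (fun _ : ℕ => E) p}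

theorem corner_eq_sum (hp : p ≠ ⊤) (hV : IsUCFamily V) (hV' : IsUCFamily V') (i j : Fin 3)
    (b : uniformlyContinuousFun (E →L[ℂ] E)) (t : ℝ≥0) {n : ℕ} (hn : ∀ k : ℕ, n ≤ k → b.1 (t - k) = 0) :
    corner hp hV hV' i j b t = ∑ k ∈ Finset.range n,
      ((cornerLeft hp V i t).comp (lp.singleContinuousLinearMap ℂ (fun _ : ℕ => E) p k)) *
        b.1 (t - k) * ((lp.evalCLM ℂ (fun _ : ℕ => E) p k).comp (cornerRight hp V' j t)) := by
  refine ContinuousLinearMap.ext fun ξ => ?_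
  rw [corner_apply, sum_apply]
  set η := cornerRight hp V' j t ξ with hη
  have h1 : ampDiag p b.1 t η =
      ∑ k ∈ Finset.range n, lp.single p k (b.1 (t - k) (η k)) := by
    refine lp.ext (funext fun k => ?_)
    rw [ampDiag_apply, lp.coeFn_sum, Finset.sum_apply]
    by_cases hk : k < n
    · rw [Finset.sum_eq_single k, lp.single_apply_self]
      · exact fun m _ hm => lp.single_apply_ne _ _ _ hm.symm
      · exact fun h => absurd (Finset.mem_range.2 hk) h
    · rw [hn k (not_lt.1 hk), Finset.sum_eq_zero]
      · rfl
      · intro m hm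
        refine lp.single_apply_ne _ _ _ ?_
        rintro rfl
        exact hk (Finset.mem_range.1 hm)
  rw [h1, map_sum]
  rfl

end Sum

section Membership

variable {Γ : Type*} [Group Γ] [TopologicalSpace Γ] [DiscreteTopology Γ] {l : ProperLength Γ}
  {s : ℝ} {X : Type*} [TopologicalSpace X] [T2Space X] [MulAction Γ X] [ContinuousConstSMul Γ X]
  {p : ℝ≥0∞} [Fact (1 ≤ p)]

omit [TopologicalSpace Γ] [DiscreteTopology Γ] [TopologicalSpace X] [T2Space X] [MulAction Γ X] [ContinuousConstSMul Γ X] in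
theorem atPoint_entry_sum {ι : Type*} (S : Finset ι)
    (T : ι → RipsSpace l s X p →L[ℂ] RipsSpace l s X p) (u u' : RatRips l s) (x : X) :
    atPoint (entry (∑ k ∈ S, T k) u u') x = ∑ k ∈ S, atPoint (entry (T k) u u') x := by
  classical
  refine ContinuousLinearMap.ext fun v => ?_
  rw [atPoint_apply, entry_apply, sum_apply, sum_apply, lp.coeFn_sum, Finset.sum_apply,
    lp.coeFn_sum, Finset.sum_apply]
  exact Finset.sum_congr rfl fun k _ => by rw [atPoint_apply, entry_apply]

theorem delay_mem_algebraicObstruction {G : OpenSubgroupoid Γ X}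
    {b : BddFun (RipsSpace l s X p →L[ℂ] RipsSpace l s X p)}
    (hb : b ∈ algebraicObstruction l s p G) (τ : ℝ≥0) :
    delay τ b ∈ algebraicObstruction l s p G := by
  obtain ⟨⟨h1, h2, h3, h4⟩, h5, K, hK, hKG, h6⟩ := hb
  refine ⟨⟨delay_mem h1, fun t => h2 _, ?_, ?_⟩, ?_, K, hK, hKG, Set.iUnion_subset fun t => ?_⟩
  · exact (iSup_le fun t => le_iSup (fun t => groupPropagation (b t)) (t - τ)).trans_lt h3
  · exact h4.comp (tendsto_atTop_atTop.2 fun r => ⟨r + τ, fun t ht => le_tsub_of_add_le_right ht⟩)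
  · change b (0 - τ) = 0
    rw [zero_tsub, h5]
  · exact (Set.subset_iUnion (fun t => support (b t)) (t - τ)).trans h6

omit [TopologicalSpace Γ] [DiscreteTopology Γ] [T2Space X] [ContinuousConstSMul Γ X] in
/-- An operator supported in a set of groupoid elements of length at most `s` has `Γ`-propagation at
most `s`. -/
theorem groupPropagation_le_of_support {T : RipsSpace l s X p →L[ℂ] RipsSpace l s X p}
    (hT : T ∈ algebraicRoe l s X p) {K : Set (TransGroupoid Γ X)} (hK : support T ⊆ K)
    (hs : ∀ q ∈ K, (l q.1 : ℝ) ≤ s) : groupPropagation T ≤ (⌊s⌋₊ : ℕ) := by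
  refine groupPropagation_le_iff.2 fun y z hyz g hg h hh => ?_
  obtain ⟨x, hx⟩ := exists_atPoint_ne (hT.2.1.entry_mem y z) hyz
  exact_mod_cast Nat.le_floor (hs _ (hK ⟨y, z, x, g, h, hx, hg, hh, rfl⟩))

variable {K K' : Set (TransGroupoid Γ X)} {β : ℝ≥0 → ℕ → RatRips l s → RatRips l s → X → ℝ}
  {v : ℝ≥0 → ℕ → RatRips l s → X → Γ →₀ ℝ} {C : ℝ} {M : ℕ}
  {V : ℝ≥0 → AmpSpace l s X p →L[ℂ] RipsSpace l s X p}
  {V' : ℝ≥0 → RipsSpace l s X p →L[ℂ] AmpSpace l s X p}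

omit [TopologicalSpace Γ] [DiscreteTopology Γ] [TopologicalSpace X] [T2Space X] [MulAction Γ X] [ContinuousConstSMul Γ X] in
theorem exists_tsub_eq_zero (b : BddFun (RipsSpace l s X p →L[ℂ] RipsSpace l s X p)) (h0 : b 0 = 0)
    (t : ℝ≥0) : ∃ n : ℕ, ∀ k : ℕ, n ≤ k → b (t - k) = 0 := by
  refine ⟨⌈t⌉₊, fun k hk => ?_⟩
  rw [tsub_eq_zero_of_le ((Nat.le_ceil t).trans (by exact_mod_cast hk)), h0]

omit [TopologicalSpace Γ] [DiscreteTopology Γ] [T2Space X] [ContinuousConstSMul Γ X] in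
theorem corner_mem_algebraicRoe (hp : p ≠ ⊤) (e : ℕ × RatRips l s × ℕ ≃ ℕ)
    (hβ : ∀ t, IsFrame (β t) M) (hV : IsUCFamily V) (hV' : IsUCFamily V')
    (hVe : ∀ t, V t = synthesis hp e (β t)) (hVe' : ∀ t, V' t = analysis hp e (β t))
    {b : BddFun (RipsSpace l s X p →L[ℂ] RipsSpace l s X p)}
    (hb : b ∈ uniformlyContinuousFun (RipsSpace l s X p →L[ℂ] RipsSpace l s X p)) (h0 : b 0 = 0)
    (h : ∀ t, b t ∈ algebraicRoe l s X p) (i j : Fin 3) (t : ℝ≥0) :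
    corner hp hV hV' i j ⟨b, hb⟩ t ∈ algebraicRoe l s X p := by
  obtain ⟨n, hn⟩ := exists_tsub_eq_zero b h0 t
  rw [corner_eq_sum hp hV hV' i j ⟨b, hb⟩ t hn]
  exact sum_mem fun k _ => ((hβ t).isWeighted_corner hp e (hVe t) (hVe' t) i k).mem_algebraicRoe hp
    ((hβ t).isWeighted_corner hp e (hVe t) (hVe' t) j k) (h _)

omit [TopologicalSpace Γ] [DiscreteTopology Γ] [T2Space X] [ContinuousConstSMul Γ X] in
theorem exists_of_corner_ne (hp : p ≠ ⊤) (e : ℕ × RatRips l s × ℕ ≃ ℕ)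
    (hβ : ∀ t, IsFrame (β t) M) (hV : IsUCFamily V) (hV' : IsUCFamily V')
    (hVe : ∀ t, V t = synthesis hp e (β t)) (hVe' : ∀ t, V' t = analysis hp e (β t))
    {b : BddFun (RipsSpace l s X p →L[ℂ] RipsSpace l s X p)}
    (hb : b ∈ uniformlyContinuousFun (RipsSpace l s X p →L[ℂ] RipsSpace l s X p)) (h0 : b 0 = 0)
    (h : ∀ t, b t ∈ algebraicRoe l s X p) {i j : Fin 3} {t : ℝ≥0} {u u' : RatRips l s} {x : X}
    (hx : atPoint (entry (corner hp hV hV' i j ⟨b, hb⟩ t) u u') x ≠ 0) :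
    ∃ (k : ℕ) (z w : RatRips l s), cornerWeight (β t) i k u z x ≠ 0 ∧
      cornerWeight (β t) j k u' w x ≠ 0 ∧ atPoint (entry (b (t - k)) z w) x ≠ 0 := by
  obtain ⟨n, hn⟩ := exists_tsub_eq_zero b h0 t
  rw [corner_eq_sum hp hV hV' i j ⟨b, hb⟩ t hn, atPoint_entry_sum] at hx
  obtain ⟨k, -, hk⟩ := Finset.exists_ne_zero_of_sum_ne_zero hx
  exact ⟨k, ((hβ t).isWeighted_corner hp e (hVe t) (hVe' t) i k).exists_of_atPoint_ne hp
    ((hβ t).isWeighted_corner hp e (hVe t) (hVe' t) j k) (h _) hk⟩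

/-- The set of `q⁻¹` for `q ∈ K`. -/
def groupoidInv (K : Set (TransGroupoid Γ X)) : Set (TransGroupoid Γ X) :=
  (fun q => (q.1⁻¹, q.1 • q.2)) '' K

omit [T2Space X] in
theorem isCompact_groupoidInv (hK : IsCompact K) : IsCompact (groupoidInv K) :=
  hK.image (continuous_prod_of_discrete_left.2 fun g => show Continuous fun x : X => (g⁻¹, g • x) from
    continuous_const.prodMk (continuous_const_smul g))

/-- The swindle maps preserve `ℂ_{L,0}[G; s]`. The supports grow from `K` at most to `K'⁻¹ K K'`. The
entries at time `t` connect points in the directions of two vectors of length at least `t` whose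
distance is at most `(t - k) d(z, w)` plus a constant, with `d(z, w)` small if `t - k` is large. So
the Rips-propagation tends to `0`, uniformly in `k`. -/
theorem corner_mem_algebraicObstruction (hp : p ≠ ⊤) (e : ℕ × RatRips l s × ℕ ≃ ℕ)
    (hβ : ∀ t, IsFrame (β t) M) (hV : IsUCFamily V) (hV' : IsUCFamily V')
    (hVe : ∀ t, V t = synthesis hp e (β t)) (hVe' : ∀ t, V' t = analysis hp e (β t))
    {G : OpenSubgroupoid Γ X} (hG : ∀ q ∈ G.carrier, (l q.1 : ℝ) ≤ s)
    (hK : IsSymmetric K) (hKc : IsCompact K) (hK'c : IsCompact K') (hK'G : K' ⊆ G.carrier)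
    (hA : IsAdapted K K' β v C) {b : BddFun (RipsSpace l s X p →L[ℂ] RipsSpace l s X p)}
    (hb : b ∈ uniformlyContinuousFun (RipsSpace l s X p →L[ℂ] RipsSpace l s X p))
    (hbG : b ∈ algebraicObstruction l s p G) (hbK : ∀ t, support (b t) ⊆ K) (i j : Fin 3) :
    corner hp hV hV' i j ⟨b, hb⟩ ∈ algebraicObstruction l s p G := by
  obtain ⟨⟨h1, h2, h3, h4⟩, h5, -⟩ := hbG
  have hroe := corner_mem_algebraicRoe hp e hβ hV hV' hVe hVe' hb h5 h2 i j
  set K'' := groupoidMul (groupoidMul (groupoidInv K') K) K' with hK''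
  have hK''c : IsCompact K'' :=
    isCompact_groupoidMul (isCompact_groupoidMul (isCompact_groupoidInv hK'c) hKc) hK'c
  have hK''G : K'' ⊆ G.carrier := by
    rintro q ⟨h, g, x, ⟨a, c, y, ⟨⟨r, w⟩, hr, hrw⟩, hc, hac⟩, hg, rfl⟩
    refine G.mul_mem _ _ _ ?_ (hK'G hg)
    rw [hac]
    refine G.mul_mem _ _ _ ?_ (hK'G (hA.subset hc))
    rw [← hrw]
    exact G.inv_mem _ _ (hK'G hr)
  have hsupp : ∀ t, support (corner hp hV hV' i j ⟨b, hb⟩ t) ⊆ K'' := by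
    rintro t q ⟨u, u', x, g, g', hx, hg, hg', rfl⟩
    obtain ⟨k, z, w, e1, e2, e3⟩ := exists_of_corner_ne hp e hβ hV hV' hVe hVe' hb h5 h2 hx
    have hzw := related_of_support_subset (hbK _) e3
    obtain ⟨h, hh, e4⟩ := hA.cornerWeight_vertex hK i hzw e1 hg
    obtain ⟨h', hh', e5⟩ := hA.cornerWeight_vertex hK j (hzw.symm hK) e2 hg'
    refine ⟨g * h'⁻¹, h' * g'⁻¹, g' • x, ⟨g * h⁻¹, h * h'⁻¹, h' • x, ?_, hzw h hh h' hh', ?_⟩, e5,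
      ?_⟩
    · refine ⟨(h * g⁻¹, g • x), e4, ?_⟩
      simp [smul_smul]
    · simp [smul_smul, mul_assoc]
    · simp [mul_assoc]
  refine ⟨⟨uniformContinuous_compress _ _ _, hroe, ?_, ?_⟩, ?_, K'', hK''c, hK''G,
    Set.iUnion_subset hsupp⟩
  · refine (iSup_le fun t => groupPropagation_le_of_support (hroe t) (hsupp t) fun q hq =>
      hG q (hK''G hq)).trans_lt (ENat.natCast_lt_top _)
  · refine ENNReal.tendsto_nhds_zero.2 fun ε hε => ?_
    obtain ⟨ε', hε', hεε⟩ := ENNReal.lt_iff_exists_nnreal_btwn.1 hε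
    have hε0 : (0 : ℝ) < ε' := by exact_mod_cast hε'
    obtain ⟨T, hT⟩ := eventually_atTop.1
      (ENNReal.tendsto_nhds_zero.1 h4 (ENNReal.ofReal (ε' / 8)) (by simpa using hε0))
    have hC := hA.nonneg
    -- beyond this time `2 * (2 * (2 * C) + D) ≤ ε' * (t - 2 * C)` for `D = 2 * T + ε' / 8 * t`, the
    -- estimate needed in `Near.dist_le` with error `2 * C`
    filter_upwards [eventually_gt_atTop
      (Real.toNNReal (2 * C + (8 * C + 4 * T + 2 * C * ε') * 2 / ε'))] with t ht
    have ht1 : 2 * C + (8 * C + 4 * T + 2 * C * ε') * 2 / ε' < t :=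
      (Real.toNNReal_lt_iff_lt_coe (by positivity)).1 ht
    have ht2 : 2 * C < t := lt_of_le_of_lt (le_add_of_nonneg_right (by positivity)) ht1
    have ht3 : (8 * C + 4 * T + 2 * C * ε') * 2 < ε' * t := by
      have : (8 * C + 4 * T + 2 * C * ε') * 2 / ε' < t :=
        lt_of_le_of_lt (le_add_of_nonneg_left (by positivity)) ht1
      rw [div_lt_iff₀ hε0] at this
      linarith
    refine le_trans (ripsPropagation_le_iff.2 fun u u' hne => ?_) hεε.le
    obtain ⟨x, hx⟩ := exists_atPoint_ne ((hroe t).2.1.entry_mem u u') hne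
    obtain ⟨k, z, w, e1, e2, e3⟩ := exists_of_corner_ne hp e hβ hV hV' hVe hVe' hb h5 h2 hx
    have hzw := related_of_support_subset (hbK _) e3
    -- either `t - k` is bounded, or the entry `(z, w)` of `b (t - k)` has small propagation
    have e4 : ((t - k : ℝ≥0) : ℝ) * dist z.point w.point ≤ 2 * T + ε' / 8 * t := by
      have e5 : ((t - k : ℝ≥0) : ℝ) ≤ t := by exact_mod_cast tsub_le_self
      rcases le_total T (t - k) with hTk | hTk
      · have e6 := ripsPropagation_le_iff.1 (hT _ hTk) z w fun h0 => e3 (by rw [h0, atPoint_zero])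
        rw [edist_le_ofReal (by positivity)] at e6
        calc _ ≤ (t : ℝ) * (ε' / 8) := mul_le_mul e5 e6 dist_nonneg t.2
          _ ≤ _ := by linarith [T.2, mul_comm (t : ℝ) (ε' / 8)]
      · have e6 : ((t - k : ℝ≥0) : ℝ) ≤ T := by exact_mod_cast hTk
        calc _ ≤ (T : ℝ) * 2 := mul_le_mul e6 (Rips.dist_le_two _ _) dist_nonneg T.2
          _ ≤ _ := by
            have : 0 ≤ (ε' : ℝ) / 8 * t := by positivity
            linarith
    have e5 := Near.dist_le (hA.cornerWeight_near i hzw e1)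
      (hA.cornerWeight_near j (hzw.symm hK) e2) ((hA.pair hzw).trans e4) (hA.mass hzw) ht2
    have e6 : dist u.point u'.point ≤ ε' := by
      refine e5.trans ?_
      rw [div_le_iff₀ (by linarith)]
      have : (0 : ℝ) ≤ ε' * t := by positivity
      have : (0 : ℝ) ≤ T := T.2
      linarith
    rw [edist_nndist]
    exact_mod_cast e6
  · rw [corner_eq_sum hp hV hV' i j ⟨b, hb⟩ 0 (n := 0) fun k _ => by
      change b (0 - k) = 0
      rw [zero_tsub, h5]]
    rfl

end Membership

end LpRoe
end

noncomputable section

/-! ### A compactly supported function invariant under a compact set of groupoid elements -/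

namespace LpRoe

section Saturate

variable {Γ X : Type*} [Group Γ] [MulAction Γ X]

/-- The largest value of `min (f₀ q₁) … (f₀ qₘ)` over the factorizations `(γ, x) = q₁ ⋯ qₘ` into at
most `n + 1` elements, whose partial products on the right have their group component in `B`. -/
def saturate (B : Finset Γ) (f₀ : Γ → X → ℝ≥0) : ℕ → Γ → X → ℝ≥0
  | 0 => f₀
  | n + 1 => fun γ x =>
    saturate B f₀ n γ x ⊔ B.sup fun δ => f₀ (γ * δ⁻¹) (δ • x) ⊓ saturate B f₀ n δ x

variable {B : Finset Γ} {f₀ : Γ → X → ℝ≥0}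

theorem saturate_le_succ (n : ℕ) (γ : Γ) (x : X) :
    saturate B f₀ n γ x ≤ saturate B f₀ (n + 1) γ x := le_sup_left

theorem inf_saturate_le_succ (n : ℕ) (γ : Γ) {δ : Γ} (hδ : δ ∈ B) (x : X) :
    f₀ (γ * δ⁻¹) (δ • x) ⊓ saturate B f₀ n δ x ≤ saturate B f₀ (n + 1) γ x :=
  le_sup_of_le_right (Finset.le_sup
    (f := fun δ => f₀ (γ * δ⁻¹) (δ • x) ⊓ saturate B f₀ n δ x) hδ)

theorem le_saturate_succ_iff {n : ℕ} {γ : Γ} {x : X} {c : ℝ≥0} (hc : 0 < c) :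
    c ≤ saturate B f₀ (n + 1) γ x ↔ c ≤ saturate B f₀ n γ x ∨
      ∃ δ ∈ B, c ≤ f₀ (γ * δ⁻¹) (δ • x) ∧ c ≤ saturate B f₀ n δ x := by
  change c ≤ saturate B f₀ n γ x ⊔ _ ↔ _
  rw [le_sup_iff, Finset.le_sup_iff (by simpa using hc)]
  simp only [le_inf_iff]

theorem continuous_saturate [TopologicalSpace X] [ContinuousConstSMul Γ X]
    (h : ∀ γ, Continuous (f₀ γ)) (n : ℕ) : ∀ γ, Continuous (saturate B f₀ n γ) := by
  induction n with
  | zero => exact h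
  | succ n ih =>
    intro γ
    refine (ih γ).sup (Continuous.finset_sup_apply fun δ _ => ?_)
    exact ((h _).comp (continuous_const_smul δ)).inf (ih δ)

theorem saturate_le_one (h : ∀ γ x, f₀ γ x ≤ 1) (n : ℕ) : ∀ γ x, saturate B f₀ n γ x ≤ 1 := by
  induction n with
  | zero => exact h
  | succ n ih =>
    intro γ x
    exact sup_le (ih γ x) (Finset.sup_le fun δ _ => inf_le_right.trans (ih δ x))

/-- For each threshold, the set where `saturate B f₀ n` reaches it increases with `n` inside the
finite set `B`, and remains constant once it repeats; so the iteration is stationary after `card B`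
steps. -/
theorem saturate_stable (hB : ∀ n γ x, saturate B f₀ n γ x ≠ 0 → γ ∈ B) (γ : Γ) (x : X) :
    saturate B f₀ (B.card + 1) γ x = saturate B f₀ B.card γ x := by
  classical
  refine le_antisymm ?_ (saturate_le_succ _ _ _)
  rcases eq_or_lt_of_le (zero_le (a := saturate B f₀ (B.card + 1) γ x)) with h0 | h0
  · rw [← h0]
    exact zero_le
  set c := saturate B f₀ (B.card + 1) γ x with hc
  let S : ℕ → Finset Γ := fun n => B.filter fun γ => c ≤ saturate B f₀ n γ x
  have hS : ∀ n γ, γ ∈ S n ↔ c ≤ saturate B f₀ n γ x := fun n γ =>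
    Finset.mem_filter.trans (and_iff_right_of_imp fun h => hB n γ x (h0.trans_le h).ne')
  have hmono : ∀ n, S n ⊆ S (n + 1) := fun n γ hγ =>
    (hS _ _).2 (((hS _ _).1 hγ).trans (saturate_le_succ _ _ _))
  have hstab : ∀ n, S n = S (n + 1) → S (n + 1) = S (n + 2) := fun n h => by
    refine (hmono (n + 1)).antisymm fun γ hγ => ?_
    rcases (le_saturate_succ_iff h0).1 ((hS _ _).1 hγ) with h1 | ⟨δ, hδ, h1, h2⟩
    · exact (hS _ _).2 h1
    · refine (hS _ _).2 ((le_saturate_succ_iff h0).2 (Or.inr ⟨δ, hδ, h1, ?_⟩))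
      rw [← hS, h, hS]
      exact h2
  have hcard : (S (B.card + 1)).card = (S B.card).card := by
    refine Nat.stabilises_of_monotone (f := fun n => (S n).card) (monotone_nat_of_le_succ fun n =>
      Finset.card_le_card (hmono n)) (fun n => Finset.card_le_card (Finset.filter_subset _ _))
      (fun n h => ?_) (Nat.le_succ _)
    exact congrArg Finset.card (hstab n (Finset.eq_of_subset_of_card_le (hmono n) h.ge))
  have := Finset.eq_of_subset_of_card_le (hmono B.card) hcard.le
  rw [← hS, this, hS]

end Saturate

section Invariant

variable {Γ : Type*} [Group Γ] [TopologicalSpace Γ] [DiscreteTopology Γ] {l : ProperLength Γ}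
  {s : ℝ} {X : Type*} [TopologicalSpace X] [CompactSpace X] [T2Space X] [MulAction Γ X]
  [ContinuousConstSMul Γ X]

omit [CompactSpace X] [T2Space X] in
/-- Every compact subset of the groupoid is contained in a compact symmetric one. -/
theorem exists_isSymmetric (G : OpenSubgroupoid Γ X) {K : Set (TransGroupoid Γ X)}
    (hK : IsCompact K) (hKG : K ⊆ G.carrier) :
    ∃ K', K ⊆ K' ∧ IsCompact K' ∧ K' ⊆ G.carrier ∧ IsSymmetric K' := by
  have hc : Continuous fun q : TransGroupoid Γ X => q.1 • q.2 :=
    continuous_prod_of_discrete_left.2 fun g => continuous_const_smul g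
  refine ⟨K ∪ groupoidInv K ∪ ((fun q => (1, q.2)) '' K ∪ (fun q => (1, q.1 • q.2)) '' K),
    fun q hq => Or.inl (Or.inl hq), ?_, ?_, ?_, ?_⟩
  · exact (hK.union (isCompact_groupoidInv hK)).union
      ((hK.image (continuous_const.prodMk continuous_snd)).union
        (hK.image (continuous_const.prodMk hc)))
  · rintro q ((h | ⟨⟨g, x⟩, h, rfl⟩) | (⟨⟨g, x⟩, h, rfl⟩ | ⟨⟨g, x⟩, h, rfl⟩))
    · exact hKG h
    · exact G.inv_mem _ _ (hKG h)
    · exact G.source_mem g x (hKG h)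
    · exact G.range_mem g x (hKG h)
  · rintro g x ((h | ⟨⟨k, y⟩, h, hq⟩) | (⟨⟨k, y⟩, h, hq⟩ | ⟨⟨k, y⟩, h, hq⟩))
    · exact Or.inl (Or.inr ⟨_, h, rfl⟩)
    · obtain ⟨rfl, rfl⟩ := Prod.ext_iff.1 hq
      refine Or.inl (Or.inl ?_)
      simpa using h
    · obtain ⟨rfl, rfl⟩ := Prod.ext_iff.1 hq
      refine Or.inr (Or.inl ⟨_, h, ?_⟩)
      simp
    · obtain ⟨rfl, rfl⟩ := Prod.ext_iff.1 hq
      refine Or.inr (Or.inr ⟨_, h, ?_⟩)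
      simp
  · rintro g x ((h | ⟨⟨k, y⟩, h, hq⟩) | (⟨⟨k, y⟩, h, hq⟩ | ⟨⟨k, y⟩, h, hq⟩))
    · exact Or.inr (Or.inl ⟨_, h, rfl⟩)
    · obtain ⟨rfl, rfl⟩ := Prod.ext_iff.1 hq
      exact Or.inr (Or.inr ⟨_, h, rfl⟩)
    · obtain ⟨rfl, rfl⟩ := Prod.ext_iff.1 hq
      exact Or.inr (Or.inl ⟨_, h, rfl⟩)
    · obtain ⟨rfl, rfl⟩ := Prod.ext_iff.1 hq
      exact Or.inr (Or.inr ⟨_, h, rfl⟩)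

/-- A continuous function `f` on the groupoid that is one on `K`, supported in the compact set
`K'`, and invariant under left multiplication by elements of `K`. -/
structure IsInvariantBump (K K' : Set (TransGroupoid Γ X)) (f : Γ → X → ℝ≥0) : Prop where
  continuous : ∀ γ, Continuous (f γ)
  le_one : ∀ γ x, f γ x ≤ 1
  mem_of_ne : ∀ γ x, f γ x ≠ 0 → (γ, x) ∈ K'
  eq_one : ∀ γ x, (γ, x) ∈ K → f γ x = 1
  invariant : ∀ η δ x, (η, δ • x) ∈ K → f (η * δ) x = f δ x

/-- An invariant bump function is obtained by saturating a function `f₀` that is one on `K`: a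
further factor in `K` does not lower the minimum over a factorization, and `K` is symmetric. The
number of factors stays bounded because only finitely many group elements have length at most `s`,
so the support remains compact. -/
theorem exists_isInvariantBump {G : OpenSubgroupoid Γ X} (hG : ∀ q ∈ G.carrier, (l q.1 : ℝ) ≤ s)
    {K : Set (TransGroupoid Γ X)} (hKc : IsCompact K) (hKG : K ⊆ G.carrier) (hK : IsSymmetric K) :
    ∃ (K' : Set (TransGroupoid Γ X)) (f : Γ → X → ℝ≥0), IsCompact K' ∧ K' ⊆ G.carrier ∧
      IsInvariantBump K K' f := by
  classical
  have hsec : ∀ γ : Γ, Continuous fun x : X => (γ, x) := fun γ => continuous_const.prodMk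
    continuous_id
  have hu : ∀ γ, ∃ f : C(X, ℝ), Set.EqOn f 1 ((fun x => (γ, x)) ⁻¹' K) ∧ IsCompact (tsupport f) ∧
      tsupport f ⊆ (fun x => (γ, x)) ⁻¹' G.carrier ∧ ∀ x, f x ∈ Set.Icc (0 : ℝ) 1 := fun γ =>
    exists_continuousMap_one_of_isCompact_subset_isOpen (hKc.isClosed.preimage (hsec γ)).isCompact
      (G.isOpen.preimage (hsec γ)) fun x hx => hKG hx
  choose u hu1 hu2 hu3 hu4 using hu
  set B : Finset Γ := (l.finite_ball_real s).toFinset with hBdef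
  have hB : ∀ γ, γ ∈ B ↔ (l γ : ℝ) ≤ s := fun γ => Set.Finite.mem_toFinset _
  let f₀ : Γ → X → ℝ≥0 := fun γ x => (u γ x).toNNReal
  have hf₀c : ∀ γ, Continuous (f₀ γ) := fun γ => continuous_real_toNNReal.comp (u γ).continuous
  have hf₀1 : ∀ γ x, f₀ γ x ≤ 1 := fun γ x => Real.toNNReal_le_one.2 (hu4 γ x).2
  let K₀ : Set (TransGroupoid Γ X) := ⋃ γ ∈ B, (fun x => (γ, x)) '' tsupport (u γ)
  have hK₀c : IsCompact K₀ := B.isCompact_biUnion fun γ _ => (hu2 γ).image (hsec γ)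
  have hK₀G : K₀ ⊆ G.carrier := by
    refine Set.iUnion₂_subset fun γ _ => ?_
    rintro q ⟨x, hx, rfl⟩
    exact hu3 γ hx
  have hf₀ : ∀ γ x, f₀ γ x ≠ 0 → (γ, x) ∈ K₀ := fun γ x h => by
    have hx : x ∈ tsupport (u γ) := by
      refine subset_tsupport _ fun h0 => h ?_
      change (u γ x).toNNReal = 0
      rw [h0, Real.toNNReal_zero]
    exact Set.mem_iUnion₂.2 ⟨γ, (hB γ).2 (hG _ (hu3 γ hx)), x, hx, rfl⟩
  have hsupp : ∀ n, ∃ K', IsCompact K' ∧ K' ⊆ G.carrier ∧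
      ∀ γ x, saturate B f₀ n γ x ≠ 0 → (γ, x) ∈ K' := fun n => by
    induction n with
    | zero => exact ⟨K₀, hK₀c, hK₀G, hf₀⟩
    | succ n ih =>
      obtain ⟨K', h1, h2, h3⟩ := ih
      refine ⟨K' ∪ groupoidMul K₀ K', h1.union (isCompact_groupoidMul hK₀c h1),
        Set.union_subset h2 ?_, fun γ x h => ?_⟩
      · rintro q ⟨h, g, x, ha, hb, rfl⟩
        exact G.mul_mem h g x (hK₀G ha) (h2 hb)
      · rcases (le_saturate_succ_iff (pos_iff_ne_zero.2 h)).1 le_rfl with h4 | ⟨δ, -, h4, h5⟩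
        · exact Or.inl (h3 γ x ((pos_iff_ne_zero.2 h).trans_le h4).ne')
        · refine Or.inr ⟨γ * δ⁻¹, δ, x, hf₀ _ _ ((pos_iff_ne_zero.2 h).trans_le h4).ne',
            h3 _ _ ((pos_iff_ne_zero.2 h).trans_le h5).ne', ?_⟩
          rw [inv_mul_cancel_right]
  have hmemB : ∀ n γ x, saturate B f₀ n γ x ≠ 0 → γ ∈ B := fun n γ x h => by
    obtain ⟨K', -, h2, h3⟩ := hsupp n
    exact (hB γ).2 (hG _ (h2 (h3 γ x h)))
  have hone : ∀ γ x, (γ, x) ∈ K → f₀ γ x = 1 := fun γ x h => by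
    change (u γ x).toNNReal = 1
    rw [hu1 γ h, Pi.one_apply, Real.toNNReal_one]
  have hle : ∀ η δ x, (η, δ • x) ∈ K →
      saturate B f₀ B.card δ x ≤ saturate B f₀ B.card (η * δ) x := fun η δ x h => by
    by_cases h0 : saturate B f₀ B.card δ x = 0
    · rw [h0]
      exact zero_le
    rw [← saturate_stable hmemB (η * δ) x]
    refine le_trans (le_inf ?_ le_rfl) (inf_saturate_le_succ _ (η * δ) (hmemB _ _ _ h0) x)
    rw [mul_inv_cancel_right, hone _ _ h]
    exact saturate_le_one hf₀1 _ _ _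
  obtain ⟨K', h1, h2, h3⟩ := hsupp B.card
  refine ⟨K', saturate B f₀ B.card, h1, h2, continuous_saturate hf₀c _, saturate_le_one hf₀1 _, h3,
    fun γ x h => ?_, fun η δ x h => ?_⟩
  · refine (saturate_le_one hf₀1 _ _ _).antisymm ?_
    have hmono := monotone_nat_of_le_succ (f := fun n => saturate B f₀ n γ x)
      fun n => saturate_le_succ n γ x
    rw [← hone γ x h]
    exact hmono (Nat.zero_le B.card)
  · refine (hle η δ x h).antisymm' ?_
    have h4 := hle η⁻¹ (η * δ) x (by
      rw [mul_smul]
      exact hK.inv_mem _ _ h)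
    rwa [inv_mul_cancel_left] at h4

end Invariant

end LpRoe
end

noncomputable section

/-! ### Rounding a vector to nearby lattice points -/

namespace LpRoe

section Tent

/-- The tent function, supported in `[-1, 1]`. -/
def tent (r : ℝ) : ℝ := max 0 (1 - |r|)

theorem tent_nonneg (r : ℝ) : 0 ≤ tent r := le_max_left _ _

theorem tent_le_one (r : ℝ) : tent r ≤ 1 := max_le zero_le_one (by linarith [abs_nonneg r])

theorem tent_zero : tent 0 = 1 := by simp [tent]

theorem abs_lt_one_of_tent_ne {r : ℝ} (h : tent r ≠ 0) : |r| < 1 := by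
  by_contra h'
  exact h (max_eq_left (by linarith))

theorem abs_tent_sub_le (a b : ℝ) : |tent a - tent b| ≤ |a - b| := by
  refine (abs_max_sub_max_le_max _ _ _ _).trans ?_
  rw [sub_self, abs_zero, max_eq_right (abs_nonneg _)]
  have : 1 - |a| - (1 - |b|) = |b| - |a| := by ring
  rw [this, abs_sub_comm a b]
  exact abs_abs_sub_abs_le _ _

theorem tent_floor_add {r : ℝ} (hr : 0 ≤ r) :
    tent (r - (⌊r⌋₊ : ℕ)) + tent (r - ((⌊r⌋₊ + 1 : ℕ) : ℝ)) = 1 := by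
  have h1 := Nat.floor_le hr
  have h2 := (Nat.lt_floor_add_one r).le
  push_cast
  rw [tent, tent, abs_of_nonneg (by linarith), abs_of_nonpos (by linarith),
    max_eq_right (by linarith), max_eq_right (by linarith)]
  ring

theorem abs_prod_sub_prod_le {ι : Type*} (s : Finset ι) {a b : ι → ℝ} (ha : ∀ i, 0 ≤ a i)
    (ha' : ∀ i, a i ≤ 1) (hb : ∀ i, 0 ≤ b i) (hb' : ∀ i, b i ≤ 1) :
    |∏ i ∈ s, a i - ∏ i ∈ s, b i| ≤ ∑ i ∈ s, |a i - b i| := by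
  classical
  induction s using Finset.induction_on with
  | empty => simp
  | insert i s hi ih =>
    rw [Finset.prod_insert hi, Finset.prod_insert hi, Finset.sum_insert hi]
    have e : a i * ∏ i ∈ s, a i - b i * ∏ i ∈ s, b i =
        (a i - b i) * ∏ i ∈ s, a i + b i * (∏ i ∈ s, a i - ∏ i ∈ s, b i) := by ring
    rw [e]
    refine (abs_add_le _ _).trans (add_le_add ?_ ?_)
    · rw [abs_mul]
      refine mul_le_of_le_one_right (abs_nonneg _) ?_
      rw [abs_of_nonneg (Finset.prod_nonneg fun i _ => ha i)]
      exact Finset.prod_le_one (fun i _ => ha i) fun i _ => ha' i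
    · rw [abs_mul, abs_of_nonneg (hb i)]
      exact (mul_le_of_le_one_left (abs_nonneg _) (hb' i)).trans ih

end Tent

section Lattice

variable {Γ : Type*}

/-- The weight of the lattice point `y` in the vector `v`: the product of the tent functions of the
differences of coordinates. -/
def latticeWeight (v : Γ →₀ ℝ) (y : Γ →₀ ℕ) : ℝ := ∏ᶠ g, tent (v g - y g)

theorem latticeWeight_eq_prod {v : Γ →₀ ℝ} {y : Γ →₀ ℕ} {B : Finset Γ} (hv : v.support ⊆ B)
    (hy : y.support ⊆ B) : latticeWeight v y = ∏ g ∈ B, tent (v g - y g) := by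
  refine finprod_eq_prod_of_mulSupport_subset _ fun g hg => ?_
  by_contra h
  refine hg ?_
  change tent (v g - y g) = 1
  rw [Finsupp.notMem_support_iff.1 fun h' => h (hv h'),
    Finsupp.notMem_support_iff.1 fun h' => h (hy h'), Nat.cast_zero, sub_zero, tent_zero]

theorem latticeWeight_nonneg (v : Γ →₀ ℝ) (y : Γ →₀ ℕ) : 0 ≤ latticeWeight v y := by
  classical
  rw [latticeWeight_eq_prod Finset.subset_union_left (Finset.subset_union_right (s₁ := v.support))]
  exact Finset.prod_nonneg fun g _ => tent_nonneg _

theorem abs_lt_one_of_latticeWeight_ne {v : Γ →₀ ℝ} {y : Γ →₀ ℕ} (h : latticeWeight v y ≠ 0)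
    (g : Γ) : |v g - y g| < 1 := by
  classical
  rw [latticeWeight_eq_prod (Finset.subset_union_left.trans (Finset.subset_insert g _))
    ((Finset.subset_union_right (s₁ := v.support)).trans (Finset.subset_insert g _))] at h
  exact abs_lt_one_of_tent_ne (Finset.prod_ne_zero_iff.1 h g (Finset.mem_insert_self _ _))

theorem abs_latticeWeight_sub_le (v v' : Γ →₀ ℝ) (y : Γ →₀ ℕ) :
    |latticeWeight v y - latticeWeight v' y| ≤ l1dist v v' := by
  classical
  set B := v.support ∪ (v'.support ∪ y.support)
  have h1 : v.support ⊆ B := Finset.subset_union_left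
  have h2 : v'.support ⊆ B := Finset.subset_union_left.trans Finset.subset_union_right
  have h3 : y.support ⊆ B := Finset.subset_union_right.trans Finset.subset_union_right
  rw [latticeWeight_eq_prod h1 h3, latticeWeight_eq_prod h2 h3, l1dist_eq h1 h2]
  refine (abs_prod_sub_prod_le _ (fun _ => tent_nonneg _) (fun _ => tent_le_one _)
    (fun _ => tent_nonneg _) fun _ => tent_le_one _).trans (Finset.sum_le_sum fun g _ => ?_)
  refine (abs_tent_sub_le _ _).trans_eq ?_
  rw [sub_sub_sub_cancel_right]

/-- The lattice points whose coordinates are those of `v`, rounded up or down. -/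
def latticeBox (v : Γ →₀ ℝ) : Finset (Γ →₀ ℕ) := v.support.finsupp fun g => {⌊v g⌋₊, ⌊v g⌋₊ + 1}

theorem card_latticeBox_le {v : Γ →₀ ℝ} {R : ℕ} (h : v.support.card ≤ R) :
    (latticeBox v).card ≤ 2 ^ R := by
  rw [latticeBox, Finset.card_finsupp]
  exact (Finset.prod_le_pow_card _ _ 2 fun g _ => Finset.card_le_two).trans
    (Nat.pow_le_pow_right two_pos h)

theorem mem_latticeBox_of_ne {v : Γ →₀ ℝ} (hv : ∀ g, 0 ≤ v g) {y : Γ →₀ ℕ}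
    (h : latticeWeight v y ≠ 0) : y ∈ latticeBox v := by
  have h1 := abs_lt_one_of_latticeWeight_ne h
  refine Finset.mem_finsupp_iff.2 ⟨fun g hg => ?_, fun g _ => ?_⟩
  · rw [Finsupp.mem_support_iff] at hg ⊢
    intro h0
    have h2 := h1 g
    rw [h0, zero_sub, abs_neg, Nat.abs_cast] at h2
    exact hg (Nat.lt_one_iff.1 (by exact_mod_cast h2))
  · have h2 := abs_lt.1 (h1 g)
    have h3 : ⌊v g⌋₊ ≤ y g := by
      rw [← Nat.lt_add_one_iff, Nat.floor_lt (hv g)]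
      push_cast
      linarith
    have h4 : y g < ⌊v g⌋₊ + 2 := by
      have := Nat.lt_floor_add_one (v g)
      have h5 : (y g : ℝ) < (⌊v g⌋₊ + 2 : ℕ) := by
        push_cast
        linarith
      exact_mod_cast h5
    rw [Finset.mem_insert, Finset.mem_singleton]
    lia

theorem support_subset_of_mem_latticeBox {v : Γ →₀ ℝ} {y : Γ →₀ ℕ} (h : y ∈ latticeBox v) :
    y.support ⊆ v.support := (Finset.mem_finsupp_iff.1 h).1

theorem sum_latticeBox {v : Γ →₀ ℝ} (hv : ∀ g, 0 ≤ v g) :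
    ∑ y ∈ latticeBox v, latticeWeight v y = 1 := by
  classical
  have h1 : ∏ g ∈ v.support, ∑ j ∈ ({⌊v g⌋₊, ⌊v g⌋₊ + 1} : Finset ℕ), tent (v g - j) = 1 := by
    refine Finset.prod_eq_one fun g _ => ?_
    rw [Finset.sum_pair (Nat.succ_ne_self _).symm]
    exact tent_floor_add (hv g)
  rw [Finset.prod_sum] at h1
  rw [← h1, latticeBox, Finset.finsupp, Finset.sum_map]
  refine Finset.sum_congr rfl fun q _ => ?_
  rw [latticeWeight_eq_prod subset_rfl]
  · rw [← Finset.prod_attach]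
    refine Finset.prod_congr rfl fun g _ => ?_
    rw [Function.Embedding.coeFn_mk, Finsupp.indicator_of_mem g.2]
  · exact Finsupp.support_indicator_subset _ _

theorem latticeWeight_equivMapDomain (e : Γ ≃ Γ) (v : Γ →₀ ℝ) (y : Γ →₀ ℕ) :
    latticeWeight (Finsupp.equivMapDomain e v) (Finsupp.equivMapDomain e y) = latticeWeight v y :=
  finprod_comp_equiv e.symm (f := fun g => tent (v g - y g))

variable [Group Γ] {l : ProperLength Γ} {s : ℝ}

open scoped Classical in
/-- The point of `Z_s` in the direction of `y`, or `z` if there is none. -/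
def direction (y : Γ →₀ ℕ) (z : RatRips l s) : RatRips l s :=
  if h : ∃ u : RatRips l s, ∃ a : ℝ, 0 < a ∧ ∀ g, (y g : ℝ) = a * u.point.coord g then h.choose else z

theorem direction_unique {y : Γ →₀ ℕ} {u u' : RatRips l s} {a a' : ℝ} (ha : 0 < a)
    (h : ∀ g, (y g : ℝ) = a * u.point.coord g) (h' : ∀ g, (y g : ℝ) = a' * u'.point.coord g) :
    u = u' := by
  have h1 : a • u.point.coord = a' • u'.point.coord := Finsupp.ext fun g => by
    rw [Finsupp.smul_apply, Finsupp.smul_apply, smul_eq_mul, smul_eq_mul, ← h, ← h']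
  have h2 : a = a' := by rw [← Rips.smul_sum a u.point, h1, Rips.smul_sum]
  refine RatRips.ext (Rips.ext (Finsupp.ext fun g => ?_))
  have h3 := (h g).symm.trans (h' g)
  rw [← h2] at h3
  exact mul_left_cancel₀ ha.ne' h3

theorem direction_eq {y : Γ →₀ ℕ} {u : RatRips l s} {a : ℝ} (ha : 0 < a)
    (h : ∀ g, (y g : ℝ) = a * u.point.coord g) (z : RatRips l s) : direction y z = u := by
  have hex : ∃ u : RatRips l s, ∃ a : ℝ, 0 < a ∧ ∀ g, (y g : ℝ) = a * u.point.coord g := ⟨u, a, ha, h⟩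
  rw [direction, dif_pos hex]
  obtain ⟨a', ha', h'⟩ := hex.choose_spec
  exact direction_unique ha' h' h

theorem direction_cases (y : Γ →₀ ℕ) (z : RatRips l s) :
    (∃ a : ℝ, 0 < a ∧ ∀ g, (y g : ℝ) = a * (direction y z).point.coord g) ∨ direction y z = z := by
  by_cases hex : ∃ u : RatRips l s, ∃ a : ℝ, 0 < a ∧ ∀ g, (y g : ℝ) = a * u.point.coord g
  · obtain ⟨u, a, ha, h⟩ := hex
    rw [direction_eq ha h]
    exact Or.inl ⟨a, ha, h⟩
  · exact Or.inr (dif_neg hex)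

theorem direction_translate (g : Γ) (y : Γ →₀ ℕ) (z : RatRips l s) :
    direction (Finsupp.equivMapDomain (Equiv.mulRight g) y) (RatRips.translate g z) =
      RatRips.translate g (direction y z) := by
  by_cases hex : ∃ u : RatRips l s, ∃ a : ℝ, 0 < a ∧ ∀ g, (y g : ℝ) = a * u.point.coord g
  · obtain ⟨u, a, ha, h⟩ := hex
    rw [← direction_eq ha h z] at h
    exact direction_eq (y := Finsupp.equivMapDomain (Equiv.mulRight g) y)
      (u := RatRips.translate g (direction y z)) ha (fun k => h (k * g⁻¹)) _
  · have h1 : direction y z = z := dif_neg hex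
    rw [h1]
    refine dif_neg ?_
    rintro ⟨u, a, ha, h⟩
    refine hex ⟨RatRips.translate g⁻¹ u, a, ha, fun k => ?_⟩
    have := h (k * g)
    rw [Finsupp.equivMapDomain_apply] at this
    simpa [RatRips.translate, Rips.translate_apply] using this

/-- A nonzero lattice point with vertices at mutual distance at most `s` has a direction in
`Z_s`. -/
theorem exists_direction {y : Γ →₀ ℕ} (h0 : y ≠ 0)
    (h : ∀ g ∈ y.support, ∀ k ∈ y.support, (l (g * k⁻¹) : ℝ) ≤ s) (z : RatRips l s) :
    ∃ a : ℝ, 0 < a ∧ ∀ g, (y g : ℝ) = a * (direction y z).point.coord g := by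
  set a : ℕ := y.sum fun _ n => n with ha
  have hpos : 0 < a := by
    obtain ⟨g, hg⟩ := Finsupp.support_nonempty_iff.2 h0
    refine (Nat.pos_of_ne_zero (Finsupp.mem_support_iff.1 hg)).trans_le ?_
    exact Finset.single_le_sum (f := fun g => y g) (fun _ _ => Nat.zero_le _) hg
  have hpos' : (0 : ℝ) < a := by exact_mod_cast hpos
  let c : Γ →₀ ℝ := y.mapRange (fun n : ℕ => (n : ℝ) / a) (by simp)
  have hc : ∀ g, c g = (y g : ℝ) / a := fun g => Finsupp.mapRange_apply ..
  have hcs : c.support ⊆ y.support := Finsupp.support_mapRange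
  let u : RatRips l s :=
    ⟨⟨c, fun g => by rw [hc]; positivity, by
      rw [Finsupp.sum_of_support_subset _ hcs _ (by simp)]
      simp only [hc]
      rw [← Finset.sum_div, div_eq_one_iff_eq hpos'.ne', ha, Finsupp.sum]
      push_cast
      rfl, fun g hg k hk => h g (hcs hg) k (hcs hk)⟩,
      fun g => ⟨(y g : ℚ) / a, by rw [hc]; push_cast; rfl⟩⟩
  have hu : ∀ g, (y g : ℝ) = a * u.point.coord g := fun g => by
    change (y g : ℝ) = a * c g
    rw [hc, mul_div_cancel₀ _ hpos'.ne']
  refine ⟨a, hpos', ?_⟩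
  rwa [direction_eq hpos' hu z]

open scoped Classical in
/-- The total weight in `v` of the lattice points with direction `u`. -/
def directionWeight (v : Γ →₀ ℝ) (z u : RatRips l s) : ℝ :=
  ∑ᶠ y : Γ →₀ ℕ, if direction y z = u then latticeWeight v y else 0

open scoped Classical in
theorem directionWeight_eq_sum {v : Γ →₀ ℝ} (hv : ∀ g, 0 ≤ v g) (z u : RatRips l s)
    {S : Finset (Γ →₀ ℕ)} (hS : latticeBox v ⊆ S) :
    directionWeight v z u = ∑ y ∈ S, if direction y z = u then latticeWeight v y else 0 := by
  refine finsum_eq_sum_of_support_subset _ fun y hy => hS (mem_latticeBox_of_ne hv fun h => hy ?_)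
  change (if direction y z = u then latticeWeight v y else 0) = 0
  rw [h, ite_self]

theorem directionWeight_nonneg (v : Γ →₀ ℝ) (z u : RatRips l s) : 0 ≤ directionWeight v z u :=
  finsum_nonneg fun y => by
    split_ifs
    · exact latticeWeight_nonneg v y
    · exact le_rfl

theorem exists_of_directionWeight_ne {v : Γ →₀ ℝ} (hv : ∀ g, 0 ≤ v g) {z u : RatRips l s}
    (h : directionWeight v z u ≠ 0) : ∃ y ∈ latticeBox v, direction y z = u ∧
      ∀ g, |v g - y g| < 1 := by
  classical
  rw [directionWeight_eq_sum hv z u subset_rfl] at h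
  obtain ⟨y, hy, h1⟩ := Finset.exists_ne_zero_of_sum_ne_zero h
  split_ifs at h1 with h2
  · exact ⟨y, hy, h2, abs_lt_one_of_latticeWeight_ne h1⟩
  · exact absurd rfl h1

theorem exists_finset_directionWeight {v : Γ →₀ ℝ} (hv : ∀ g, 0 ≤ v g) (z : RatRips l s) {R : ℕ}
    (hR : v.support.card ≤ R) : ∃ F : Finset (RatRips l s), F.card ≤ 2 ^ R ∧
      (∀ u ∉ F, directionWeight v z u = 0) ∧ HasSum (directionWeight v z) 1 := by
  classical
  set F := (latticeBox v).image fun y => direction y z with hF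
  have h0 : ∀ u ∉ F, directionWeight v z u = 0 := fun u hu => by
    by_contra h
    obtain ⟨y, hy, h1, -⟩ := exists_of_directionWeight_ne hv h
    exact hu (Finset.mem_image.2 ⟨y, hy, h1⟩)
  refine ⟨F, Finset.card_image_le.trans (card_latticeBox_le hR), h0, ?_⟩
  have h1 : ∑ u ∈ F, directionWeight v z u = 1 := by
    rw [← sum_latticeBox hv, Finset.sum_congr rfl fun u _ =>
      directionWeight_eq_sum hv z u subset_rfl, Finset.sum_comm]
    refine Finset.sum_congr rfl fun y hy => ?_
    rw [Finset.sum_ite_eq, if_pos (Finset.mem_image_of_mem _ hy)]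
  rw [← h1]
  exact hasSum_sum_of_ne_finset_zero h0

theorem abs_directionWeight_sub_le {v v' : Γ →₀ ℝ} (hv : ∀ g, 0 ≤ v g) (hv' : ∀ g, 0 ≤ v' g)
    (z u : RatRips l s) {R : ℕ} (hR : v.support.card ≤ R) (hR' : v'.support.card ≤ R) :
    |directionWeight v z u - directionWeight v' z u| ≤ 2 ^ (R + 1) * l1dist v v' := by
  classical
  rw [directionWeight_eq_sum hv z u Finset.subset_union_left,
    directionWeight_eq_sum hv' z u (Finset.subset_union_right (s₁ := latticeBox v)),
    ← Finset.sum_sub_distrib]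
  refine (Finset.abs_sum_le_sum_abs _ _).trans ?_
  calc _ ≤ ∑ _y ∈ latticeBox v ∪ latticeBox v', l1dist v v' := by
        refine Finset.sum_le_sum fun y _ => ?_
        split_ifs
        · exact abs_latticeWeight_sub_le _ _ _
        · rw [sub_zero, abs_zero]
          exact l1dist_nonneg _ _
    _ ≤ _ := by
        rw [Finset.sum_const, nsmul_eq_mul]
        refine mul_le_mul_of_nonneg_right ?_ (l1dist_nonneg _ _)
        have h1 : (latticeBox v ∪ latticeBox v').card ≤ 2 ^ (R + 1) := by
          refine (Finset.card_union_le _ _).trans ?_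
          have e1 := card_latticeBox_le hR
          have e2 := card_latticeBox_le hR'
          rw [pow_succ]
          lia
        exact_mod_cast h1

theorem directionWeight_translate (g : Γ) (v : Γ →₀ ℝ) (z u : RatRips l s) :
    directionWeight (Finsupp.equivMapDomain (Equiv.mulRight g) v) (RatRips.translate g z)
      (RatRips.translate g u) = directionWeight v z u := by
  classical
  refine (finsum_comp_equiv (Finsupp.domCongr (M := ℕ) (Equiv.mulRight g)).toEquiv).symm.trans ?_
  refine finsum_congr fun y => ?_
  have e1 : (Finsupp.domCongr (M := ℕ) (Equiv.mulRight g)).toEquiv y =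
    Finsupp.equivMapDomain (Equiv.mulRight g) y := rfl
  rw [e1, direction_translate, latticeWeight_equivMapDomain]
  simp only [EmbeddingLike.apply_eq_iff_eq]

end Lattice

theorem abs_sqrt_sub_sqrt_le (a b : ℝ) : |√a - √b| ≤ √|a - b| := by
  wlog h : b ≤ a generalizing a b
  · rw [abs_sub_comm, abs_sub_comm a]
    exact this b a (le_of_not_ge h)
  rw [abs_of_nonneg (sub_nonneg.2 (Real.sqrt_le_sqrt h)), abs_of_nonneg (sub_nonneg.2 h),
    sub_le_iff_le_add]
  rcases le_total b 0 with hb | hb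
  · rw [Real.sqrt_eq_zero_of_nonpos hb, add_zero]
    exact Real.sqrt_le_sqrt (by linarith)
  · refine (Real.sqrt_le_left (by positivity)).2 ?_
    rw [add_sq, Real.sq_sqrt hb, Real.sq_sqrt (sub_nonneg.2 h)]
    have : 0 ≤ 2 * √(a - b) * √b := by positivity
    linarith

end LpRoe
end

noncomputable section

/-! ### A frame adapted to a compact symmetric subset of the groupoid -/

namespace LpRoe

theorem l1dist_add_le {Γ : Type*} (y y' w w' : Γ →₀ ℝ) :
    l1dist (y + w) (y' + w') ≤ l1dist y y' + l1dist w w' := by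
  classical
  have e1 : l1dist (y + w) (y' + w) = l1dist y y' := by rw [l1dist, add_sub_add_right_eq_sub, l1dist]
  have e2 : l1dist (y' + w) (y' + w') = l1dist w w' := by
    rw [l1dist, add_sub_add_left_eq_sub, l1dist]
  rw [← e1, ← e2]
  exact l1dist_triangle _ _ _

section Neighbourhood

variable {Γ : Type*} [Group Γ] {l : ProperLength Γ} {s : ℝ}

/-- The elements of `Γ` at distance at most `s` from some vertex of `z`. -/
def nbhd (z : RatRips l s) : Finset Γ :=
  Set.Finite.toFinset (s := ⋃ h ∈ z.point.supp, {γ | (l (h * γ⁻¹) : ℝ) ≤ s}) <|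
    z.point.supp.finite_toSet.biUnion fun h _ =>
      (l.finite_ball_real s).preimage (f := fun γ => h * γ⁻¹)
        ((mul_right_injective h).comp inv_injective).injOn

theorem mem_nbhd {z : RatRips l s} {γ : Γ} :
    γ ∈ nbhd z ↔ ∃ h ∈ z.point.supp, (l (h * γ⁻¹) : ℝ) ≤ s := by
  simp [nbhd]

theorem supp_subset_nbhd (z : RatRips l s) : z.point.supp ⊆ nbhd z := fun g hg =>
  mem_nbhd.2 ⟨g, hg, z.point.length_le g hg g hg⟩

theorem ProperLength.mul_le_real (l : ProperLength Γ) {g h k : Γ} {a b : ℝ}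
    (h1 : (l (g * h⁻¹) : ℝ) ≤ a) (h2 : (l (h * k⁻¹) : ℝ) ≤ b) : (l (g * k⁻¹) : ℝ) ≤ a + b := by
  have h3 : l (g * k⁻¹) ≤ l (g * h⁻¹) + l (h * k⁻¹) := by
    have := l.mul_le (g * h⁻¹) (h * k⁻¹)
    rwa [mul_assoc, inv_mul_cancel_left] at this
  have h4 : (l (g * k⁻¹) : ℝ) ≤ l (g * h⁻¹) + l (h * k⁻¹) := by exact_mod_cast h3
  linarith

theorem ProperLength.mul_inv_comm (l : ProperLength Γ) (g h : Γ) : l (g * h⁻¹) = l (h * g⁻¹) := by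
  rw [← l.inv_eq, mul_inv_rev, inv_inv]

theorem length_le_of_mem_nbhd {z : RatRips l s} {g h : Γ} (hg : g ∈ nbhd z) (hh : h ∈ z.point.supp) :
    (l (g * h⁻¹) : ℝ) ≤ 2 * s := by
  obtain ⟨k, hk, h1⟩ := mem_nbhd.1 hg
  rw [l.mul_inv_comm] at h1
  have := l.mul_le_real h1 (z.point.length_le k hk h hh)
  linarith

variable (l s) in
/-- The number of elements of the ball of radius `2s`. -/
def ballCard : ℕ := (l.finite_ball_real (2 * s)).toFinset.card

theorem card_nbhd_le (z : RatRips l s) : (nbhd z).card ≤ ballCard l s := by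
  obtain ⟨h, hh⟩ := z.point.supp_nonempty
  refine Finset.card_le_card_of_injOn (fun g => g * h⁻¹) (fun g hg => ?_)
    (mul_left_injective h⁻¹).injOn
  exact (Set.Finite.mem_toFinset _).2 (length_le_of_mem_nbhd hg hh)

theorem RatRips.translate_coord (g : Γ) (z : RatRips l s) :
    (RatRips.translate g z).point.coord = Finsupp.equivMapDomain (Equiv.mulRight g) z.point.coord :=
  Finsupp.ext fun _ => rfl

theorem Rips.coord_le_one (z : Rips l s) (g : Γ) : z.coord g ≤ 1 := by
  classical
  rw [← z.sum_eq_one]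
  by_cases hg : g ∈ z.coord.support
  · exact Finset.single_le_sum (f := z.coord) (fun g _ => z.nonneg g) hg
  · rw [Finsupp.notMem_support_iff.1 hg]
    exact Finset.sum_nonneg fun g _ => z.nonneg g

end Neighbourhood

section Vector

variable {Γ : Type*} [Group Γ] {l : ProperLength Γ} {s : ℝ} {X : Type*} [MulAction Γ X]

open scoped Classical in
/-- The average over the vertices `h` of `z` of the functions `γ ↦ f(h γ⁻¹, γ x)`. -/
def hull (f : Γ → X → ℝ≥0) (z : RatRips l s) (x : X) : Γ →₀ ℝ :=
  Finsupp.indicator (nbhd z) fun γ _ => z.point.coord.sum fun h a => a * f (h * γ⁻¹) (γ • x)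

/-- The vectors interpolating between `t z` for `k = 0` and `t` times the hull for `k ≥ t`. -/
def frameVector (f : Γ → X → ℝ≥0) (t : ℝ≥0) (k : ℕ) (z : RatRips l s) (x : X) : Γ →₀ ℝ :=
  ((t - k : ℝ≥0) : ℝ) • z.point.coord + ((min (k : ℝ≥0) t : ℝ≥0) : ℝ) • hull f z x

/-- The frame obtained by rounding the vectors `frameVector f t k z x` to points of `Z_s`. -/
def frameWeight (f : Γ → X → ℝ≥0) (t : ℝ≥0) (k : ℕ) (u z : RatRips l s) (x : X) : ℝ :=
  √(directionWeight (frameVector f t k z x) z u)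

variable {f : Γ → X → ℝ≥0}

theorem support_hull_subset (f : Γ → X → ℝ≥0) (z : RatRips l s) (x : X) :
    (hull f z x).support ⊆ nbhd z := Finsupp.support_indicator_subset _ _

theorem hull_nonneg (f : Γ → X → ℝ≥0) (z : RatRips l s) (x : X) (γ : Γ) : 0 ≤ hull f z x γ := by
  classical
  rw [hull, Finsupp.indicator_apply]
  split_ifs
  · exact Finset.sum_nonneg fun h _ => mul_nonneg (z.point.nonneg h) (f _ _).2
  · exact le_rfl

theorem hull_le_one (hf : ∀ γ x, f γ x ≤ 1) (z : RatRips l s) (x : X) (γ : Γ) :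
    hull f z x γ ≤ 1 := by
  classical
  rw [hull, Finsupp.indicator_apply]
  split_ifs
  · rw [← z.point.sum_eq_one]
    exact Finset.sum_le_sum fun h _ => mul_le_of_le_one_right (z.point.nonneg h) (hf _ _)
  · exact zero_le_one

theorem hull_apply (hf : ∀ γ x, f γ x ≠ 0 → (l γ : ℝ) ≤ s) (z : RatRips l s) (x : X) (γ : Γ) :
    hull f z x γ = z.point.coord.sum fun h a => a * f (h * γ⁻¹) (γ • x) := by
  classical
  rw [hull, Finsupp.indicator_apply]
  split_ifs with hγ
  · rfl
  · refine (Finset.sum_eq_zero fun h hh => ?_).symm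
    have : f (h * γ⁻¹) (γ • x) = 0 := by
      by_contra h0
      exact hγ (mem_nbhd.2 ⟨h, hh, hf _ _ h0⟩)
    simp only [this, NNReal.coe_zero, mul_zero]

theorem exists_of_hull_ne {z : RatRips l s} {x : X} {γ : Γ} (h : hull f z x γ ≠ 0) :
    ∃ h ∈ z.point.supp, f (h * γ⁻¹) (γ • x) ≠ 0 := by
  classical
  rw [hull, Finsupp.indicator_apply] at h
  split_ifs at h
  · obtain ⟨k, hk, h0⟩ := Finset.exists_ne_zero_of_sum_ne_zero h
    refine ⟨k, hk, fun h1 => h0 ?_⟩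
    simp only [h1, NNReal.coe_zero, mul_zero]
  · exact absurd rfl h

theorem l1dist_hull_le (hf : ∀ γ x, f γ x ≤ 1) (z : RatRips l s) (x : X) :
    l1dist (hull f z x) 0 ≤ ballCard l s := by
  rw [l1dist_eq (support_hull_subset f z x) (by simp)]
  refine (Finset.sum_le_card_nsmul _ _ 1 fun g _ => ?_).trans ?_
  · rw [Finsupp.zero_apply, sub_zero, abs_of_nonneg (hull_nonneg f z x g)]
    exact hull_le_one hf z x g
  · rw [nsmul_eq_mul, mul_one]
    exact_mod_cast card_nbhd_le z

theorem hull_translate (hf : ∀ γ x, f γ x ≠ 0 → (l γ : ℝ) ≤ s) (g : Γ) (z : RatRips l s) (x : X) :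
    hull f (RatRips.translate g z) (g⁻¹ • x) =
      Finsupp.equivMapDomain (Equiv.mulRight g) (hull f z x) := by
  refine Finsupp.ext fun γ => ?_
  rw [Finsupp.equivMapDomain_apply, hull_apply hf, hull_apply hf, RatRips.translate_coord,
    Finsupp.sum_equivMapDomain]
  refine Finset.sum_congr rfl fun h _ => ?_
  simp [mul_assoc, smul_smul]

theorem frameVector_apply (t : ℝ≥0) (k : ℕ) (z : RatRips l s) (x : X) (γ : Γ) :
    frameVector f t k z x γ = ((t - k : ℝ≥0) : ℝ) * z.point.coord γ +
      ((min (k : ℝ≥0) t : ℝ≥0) : ℝ) * hull f z x γ := rfl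

theorem support_frameVector_subset (f : Γ → X → ℝ≥0) (t : ℝ≥0) (k : ℕ) (z : RatRips l s) (x : X) :
    (frameVector f t k z x).support ⊆ nbhd z := by
  classical
  refine Finsupp.support_add.trans (Finset.union_subset ?_ ?_)
  · exact Finsupp.support_smul.trans (supp_subset_nbhd z)
  · exact Finsupp.support_smul.trans (support_hull_subset f z x)

theorem card_support_frameVector_le (f : Γ → X → ℝ≥0) (t : ℝ≥0) (k : ℕ) (z : RatRips l s) (x : X) :
    (frameVector f t k z x).support.card ≤ ballCard l s :=
  (Finset.card_le_card (support_frameVector_subset f t k z x)).trans (card_nbhd_le z)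

theorem frameVector_nonneg (f : Γ → X → ℝ≥0) (t : ℝ≥0) (k : ℕ) (z : RatRips l s) (x : X) (γ : Γ) :
    0 ≤ frameVector f t k z x γ :=
  add_nonneg (mul_nonneg (NNReal.coe_nonneg _) (z.point.nonneg γ))
    (mul_nonneg (NNReal.coe_nonneg _) (hull_nonneg f z x γ))

theorem sub_add_min (t : ℝ≥0) (k : ℕ) :
    ((t - k : ℝ≥0) : ℝ) + ((min (k : ℝ≥0) t : ℝ≥0) : ℝ) = t := by
  rw [← NNReal.coe_add, min_comm, tsub_add_min]

theorem frameVector_le (hf : ∀ γ x, f γ x ≤ 1) (t : ℝ≥0) (k : ℕ) (z : RatRips l s) (x : X) (γ : Γ) :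
    frameVector f t k z x γ ≤ t := by
  rw [frameVector_apply, ← sub_add_min t k]
  exact add_le_add (mul_le_of_le_one_right (NNReal.coe_nonneg _) (z.point.coord_le_one γ))
    (mul_le_of_le_one_right (NNReal.coe_nonneg _) (hull_le_one hf z x γ))

theorem l1dist_frameVector_le (hf : ∀ γ x, f γ x ≤ 1) {t t' : ℝ≥0} {k k' : ℕ} {c : ℝ}
    (z : RatRips l s) (x : X) (h1 : |((t - k : ℝ≥0) : ℝ) - ((t' - k' : ℝ≥0) : ℝ)| ≤ c)
    (h2 : |((min (k : ℝ≥0) t : ℝ≥0) : ℝ) - ((min (k' : ℝ≥0) t' : ℝ≥0) : ℝ)| ≤ c) :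
    l1dist (frameVector f t k z x) (frameVector f t' k' z x) ≤ c * (1 + ballCard l s) := by
  refine (l1dist_add_le _ _ _ _).trans ?_
  rw [l1dist_smul_left, l1dist_smul_left, z.point.l1dist_zero, mul_one, mul_add, mul_one]
  refine add_le_add h1 ?_
  exact mul_le_mul h2 (l1dist_hull_le hf z x) (l1dist_nonneg _ _) ((abs_nonneg _).trans h2)

/-- The frame vectors depend on time with a Lipschitz constant independent of `k`, `z` and `x`. -/
theorem l1dist_frameVector_time_le (hf : ∀ γ x, f γ x ≤ 1) (t t' : ℝ≥0) (k : ℕ)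
    (z : RatRips l s) (x : X) : l1dist (frameVector f t k z x) (frameVector f t' k z x) ≤
      dist t t' * (1 + ballCard l s) := by
  refine l1dist_frameVector_le hf z x ?_ ?_
  · rw [NNReal.coe_sub_def, NNReal.coe_sub_def, NNReal.dist_eq]
    refine (abs_max_sub_max_le_max _ _ _ _).trans ?_
    simp
  · rw [NNReal.coe_min, NNReal.coe_min, NNReal.dist_eq]
    refine (abs_min_sub_min_le_max _ _ _ _).trans ?_
    simp

theorem l1dist_frameVector_succ_le (hf : ∀ γ x, f γ x ≤ 1) (t : ℝ≥0) (k : ℕ)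
    (z : RatRips l s) (x : X) : l1dist (frameVector f t k z x) (frameVector f t (k + 1) z x) ≤
      1 + ballCard l s := by
  rw [← one_mul (1 + (ballCard l s : ℝ))]
  refine l1dist_frameVector_le hf z x ?_ ?_
  · rw [NNReal.coe_sub_def, NNReal.coe_sub_def]
    refine (abs_max_sub_max_le_max _ _ _ _).trans ?_
    push_cast
    simp
  · rw [NNReal.coe_min, NNReal.coe_min]
    refine (abs_min_sub_min_le_max _ _ _ _).trans ?_
    push_cast
    simp

theorem frameVector_translate (hf : ∀ γ x, f γ x ≠ 0 → (l γ : ℝ) ≤ s) (t : ℝ≥0) (k : ℕ) (g : Γ)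
    (z : RatRips l s) (x : X) : frameVector f t k (RatRips.translate g z) (g⁻¹ • x) =
      Finsupp.equivMapDomain (Equiv.mulRight g) (frameVector f t k z x) := by
  refine Finsupp.ext fun γ => ?_
  rw [frameVector_apply, hull_translate hf, RatRips.translate_coord]
  rfl

/-- The points `u` of nonzero weight are `z` itself or have their vertices near those of `z`. -/
theorem mem_support_or_eq_of_direction {t : ℝ≥0} {k : ℕ} {z : RatRips l s} {x : X} {y : Γ →₀ ℕ}
    (hy : y ∈ latticeBox (frameVector f t k z x)) {g : Γ}
    (hg : g ∈ (direction y z).point.supp) :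
    g ∈ (frameVector f t k z x).support ∨ g ∈ z.point.supp := by
  rcases direction_cases y z with ⟨a, ha, h⟩ | h
  · refine Or.inl (support_subset_of_mem_latticeBox hy (Finsupp.mem_support_iff.2 fun h0 => ?_))
    have h1 := h g
    rw [h0, Nat.cast_zero, eq_comm, mul_eq_zero] at h1
    exact (Finsupp.mem_support_iff.1 hg) (h1.resolve_left ha.ne')
  · rw [h] at hg
    exact Or.inr hg

theorem frameWeight_ne {t : ℝ≥0} {k : ℕ} {u z : RatRips l s} {x : X}
    (h : frameWeight f t k u z x ≠ 0) : ∃ y ∈ latticeBox (frameVector f t k z x),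
      direction y z = u ∧ ∀ g, |frameVector f t k z x g - y g| < 1 :=
  exists_of_directionWeight_ne (frameVector_nonneg f t k z x) fun h0 => h (by
    rw [frameWeight, h0, Real.sqrt_zero])

/-- The modulus of continuity in time of the frame weights is that of the square root. -/
theorem abs_frameWeight_sub_le (hf : ∀ γ x, f γ x ≤ 1) (t t' : ℝ≥0) (k : ℕ) (u z : RatRips l s)
    (x : X) : |frameWeight f t k u z x - frameWeight f t' k u z x| ≤
      √(2 ^ (ballCard l s + 1) * (dist t t' * (1 + ballCard l s))) := by
  refine (abs_sqrt_sub_sqrt_le _ _).trans (Real.sqrt_le_sqrt ?_)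
  refine (abs_directionWeight_sub_le (frameVector_nonneg f t k z x) (frameVector_nonneg f t' k z x)
    z u (card_support_frameVector_le f t k z x) (card_support_frameVector_le f t' k z x)).trans ?_
  exact mul_le_mul_of_nonneg_left (l1dist_frameVector_time_le hf t t' k z x) (by positivity)

variable [TopologicalSpace X] [ContinuousConstSMul Γ X]

theorem continuous_frameVector (hf : ∀ γ, Continuous (f γ)) (t : ℝ≥0) (k : ℕ) (z : RatRips l s)
    (γ : Γ) : Continuous fun x => frameVector f t k z x γ := by
  classical
  simp only [frameVector_apply, hull, Finsupp.indicator_apply]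
  refine continuous_const.add (continuous_const.mul ?_)
  split_ifs
  · exact continuous_finsetSum _ fun h _ => continuous_const.mul
      (NNReal.continuous_coe.comp ((hf _).comp (continuous_const_smul γ)))
  · exact continuous_const

theorem continuous_frameWeight (hf : ∀ γ, Continuous (f γ)) (t : ℝ≥0) (k : ℕ)
    (u z : RatRips l s) : Continuous (frameWeight f t k u z) := by
  refine Real.continuous_sqrt.comp (continuous_iff_continuousAt.2 fun x₀ => ?_)
  refine tendsto_iff_dist_tendsto_zero.2 (squeeze_zero (fun _ => dist_nonneg) (fun x =>
    abs_directionWeight_sub_le (frameVector_nonneg f t k z x) (frameVector_nonneg f t k z x₀)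
      z u (card_support_frameVector_le f t k z x) (card_support_frameVector_le f t k z x₀)) ?_)
  have hc : Continuous fun x => 2 ^ (ballCard l s + 1) *
      l1dist (frameVector f t k z x) (frameVector f t k z x₀) := by
    refine continuous_const.mul ?_
    simp only [fun x => l1dist_eq (support_frameVector_subset f t k z x)
      (support_frameVector_subset f t k z x₀)]
    exact continuous_finsetSum _ fun γ _ =>
      ((continuous_frameVector hf t k z γ).sub continuous_const).abs
  have := hc.tendsto x₀
  rwa [l1dist_self, mul_zero] at this

theorem isFrame_frameWeight (hfc : ∀ γ, Continuous (f γ)) (hf1 : ∀ γ x, f γ x ≤ 1)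
    (hf : ∀ γ x, f γ x ≠ 0 → (l γ : ℝ) ≤ s) (t : ℝ≥0) :
    IsFrame (l := l) (s := s) (frameWeight f t) (2 ^ ballCard l s) := by
  have hv := fun k (z : RatRips l s) x => exists_finset_directionWeight (frameVector_nonneg f t k z x) z
    (card_support_frameVector_le f t k z x)
  refine ⟨fun k u z x => ?_, fun k z x => ?_, fun k z x => ?_, fun k u z => ?_, fun k z => ?_,
    fun k => ?_, fun k g u z x => ?_⟩
  · obtain ⟨-, -, -, hF⟩ := hv k z x
    rw [frameWeight, abs_of_nonneg (Real.sqrt_nonneg _), Real.sqrt_le_one]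
    exact le_hasSum hF u fun w _ => directionWeight_nonneg _ _ _
  · obtain ⟨F, hF, h0, -⟩ := hv k z x
    exact ⟨F, hF, fun u hu => by rw [frameWeight, h0 u hu, Real.sqrt_zero]⟩
  · obtain ⟨-, -, -, hF⟩ := hv k z x
    simpa only [frameWeight, Real.sq_sqrt (directionWeight_nonneg _ _ _)] using hF
  · exact continuous_frameWeight hfc t k u z
  · classical
    refine (((nbhd z).finsupp fun _ => Finset.range (⌈t⌉₊ + 1)).finite_toSet.image
      fun y => direction y z).subset ?_
    rintro u ⟨x, hx⟩
    obtain ⟨y, hy, h1, h2⟩ := frameWeight_ne hx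
    refine ⟨y, Finset.mem_coe.2 (Finset.mem_finsupp_iff.2 ⟨?_, fun g _ => ?_⟩), h1⟩
    · exact (support_subset_of_mem_latticeBox hy).trans (support_frameVector_subset f t k z x)
    · rw [Finset.mem_range]
      have e1 := (abs_lt.1 (h2 g)).1
      have e2 := frameVector_le hf1 t k z x g
      have e3 : (t : ℝ) ≤ ⌈t⌉₊ := by exact_mod_cast Nat.le_ceil t
      have e4 : (y g : ℝ) < (⌈t⌉₊ + 1 : ℕ) := by
        push_cast
        linarith
      exact_mod_cast e4
  · refine ⟨⌈2 * s⌉₊, fun u z x hx g hg h hh => ?_⟩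
    obtain ⟨y, hy, rfl, -⟩ := frameWeight_ne hx
    have h1 : g ∈ nbhd z := (mem_support_or_eq_of_direction hy hg).elim
      (fun h => support_frameVector_subset f t k z x h) fun h => supp_subset_nbhd z h
    have h2 : (l (g * h⁻¹) : ℝ) ≤ ⌈2 * s⌉₊ := (length_le_of_mem_nbhd h1 hh).trans (Nat.le_ceil _)
    exact_mod_cast h2
  · rw [frameWeight, frameVector_translate hf, directionWeight_translate, frameWeight]

end Vector

section Adapted

variable {Γ : Type*} [Group Γ] [TopologicalSpace Γ] {l : ProperLength Γ} {s : ℝ} {X : Type*}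
  [MulAction Γ X] [TopologicalSpace X] {K K' : Set (TransGroupoid Γ X)} {f : Γ → X → ℝ≥0}
  {G : OpenSubgroupoid Γ X}

omit [TopologicalSpace Γ] in
/-- Over related points the hull of `z` is the function `γ ↦ f(k γ⁻¹, γ x)` for any single vertex
`k` of `w`, by the invariance of `f`. -/
theorem IsInvariantBump.hull_eq (h : IsInvariantBump K K' f) (hf : ∀ γ x, f γ x ≠ 0 → (l γ : ℝ) ≤ s)
    {z w : RatRips l s} {x : X} (hzw : Related K z w x) {k : Γ} (hk : k ∈ w.point.supp) (γ : Γ) :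
    hull f z x γ = f (k * γ⁻¹) (γ • x) := by
  rw [hull_apply hf]
  have h1 : ∀ g ∈ z.point.supp, f (g * γ⁻¹) (γ • x) = f (k * γ⁻¹) (γ • x) := fun g hg => by
    have := h.invariant (g * k⁻¹) (k * γ⁻¹) (γ • x) (by
      rw [smul_smul, inv_mul_cancel_right]
      exact hzw g hg k hk)
    rwa [mul_assoc, inv_mul_cancel_left] at this
  calc _ = z.point.coord.sum fun _ a => a * f (k * γ⁻¹) (γ • x) :=
        Finset.sum_congr rfl fun g hg => by simp only [h1 g hg]
    _ = _ := by rw [← Finsupp.sum_mul, z.point.sum_eq_one, one_mul]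

omit [TopologicalSpace Γ] in
/-- The hull depends only on the component of `z`, which is why the interpolation to it brings related
points together. -/
theorem IsInvariantBump.hull_eq_hull (h : IsInvariantBump K K' f) (hK : IsSymmetric K)
    (hf : ∀ γ x, f γ x ≠ 0 → (l γ : ℝ) ≤ s) {z w : RatRips l s} {x : X} (hzw : Related K z w x) :
    hull f z x = hull f w x := by
  obtain ⟨g, hg⟩ := z.point.supp_nonempty
  obtain ⟨k, hk⟩ := w.point.supp_nonempty
  refine Finsupp.ext fun γ => ?_
  rw [h.hull_eq hf hzw hk, h.hull_eq hf (hzw.symm hK) hg]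
  have := h.invariant (g * k⁻¹) (k * γ⁻¹) (γ • x) (by
    rw [smul_smul, inv_mul_cancel_right]
    exact hzw g hg k hk)
  rw [mul_assoc, inv_mul_cancel_left] at this
  rw [this]

omit [TopologicalSpace Γ] in
theorem IsInvariantBump.vertex (h : IsInvariantBump K K' f) (hK : IsSymmetric K)
    {t : ℝ≥0} {k : ℕ} {z w : RatRips l s} {x : X} (hzw : Related K z w x) {g : Γ}
    (hg : g ∈ (frameVector f t k z x).support ∨ g ∈ z.point.supp) :
    ∃ h ∈ z.point.supp, (h * g⁻¹, g • x) ∈ K ∪ K' := by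
  by_cases hz : g ∈ z.point.supp
  · refine ⟨g, hz, Or.inl ?_⟩
    rw [mul_inv_cancel]
    exact hzw.one_mem hK hz
  · have h1 := Finsupp.mem_support_iff.1 (hg.resolve_right hz)
    rw [frameVector_apply, show z.point.coord g = 0 from Finsupp.notMem_support_iff.1 hz, mul_zero,
      zero_add] at h1
    obtain ⟨k, hk, h2⟩ := exists_of_hull_ne (right_ne_zero_of_mul h1)
    exact ⟨k, hk, Or.inr (h.mem_of_ne _ _ h2)⟩

/-- Over related points all vertices of the frame vector lie in one simplex, because the groupoid
elements connecting them are in `G`. -/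
theorem IsInvariantBump.length_le (h : IsInvariantBump K K' f) (hK : IsSymmetric K)
    (hG : ∀ q ∈ G.carrier, (l q.1 : ℝ) ≤ s) (hKG : K ⊆ G.carrier) (hKG' : K' ⊆ G.carrier)
    {t : ℝ≥0} {k : ℕ} {z w : RatRips l s} {x : X} (hzw : Related K z w x) {g g' : Γ}
    (hg : g ∈ (frameVector f t k z x).support) (hg' : g' ∈ (frameVector f t k z x).support) :
    (l (g * g'⁻¹) : ℝ) ≤ s := by
  obtain ⟨a, ha, h1⟩ := h.vertex hK hzw (Or.inl hg)
  obtain ⟨b, hb, h2⟩ := h.vertex hK hzw (Or.inl hg')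
  obtain ⟨c, hc⟩ := w.point.supp_nonempty
  have hsub := Set.union_subset hKG hKG'
  have hmul : ∀ p q r : Γ, (p * q⁻¹, q • x) ∈ G.carrier → (q * r⁻¹, r • x) ∈ G.carrier →
      (p * r⁻¹, r • x) ∈ G.carrier := fun p q r h1 h2 => by
    have := G.mul_mem (p * q⁻¹) (q * r⁻¹) (r • x) (by rwa [smul_smul, inv_mul_cancel_right]) h2
    rwa [mul_assoc, inv_mul_cancel_left] at this
  have h3 : (g * a⁻¹, a • x) ∈ G.carrier := by
    have := G.inv_mem _ _ (hsub h1)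
    rwa [mul_inv_rev, inv_inv, smul_smul, inv_mul_cancel_right] at this
  exact hG _ (hmul g a g' h3 (hmul a c g' (hKG (hzw a ha c hc))
    (hmul c b g' (hKG (hzw.symm hK c hc b hb)) (hsub h2))))

/-- Rounding moves each of the at most `ballCard l s` nonzero coordinates by less than one. -/
theorem IsInvariantBump.near (h : IsInvariantBump K K' f) (hK : IsSymmetric K)
    (hG : ∀ q ∈ G.carrier, (l q.1 : ℝ) ≤ s) (hKG : K ⊆ G.carrier) (hKG' : K' ⊆ G.carrier)
    {t : ℝ≥0} {k : ℕ} {u z w : RatRips l s} {x : X} (hzw : Related K z w x)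
    (hu : frameWeight f t k u z x ≠ 0) :
    Near (1 + ballCard l s) (frameVector f t k z x) u.point := by
  obtain ⟨y, hy, rfl, h1⟩ := frameWeight_ne hu
  have hys := support_subset_of_mem_latticeBox hy
  obtain ⟨a, ha⟩ : ∃ a : ℝ, ∀ g, (y g : ℝ) = a * (direction y z).point.coord g := by
    by_cases hy0 : y = 0
    · exact ⟨0, fun g => by simp [hy0]⟩
    · obtain ⟨a, -, ha⟩ := exists_direction hy0 (fun g hg g' hg' =>
        h.length_le hK hG hKG hKG' hzw (hys hg) (hys hg')) z
      exact ⟨a, ha⟩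
  refine ⟨a, ?_⟩
  have hs1 : (a • (direction y z).point.coord).support ⊆ nbhd z := fun g hg => by
    rw [Finsupp.mem_support_iff, Finsupp.smul_apply, smul_eq_mul, ← ha, Nat.cast_ne_zero] at hg
    exact support_frameVector_subset f t k z x (hys (Finsupp.mem_support_iff.2 hg))
  rw [l1dist_eq hs1 (support_frameVector_subset f t k z x)]
  refine (Finset.sum_le_card_nsmul _ _ 1 fun g _ => ?_).trans ?_
  · rw [Finsupp.smul_apply, smul_eq_mul, ← ha, abs_sub_comm]
    exact (h1 g).le
  · rw [nsmul_eq_mul, mul_one]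
    have : ((nbhd z).card : ℝ) ≤ ballCard l s := by exact_mod_cast card_nbhd_le z
    linarith

theorem IsInvariantBump.isAdapted (h : IsInvariantBump K K' f) (hK : IsSymmetric K)
    (hG : ∀ q ∈ G.carrier, (l q.1 : ℝ) ≤ s) (hKG : K ⊆ G.carrier) (hKG' : K' ⊆ G.carrier) :
    IsAdapted (l := l) (s := s) K (K ∪ K') (frameWeight f) (frameVector f) (1 + ballCard l s) := by
  have hf : ∀ γ x, f γ x ≠ 0 → (l γ : ℝ) ≤ s := fun γ x h0 => hG _ (hKG' (h.mem_of_ne γ x h0))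
  refine ⟨Set.subset_union_left, by positivity, fun hzw h0 g hg => ?_,
    fun hzw h0 => h.near hK hG hKG hKG' hzw h0, fun t z x => ?_,
    fun _ => l1dist_frameVector_succ_le h.le_one _ _ _ _, fun {t k z w x} hzw => ?_,
    fun {t k z w x} hzw => ?_⟩
  · obtain ⟨y, hy, rfl, -⟩ := frameWeight_ne h0
    exact h.vertex hK hzw (mem_support_or_eq_of_direction hy hg)
  · refine Finsupp.ext fun γ => ?_
    rw [frameVector_apply]
    simp
  · refine (l1dist_add_le _ _ _ _).trans ?_
    rw [h.hull_eq_hull hK hf hzw, l1dist_self, add_zero, l1dist_smul,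
      abs_of_nonneg (NNReal.coe_nonneg _), Rips.dist_def]
  · obtain ⟨g, hg⟩ := z.point.supp_nonempty
    obtain ⟨k', hk'⟩ := w.point.supp_nonempty
    have h1 : (1 : ℝ) ≤ (hull f z x).sum fun _ a => a := by
      have h2 : hull f z x g = 1 := by
        rw [h.hull_eq hf hzw hk', h.eq_one _ _ (hzw.symm hK k' hk' g hg), NNReal.coe_one]
      rw [← h2]
      refine Finset.single_le_sum (f := hull f z x) (fun γ _ => hull_nonneg f z x γ)
        (Finsupp.mem_support_iff.2 ?_)
      rw [h2]
      exact one_ne_zero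
    rw [frameVector, Finsupp.sum_add_index' (fun _ => rfl) (fun _ _ _ => rfl), Rips.smul_sum,
      Finsupp.sum_smul_index (fun _ => rfl), ← Finsupp.mul_sum, ← sub_add_min t k]
    exact add_le_add_right (le_mul_of_one_le_right (NNReal.coe_nonneg _) h1) _

end Adapted

end LpRoe
end

noncomputable section

/-! ### Finite subsets of the obstruction algebra are absorbed by swindles -/

namespace LpRoe

section Countable

variable {Γ : Type*} [Group Γ] {l : ProperLength Γ} {s : ℝ}

instance [Countable Γ] : Countable (RatRips l s) := by
  choose q hq using fun z : RatRips l s => z.rational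
  let φ : RatRips l s → Γ →₀ ℚ := fun z => Finsupp.onFinset z.point.supp (q z) fun g hg =>
    Finsupp.mem_support_iff.2 fun h0 => hg (by
      have := hq z g
      rw [h0] at this
      exact_mod_cast this.symm)
  refine Function.Injective.countable (f := φ) fun z w h => RatRips.ext (Rips.ext
    (Finsupp.ext fun g => ?_))
  have h1 : q z g = q w g := DFunLike.congr_fun h g
  rw [hq z, h1, ← hq w]

theorem RatRips.nonempty (hs : 0 ≤ s) : Nonempty (RatRips l s) := by
  classical
  refine ⟨⟨⟨Finsupp.single 1 1, fun g => ?_, by simp, fun g hg h hh => ?_⟩, fun g => ?_⟩⟩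
  · rw [Finsupp.single_apply]
    split_ifs <;> norm_num
  · have hg' := Finset.mem_singleton.1 (Finsupp.support_single_subset hg)
    have hh' := Finset.mem_singleton.1 (Finsupp.support_single_subset hh)
    rw [hg', hh', mul_inv_cancel, (l.eq_zero_iff 1).2 rfl]
    exact_mod_cast hs
  · exact ⟨if 1 = g then 1 else 0, by rw [Finsupp.single_apply]; split_ifs <;> simp⟩

end Countable

section Final

variable {Γ X : Type*} [Group Γ] [TopologicalSpace Γ]
  [DiscreteTopology Γ] [TopologicalSpace X] [T2Space X] [MulAction Γ X]
  [ContinuousConstSMul Γ X] {l : ProperLength Γ} {p : ℝ≥0∞} [Fact (1 ≤ p)] {s : ℝ}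

theorem isUCFamily_of_modulus {E F : Type*} [NormedAddCommGroup E] [NormedSpace ℂ E]
    [NormedAddCommGroup F] [NormedSpace ℂ F] {V : ℝ≥0 → E →L[ℂ] F} {C : ℝ} {ω : ℝ → ℝ}
    (hω : Tendsto ω (𝓝 0) (𝓝 0)) (hV : ∀ t, ‖V t‖ ≤ C)
    (h : ∀ t t', ‖V t - V t'‖ ≤ ω (dist t t')) : IsUCFamily V := by
  refine ⟨⟨C, hV⟩, Metric.uniformContinuous_iff.2 fun ε hε => ?_⟩
  obtain ⟨δ, hδ, h1⟩ := Metric.eventually_nhds_iff.1 (hω.eventually (gt_mem_nhds hε))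
  refine ⟨δ, hδ, fun {t t'} htt => ?_⟩
  rw [dist_eq_norm]
  refine (h t t').trans_lt (h1 ?_)
  rwa [dist_zero_right, Real.norm_of_nonneg dist_nonneg]

theorem tendsto_modulus (a b c : ℝ) : Tendsto (fun d : ℝ => a * √(b * (d * c))) (𝓝 0) (𝓝 0) := by
  have : Continuous fun d : ℝ => a * √(b * (d * c)) := by fun_prop
  have h := this.tendsto 0
  rwa [zero_mul, mul_zero, Real.sqrt_zero, mul_zero] at h

variable {f : Γ → X → ℝ≥0}

omit [TopologicalSpace Γ] [DiscreteTopology Γ] [T2Space X] in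
theorem isUCFamily_synthesis (hp : p ≠ ⊤) (e : ℕ × RatRips l s × ℕ ≃ ℕ)
    (hfc : ∀ γ, Continuous (f γ)) (hf1 : ∀ γ x, f γ x ≤ 1)
    (hf : ∀ γ x, f γ x ≠ 0 → (l γ : ℝ) ≤ s) :
    IsUCFamily fun t => (synthesis hp e (frameWeight f t) : AmpSpace l s X p →L[ℂ] _) :=
  isUCFamily_of_modulus (tendsto_modulus _ _ _)
    (fun t => norm_synthesis_le hp e (isFrame_frameWeight hfc hf1 hf t)) fun t t' =>
      norm_synthesis_sub_le hp e (isFrame_frameWeight hfc hf1 hf t)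
        (isFrame_frameWeight hfc hf1 hf t') (Real.sqrt_nonneg _)
        fun k u z x => abs_frameWeight_sub_le hf1 t t' k u z x

omit [TopologicalSpace Γ] [DiscreteTopology Γ] [T2Space X] in
theorem isUCFamily_analysis (hp : p ≠ ⊤) (e : ℕ × RatRips l s × ℕ ≃ ℕ)
    (hfc : ∀ γ, Continuous (f γ)) (hf1 : ∀ γ x, f γ x ≤ 1)
    (hf : ∀ γ x, f γ x ≠ 0 → (l γ : ℝ) ≤ s) :
    IsUCFamily fun t => (analysis hp e (frameWeight f t) : _ →L[ℂ] AmpSpace l s X p) :=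
  isUCFamily_of_modulus (tendsto_modulus _ _ _)
    (fun t => norm_analysis_le hp e (isFrame_frameWeight hfc hf1 hf t)) fun t t' =>
      norm_analysis_sub_le hp e (isFrame_frameWeight hfc hf1 hf t)
        (isFrame_frameWeight hfc hf1 hf t') (Real.sqrt_nonneg _)
        fun k u z x => abs_frameWeight_sub_le hf1 t t' k u z x

/-- Finitely many elements of `ℂ_{L,0}[G; s]` have their supports in a common compact symmetric
subset of `G`, and the swindle along a frame adapted to that subset absorbs them. -/
theorem absorbed_of_mem_algebraicObstruction [Countable Γ] [CompactSpace X] (hp : p ≠ ⊤)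
    (hs : 0 ≤ s) {G : OpenSubgroupoid Γ X} (hG : ∀ q ∈ G.carrier, (l q.1 : ℝ) ≤ s)
    {F : Set (obstructionAlgebra l s p G)} (hF : F.Finite)
    (hFG : ∀ a ∈ F, (a : BddFun (RipsSpace l s X p →L[ℂ] RipsSpace l s X p)) ∈
      algebraicObstruction l s p G) : KTheory.Absorbed F := by
  classical
  choose! K₀ hK₀ using fun a ha => (hFG a ha).2.2
  obtain ⟨K, hK₀K, hKc, hKG, hK⟩ := exists_isSymmetric G
    (hF.isCompact_biUnion fun a ha => (hK₀ a ha).1)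
    (Set.iUnion₂_subset fun a ha => (hK₀ a ha).2.1)
  obtain ⟨K', f, hK'c, hK'G, hf⟩ := exists_isInvariantBump hG hKc hKG hK
  have hfs : ∀ γ x, f γ x ≠ 0 → (l γ : ℝ) ≤ s := fun γ x h => hG _ (hK'G (hf.mem_of_ne γ x h))
  have hβ := fun t => isFrame_frameWeight (s := s) hf.continuous hf.le_one hfs t
  have := RatRips.nonempty (l := l) hs
  obtain ⟨e⟩ : Nonempty (ℕ × RatRips l s × ℕ ≃ ℕ) := nonempty_equiv_of_countable
  have hV := isUCFamily_synthesis (p := p) hp e hf.continuous hf.le_one hfs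
  have hV' := isUCFamily_analysis (p := p) hp e hf.continuous hf.le_one hfs
  have hVV : ∀ t ξ, analysis hp e (frameWeight f t)
      (synthesis (p := p) hp e (frameWeight f t) ξ) = ξ := fun t ξ =>
    DFunLike.congr_fun (analysis_comp_synthesis hp e (hβ t)) ξ
  have hA := hf.isAdapted hK hG hKG hK'G
  have hle : algebraicObstruction l s p G ≤ obstructionAlgebra l s p G :=
    NonUnitalSubalgebra.le_topologicalClosure _
  have hcorner : ∀ {b : BddFun (RipsSpace l s X p →L[ℂ] RipsSpace l s X p)}
      (hb : b ∈ algebraicObstruction l s p G), (∀ t, support (b t) ⊆ K) →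
      ∀ i j, corner hp hV hV' i j ⟨b, hb.1.1⟩ ∈ algebraicObstruction l s p G := fun hb hbK i j =>
    corner_mem_algebraicObstruction hp e hβ hV hV' (fun _ => rfl) (fun _ => rfl) hG hK hKc
      (hKc.union hK'c) (Set.union_subset hKG hK'G) hA hb.1.1 hb hbK i j
  refine (isSwindle_corner hp hV hV' hVV).absorbed isClosed_uniformlyContinuousFun
    (NonUnitalSubalgebra.isClosed_topologicalClosure _) fun a ha => ?_
  have haK : ∀ t, support ((a : BddFun (RipsSpace l s X p →L[ℂ] RipsSpace l s X p)) t) ⊆ K :=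
    fun t => ((Set.subset_iUnion _ t).trans (hK₀ a ha).2.2).trans
      ((Set.subset_biUnion_of_mem ha).trans hK₀K)
  refine ⟨⟨a, (hFG a ha).1.1⟩, ⟨fun i j => hle (hcorner (hFG a ha) haK i j), fun τ => hle ?_⟩, rfl⟩
  refine hcorner (delay_mem_algebraicObstruction (hFG a ha) τ) (fun t => haK (t - τ)) 2 2

theorem dense_algebraicObstruction (G : OpenSubgroupoid Γ X) :
    Dense {a : obstructionAlgebra l s p G |
      (a : BddFun (RipsSpace l s X p →L[ℂ] RipsSpace l s X p)) ∈ algebraicObstruction l s p G} := by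
  refine dense_iff_closure_eq.2 (Set.eq_univ_of_forall fun a => closure_subtype.2 ?_)
  have h : (Subtype.val '' {a : obstructionAlgebra l s p G |
      (a : BddFun (RipsSpace l s X p →L[ℂ] RipsSpace l s X p)) ∈ algebraicObstruction l s p G}) =
      algebraicObstruction l s p G := by
    refine Set.Subset.antisymm ?_ fun b hb => ?_
    · rintro _ ⟨b, hb, rfl⟩
      exact hb
    · exact ⟨⟨b, NonUnitalSubalgebra.le_topologicalClosure _ hb⟩, hb, rfl⟩
  rw [h]
  exact a.2

end Final

end LpRoe
end

theorem mainTheorem2 {Γ X : Type*} [Group Γ] [Countable Γ] [TopologicalSpace Γ]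
    [DiscreteTopology Γ] [TopologicalSpace X] [CompactSpace X] [T2Space X] [MulAction Γ X]
    [ContinuousConstSMul Γ X] (l : LpRoe.ProperLength Γ) (p : ℝ≥0∞) [Fact (1 ≤ p)] (hp : p ≠ ⊤)
    (s : ℝ) (hs : 0 ≤ s) (G : LpRoe.OpenSubgroupoid Γ X)
    (hG : ∀ q ∈ G.carrier, (l q.1 : ℝ) ≤ s) :
    Subsingleton (KTheory.K0 (LpRoe.obstructionAlgebra l s p G)) ∧
      Subsingleton (KTheory.K1 (LpRoe.obstructionAlgebra l s p G)) := by
  have : CompleteSpace (LpRoe.obstructionAlgebra l s p G) :=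
    (NonUnitalSubalgebra.isClosed_topologicalClosure _).completeSpace_coe
  have h : ∀ F : Set (LpRoe.obstructionAlgebra l s p G), F.Finite → F ⊆ _ → KTheory.Absorbed F :=
    fun F hF hFG => LpRoe.absorbed_of_mem_algebraicObstruction hp hs hG hF hFG
  exact ⟨KTheory.subsingleton_K0 (LpRoe.dense_algebraicObstruction G) h,
    KTheory.subsingleton_K1 (LpRoe.dense_algebraicObstruction G) h⟩
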